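/- **Setting.** Fix $T,\rho>0$ and coordinates $(z,x,y)\in \mathbb{R}/T\mathbb{Z}\times\mathbb{R}/\mathbb{Z}\times(-\rho,\rho)$ near a Morse–Bott torus $\{y=0\}$, with contact form $\lambda=h\,(dz-y\,dx)$, where $h>0$ is smooth and $h=1$, $dh=0$ along $y=0$. The Reeb orbits $t\mapsto(t,x,0)$ are Morse–Bott: every solution of the Reeb flow linearized along such an orbit that closes up after time $T$ is tangent to $\{y=0\}$. On the symplectization, with extra coordinate $a\in\mathbb{R}$, let $J$ be a smooth $a$-invariant $\lambda$-compatible almost complex structure ($J\partial_a=R_\lambda$, $JR_\lambda=-\partial_a$, $J$ preserves $\ker\lambda$, $d\lambda(\cdot,J\cdot)>0$ there) with $J\partial_x=\partial_y$ along $y=0$. Let $f:\mathbb{R}/\mathbb{Z}\to\mathbb{R}$ be a smooth Morse function whose only critical points are a minimum at $0$ and a maximum at $1/2$. For $\delta>0$ let $\lambda_\delta=e^{\delta f(x)}\lambda$, and let $J_\delta$ be the almost complex structure that agrees with $J$ on $\ker\lambda=\ker\lambda_\delta$ and satisfies $J_\delta\partial_a=R_{\lambda_\delta}$, $J_\delta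 R_{\lambda_\delta}=-\partial_a$. For a smooth map $u=(a,z,x,y)$ from $[0,\infty)\times\mathbb{R}/T\mathbb{Z}$ that covers the $z$-circle once in $t$ (and has $x(s,\cdot)$ null-homotopic; $z$ and $x$ are lifted to $\mathbb{R}$) put $Y=(a-s,\,z-t,\,x,\,y)$. Let $PY$ be, for each $s$, the $L^2(\mathbb{R}/T\mathbb{Z})$-orthogonal projection of $Y(s,\cdot)$ to the constant combinations of $\partial_a,\partial_z,\partial_x$ (the kernel of the asymptotic operator), i.e. $PY=(\overline{a-s},\overline{z-t},\overline{x},0)$ with bars denoting averages over $t$. Put $QY=Y-PY$. **Theorem (inf conv).** There is $r>0$, depending only on the local geometry $(T,\rho,h,J)$ of the Morse–Bott torus, such that the following holds. Given $f$, an integer $k\ge 0$, $\eta>0$ and constants $B_1,B_2,\dots$, there are $\varepsilon>0$ and $\delta_0>0$, and for every $p>2$ a constant $C>0$ (independent of $\delta$ and $u$), such that for all $0<\delta<\delta_0$ and all maps $u=u_\delta$ as above with 1. $\partial_s u+J_\delta(u)\,\partial_t u=0$; 2. as $s\to\infty$, $u$ converges to the simply covered Reeb orbit over a critical point $x_0$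 of $f$: $a\to\infty$ and $(z,x,y)(s,t)-(t+c_0,x_0,0)\to0$ uniformly in $t$, for some constant $c_0$; 3. for $s>0$, $x$ stays at distance at least $\eta$ from the other critical point of $f$; 4. for $s>0$, $|z-t|\le\varepsilon$, $y$ and its derivatives of order at most $k$ are bounded by $\varepsilon$, the derivatives of $x$ of orders $1,\dots,k$ are bounded by $\varepsilon$, and all other derivatives of order $n\ge1$ of $a,z,x,y$ are bounded by $B_n$; there are a constant $c$ and a solution $x_p:\mathbb{R}\to\mathbb{R}$ of $x_p'=\delta f'(x_p)$ such that, for every $s_0\in\mathbb{R}$, there is a constant $c'$ for which the five functions $$QY,\qquad y,\qquad z-t+c,\qquad x-x_p(s),\qquad a-c'-\int_{s_0}^s e^{\delta f(x_p(s'))}\,ds'$$ and all their derivatives in $(s,t)$ of order at most $k$ are bounded, for all $s>0$, by $$C\,\|QY(0,\cdot)\|_{L^2(\mathbb{R}/T\mathbb{Z})}^{2/p}\,e^{-rs}.$$ -/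

import Mathlib

open Filter Topology
open scoped ContDiff

noncomputable section

namespace MorseBott

/-! ## Contact forms `H (dz - y dx)` in coordinates `(z, x, y)` -/

/-- Coordinates `(z, x, y)` near a Morse-Bott torus, lifted to the universal cover of
`S¹ × S¹ × ℝ`. -/
abbrev Pt : Type := ℝ × ℝ × ℝ

/-- Coordinates `(a, z, x, y)` on the symplectization. -/
abbrev SPt : Type := ℝ × Pt

/-- The vector field `∂/∂a`. -/
def dA : SPt := (1, 0)

/-- The vector field `∂/∂x`. -/
def dX : SPt := (0, 0, 1, 0)

/-- The vector field `∂/∂y`. -/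
def dY : SPt := (0, 0, 0, 1)

/-- The `1`-form `H (dz - y dx)` at the point `p = (z, x, y)`. -/
def form (H : Pt → ℝ) (p : Pt) : Pt →L[ℝ] ℝ :=
  H p • (ContinuousLinearMap.fst ℝ ℝ (ℝ × ℝ)
    - p.2.2 • (ContinuousLinearMap.fst ℝ ℝ ℝ).comp (ContinuousLinearMap.snd ℝ ℝ (ℝ × ℝ)))

/-- The exterior derivative of `H (dz - y dx)`, evaluated on two (constant) vectors. -/
def dform (H : Pt → ℝ) (p v w : Pt) : ℝ :=
  fderiv ℝ (fun q => form H q w) p v - fderiv ℝ (fun q => form H q v) p w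

/-- The Reeb vector field of `H (dz - y dx)`; see `form_reeb` and `dform_reeb`. -/
def reeb (H : Pt → ℝ) (p : Pt) : Pt :=
  (1 / H p + p.2.2 * fderiv ℝ H p (0, 0, 1) / H p ^ 2,
    fderiv ℝ H p (0, 0, 1) / H p ^ 2,
    -(fderiv ℝ H p (0, 1, 0) + p.2.2 * fderiv ℝ H p (1, 0, 0)) / H p ^ 2)

theorem form_apply (H : Pt → ℝ) (p v : Pt) : form H p v = H p * (v.1 - p.2.2 * v.2.1) := by
  simp [form]

theorem form_reeb {H : Pt → ℝ} {p : Pt} (h0 : H p ≠ 0) : form H p (reeb H p) = 1 := by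
  rw [form_apply]
  simp only [reeb]
  field_simp
  ring

theorem dform_eq {H : Pt → ℝ} {p : Pt} (hd : DifferentiableAt ℝ H p) (v w : Pt) :
    dform H p v w = fderiv ℝ H p v * (w.1 - p.2.2 * w.2.1)
      - fderiv ℝ H p w * (v.1 - p.2.2 * v.2.1) + H p * (v.2.1 * w.2.2 - v.2.2 * w.2.1) := by
  have key : ∀ v w : Pt, fderiv ℝ (fun q => form H q w) p v
      = fderiv ℝ H p v * (w.1 - p.2.2 * w.2.1) - H p * (v.2.2 * w.2.1) := by
    intro v w
    have e : (fun q => form H q w) = fun q : Pt => H q * (w.1 - q.2.2 * w.2.1) := by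
      funext q
      exact form_apply H q w
    have hy : HasFDerivAt (fun q : Pt => q.2.2)
        ((ContinuousLinearMap.snd ℝ ℝ ℝ).comp (ContinuousLinearMap.snd ℝ ℝ (ℝ × ℝ))) p :=
      ((ContinuousLinearMap.snd ℝ ℝ ℝ).comp (ContinuousLinearMap.snd ℝ ℝ (ℝ × ℝ))).hasFDerivAt
    have hm : HasFDerivAt (fun q : Pt => H q * (w.1 - q.2.2 * w.2.1)) _ p :=
      hd.hasFDerivAt.mul ((hy.mul_const w.2.1).const_sub w.1)
    rw [e, hm.fderiv]
    simp
    ring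
  unfold dform
  rw [key, key]
  ring

theorem dform_reeb {H : Pt → ℝ} {p : Pt} (hd : DifferentiableAt ℝ H p) (h0 : H p ≠ 0)
    (v : Pt) : dform H p (reeb H p) v = 0 := by
  have lin : ∀ w : Pt, fderiv ℝ H p w = w.1 * fderiv ℝ H p (1, 0, 0)
      + w.2.1 * fderiv ℝ H p (0, 1, 0) + w.2.2 * fderiv ℝ H p (0, 0, 1) := by
    intro w
    have : w = w.1 • ((1, 0, 0) : Pt) + w.2.1 • ((0, 1, 0) : Pt) + w.2.2 • ((0, 0, 1) : Pt) := by
      ext <;> simp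
    conv_lhs => rw [this]
    simp only [map_add, map_smul, smul_eq_mul]
  rw [dform_eq hd, lin v, lin (reeb H p)]
  simp only [reeb]
  field_simp
  ring

/-- `J` is an almost complex structure on the symplectization, independent of `a`, over the
region `|y| < ρ`, compatible with the contact form `H (dz - y dx)`: it is smooth, it maps `∂/∂a` to
the Reeb field and the Reeb field to `-∂/∂a`, and it restricts to a complex structure on the contact
planes on which `d(H (dz - y dx)) (·, J ·)` is positive. -/
structure IsCompatible (ρ : ℝ) (H : Pt → ℝ) (J : Pt → SPt →L[ℝ] SPt) : Prop where
  smooth : ContDiffOn ℝ ∞ J {p | |p.2.2| < ρ}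
  map_dA : ∀ p : Pt, |p.2.2| < ρ → J p dA = (0, reeb H p)
  map_reeb : ∀ p : Pt, |p.2.2| < ρ → J p (0, reeb H p) = -dA
  map_contact : ∀ p v : Pt, |p.2.2| < ρ → form H p v = 0 →
    (J p (0, v)).1 = 0 ∧ form H p (J p (0, v)).2 = 0
  sq_contact : ∀ p v : Pt, |p.2.2| < ρ → form H p v = 0 → J p (J p (0, v)) = -(0, v)
  pos : ∀ p v : Pt, |p.2.2| < ρ → form H p v = 0 → v ≠ 0 → 0 < dform H p v (J p (0, v)).2

/-- The local geometry of a Morse-Bott torus `{y = 0}`: the neighbourhood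
`(ℝ / T ℤ) × (ℝ / ℤ) × (-ρ, ρ)` with coordinates `(z, x, y)`, the contact form
`h (dz - y dx)` with `h = 1` and `dh = 0` on the torus, and a compatible almost complex structure
`J` on the symplectization with `J ∂/∂x = ∂/∂y` over the torus. All data are written on the universal
cover. -/
structure Torus where
  T : ℝ
  T_pos : 0 < T
  ρ : ℝ
  ρ_pos : 0 < ρ
  h : Pt → ℝ
  h_smooth : ContDiffOn ℝ ∞ h {p | |p.2.2| < ρ}
  h_pos : ∀ p : Pt, |p.2.2| < ρ → 0 < h p
  h_periodic_z : ∀ z x y : ℝ, h (z + T, x, y) = h (z, x, y)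
  h_periodic_x : ∀ z x y : ℝ, h (z, x + 1, y) = h (z, x, y)
  h_torus : ∀ z x : ℝ, h (z, x, 0) = 1
  dh_torus : ∀ z x : ℝ, fderiv ℝ h (z, x, 0) = 0
  /-- The Morse-Bott condition: along each orbit `t ↦ (t, x, 0)` of the torus, a solution of the
  linearized Reeb flow that closes up after the period is tangent to the torus. -/
  morse_bott : ∀ (x : ℝ) (ζ : ℝ → Pt),
    (∀ t, HasDerivAt ζ (fderiv ℝ (reeb h) (t, x, 0) (ζ t)) t) → ζ T = ζ 0 →
    ∀ t, (ζ t).2.2 = 0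
  J : Pt → SPt →L[ℝ] SPt
  J_compatible : IsCompatible ρ h J
  J_periodic_z : ∀ z x y : ℝ, J (z + T, x, y) = J (z, x, y)
  J_periodic_x : ∀ z x y : ℝ, J (z, x + 1, y) = J (z, x, y)
  J_torus : ∀ z x : ℝ, J (z, x, 0) dX = dY

/-- A smooth Morse function on `ℝ / ℤ` with a minimum at `0`, a maximum at `1/2`, and no other
critical point. -/
structure IsPerturbingFunction (f : ℝ → ℝ) : Prop where
  smooth : ContDiff ℝ ∞ f
  periodic : ∀ x, f (x + 1) = f x
  critical : ∀ x, deriv f x = 0 ↔ ∃ n : ℤ, x = n / 2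
  minimum : 0 < deriv (deriv f) 0
  maximum : deriv (deriv f) (1 / 2) < 0

namespace Torus

variable (M : Torus) (f : ℝ → ℝ) (δ : ℝ)

/-- The conformal factor of the perturbed contact form `e^{δ f} h (dz - y dx)`. -/
def hδ (p : Pt) : ℝ := Real.exp (δ * f p.2.1) * M.h p

/-- The perturbed almost complex structure `J_δ`: it exchanges `∂/∂a` and the Reeb field `R_δ` of
`λ_δ = e^{δ f} h (dz - y dx)` (`∂/∂a ↦ R_δ ↦ -∂/∂a`) and it agrees with `J` on the contact planes.
In a formula, `(α, v) ↦ α R_δ - λ_δ(v) ∂/∂a + J (v - λ_δ(v) R_δ)`. -/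
def Jδ (p : Pt) : SPt →L[ℝ] SPt :=
  (ContinuousLinearMap.fst ℝ ℝ Pt).smulRight ((0, reeb (M.hδ f δ) p) : SPt)
    - ((form (M.hδ f δ) p).comp (ContinuousLinearMap.snd ℝ ℝ Pt)).smulRight dA
    + (M.J p).comp ((ContinuousLinearMap.inr ℝ ℝ Pt).comp
        (ContinuousLinearMap.snd ℝ ℝ Pt - ((form (M.hδ f δ) p).comp
          (ContinuousLinearMap.snd ℝ ℝ Pt)).smulRight (reeb (M.hδ f δ) p)))

variable {M f δ}

theorem Jδ_apply (p : Pt) (V : SPt) : M.Jδ f δ p V =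
    V.1 • ((0, reeb (M.hδ f δ) p) : SPt) - form (M.hδ f δ) p V.2 • dA
      + M.J p (0, V.2 - form (M.hδ f δ) p V.2 • reeb (M.hδ f δ) p) := rfl

theorem form_hδ (p v : Pt) : form (M.hδ f δ) p v = Real.exp (δ * f p.2.1) * form M.h p v := by
  simp only [form_apply, hδ]
  ring

theorem hδ_pos {p : Pt} (hp : |p.2.2| < M.ρ) : 0 < M.hδ f δ p :=
  mul_pos (Real.exp_pos _) (M.h_pos p hp)

theorem isOpen_region (ρ : ℝ) : IsOpen {p : Pt | |p.2.2| < ρ} :=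
  isOpen_lt (by fun_prop) continuous_const

theorem hδ_smooth (hf : ContDiff ℝ ∞ f) : ContDiffOn ℝ ∞ (M.hδ f δ) {p | |p.2.2| < M.ρ} := by
  have h1 : ContDiff ℝ ∞ fun p : Pt => Real.exp (δ * f p.2.1) := by fun_prop
  exact h1.contDiffOn.mul M.h_smooth

/-- `J_δ` agrees with `J` on the contact planes. -/
theorem Jδ_contact {p v : Pt} (hv : form M.h p v = 0) : M.Jδ f δ p (0, v) = M.J p (0, v) := by
  simp [Jδ_apply, form_hδ, hv]

theorem reeb_smooth {ρ : ℝ} {H : Pt → ℝ} (hH : ContDiffOn ℝ ∞ H {p | |p.2.2| < ρ})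
    (h0 : ∀ p : Pt, |p.2.2| < ρ → 0 < H p) : ContDiffOn ℝ ∞ (reeb H) {p | |p.2.2| < ρ} := by
  have hd : ContDiffOn ℝ ∞ (fderiv ℝ H) {p | |p.2.2| < ρ} :=
    hH.fderiv_of_isOpen (isOpen_region ρ) (by simp)
  have hv : ∀ v : Pt, ContDiffOn ℝ ∞ (fun p => fderiv ℝ H p v) {p | |p.2.2| < ρ} :=
    fun v => hd.clm_apply contDiffOn_const
  have hy : ContDiffOn ℝ ∞ (fun p : Pt => p.2.2) {p | |p.2.2| < ρ} := by
    exact ContDiff.contDiffOn (by fun_prop)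
  have hne : ∀ p ∈ {p : Pt | |p.2.2| < ρ}, H p ≠ 0 := fun p hp => (h0 p hp).ne'
  have hne2 : ∀ p ∈ {p : Pt | |p.2.2| < ρ}, H p ^ 2 ≠ 0 := fun p hp => pow_ne_zero 2 (hne p hp)
  unfold reeb
  refine ContDiffOn.prodMk ?_ (ContDiffOn.prodMk ?_ ?_)
  · exact (contDiffOn_const.div hH hne).add ((hy.mul (hv _)).div (hH.pow 2) hne2)
  · exact (hv _).div (hH.pow 2) hne2
  · exact ((hv _).add (hy.mul (hv _))).neg.div (hH.pow 2) hne2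

/-- `J_δ` is compatible with `λ_δ`. -/
theorem Jδ_compatible (hf : ContDiff ℝ ∞ f) : IsCompatible M.ρ (M.hδ f δ) (M.Jδ f δ) := by
  have hJ := M.J_compatible
  have hc : ∀ p v : Pt, form (M.hδ f δ) p v = 0 → form M.h p v = 0 := by
    intro p v hv
    rw [form_hδ] at hv
    exact (mul_eq_zero.mp hv).resolve_left (Real.exp_pos _).ne'
  have hform : ∀ p, |p.2.2| < M.ρ → form (M.hδ f δ) p (reeb (M.hδ f δ) p) = 1 :=
    fun p hp => form_reeb (hδ_pos hp).ne'
  refine ⟨?_, ?_, ?_, ?_, ?_, ?_⟩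
  · have hH := hδ_smooth (M := M) (δ := δ) hf
    have hR := reeb_smooth hH (fun p hp => hδ_pos hp)
    have hF : ContDiffOn ℝ ∞ (form (M.hδ f δ)) {p | |p.2.2| < M.ρ} := by
      unfold form
      refine hH.smul (ContDiff.contDiffOn ?_)
      fun_prop
    have hF2 : ContDiffOn ℝ ∞ (fun p => (form (M.hδ f δ) p).comp
        (ContinuousLinearMap.snd ℝ ℝ Pt)) {p | |p.2.2| < M.ρ} := hF.clm_comp contDiffOn_const
    unfold Jδ
    refine ContDiffOn.add (ContDiffOn.sub ?_ ?_) (hJ.smooth.clm_comp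
      (contDiffOn_const.clm_comp (contDiffOn_const.sub ?_)))
    · exact contDiffOn_const.smulRight (contDiffOn_const.prodMk hR)
    · exact hF2.smulRight contDiffOn_const
    · exact hF2.smulRight hR
  · intro p hp
    have h00 : M.J p ((0 : ℝ), (0 : Pt)) = 0 := map_zero _
    simp [Jδ_apply, dA, h00]
  · intro p hp
    have h00 : M.J p ((0 : ℝ), (0 : Pt)) = 0 := map_zero _
    simp [Jδ_apply, hform p hp, h00]
  · intro p v hp hv
    rw [Jδ_contact (hc p v hv), form_hδ]
    obtain ⟨h1, h2⟩ := hJ.map_contact p v hp (hc p v hv)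
    exact ⟨h1, by rw [h2, mul_zero]⟩
  · intro p v hp hv
    obtain ⟨h1, h2⟩ := hJ.map_contact p v hp (hc p v hv)
    have e : M.J p (0, v) = (0, (M.J p (0, v)).2) := Prod.ext h1 rfl
    rw [Jδ_contact (hc p v hv), e, Jδ_contact h2, ← e]
    exact hJ.sq_contact p v hp (hc p v hv)
  · intro p v hp hv hv0
    have hv' := hc p v hv
    obtain ⟨h1, h2⟩ := hJ.map_contact p v hp hv'
    have hpos := hJ.pos p v hp hv' hv0
    have hdiff : DifferentiableAt ℝ M.h p :=
      (M.h_smooth.contDiffAt ((isOpen_region M.ρ).mem_nhds hp)).differentiableAt (by simp)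
    have hdiff' : DifferentiableAt ℝ (M.hδ f δ) p :=
      ((hδ_smooth hf).contDiffAt ((isOpen_region M.ρ).mem_nhds hp)).differentiableAt (by simp)
    have z : ∀ w : Pt, form M.h p w = 0 → w.1 - p.2.2 * w.2.1 = 0 := by
      intro w hw
      rw [form_apply] at hw
      exact (mul_eq_zero.mp hw).resolve_left (M.h_pos p hp).ne'
    rw [Jδ_contact hv']
    rw [dform_eq hdiff, z v hv', z _ h2] at hpos
    rw [dform_eq hdiff', z v hv', z _ h2, hδ]
    have := mul_pos (Real.exp_pos (δ * f p.2.1)) hpos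
    linarith

end Torus

/-! ## Half-cylinders near the torus

A map `u` from the half-cylinder `[0, ∞) × ℝ / T ℤ` to the symplectization of the neighbourhood is
written in the coordinates `(a, z, x, y)`, lifted to the universal covers, as a function of
`(s, t)`. Only its values for `s ≥ 0` matter. -/

/-- The `a`-component of `u`. -/
def aC (u : ℝ × ℝ → SPt) (q : ℝ × ℝ) : ℝ := (u q).1

/-- The `z`-component of `u`. -/
def zC (u : ℝ × ℝ → SPt) (q : ℝ × ℝ) : ℝ := (u q).2.1

/-- The `x`-component of `u`. -/
def xC (u : ℝ × ℝ → SPt) (q : ℝ × ℝ) : ℝ := (u q).2.2.1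

/-- The `y`-component of `u`. -/
def yC (u : ℝ × ℝ → SPt) (q : ℝ × ℝ) : ℝ := (u q).2.2.2

/-- `u` is a `J_δ`-holomorphic map from `[0, ∞) × ℝ / T ℤ` to the symplectization of the
neighbourhood of the torus, which covers the `z`-circle once in the `t` direction. -/
structure IsHolomorphic (M : Torus) (f : ℝ → ℝ) (δ : ℝ) (u : ℝ × ℝ → SPt) : Prop where
  smooth : ContDiffOn ℝ ∞ u {q | 0 ≤ q.1}
  periodic : ∀ s t : ℝ, 0 ≤ s → u (s, t + M.T) = u (s, t) + (0, M.T, 0, 0)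
  mem_region : ∀ q : ℝ × ℝ, 0 ≤ q.1 → |yC u q| < M.ρ
  equation : ∀ q : ℝ × ℝ, 0 < q.1 →
    fderiv ℝ u q (1, 0) + M.Jδ f δ (u q).2 (fderiv ℝ u q (0, 1)) = 0

/-- As `s → ∞`, `u` converges to the simply covered Reeb orbit `{x = x₀, y = 0}`: `a → ∞`, and
`(z, x, y)(s, ·)` converges uniformly to a parametrization `t ↦ (t + c, x₀, 0)` of the orbit. -/
def ConvergesToOrbit (u : ℝ × ℝ → SPt) (x₀ : ℝ) : Prop :=
  (∀ A : ℝ, ∀ᶠ s in atTop, ∀ t : ℝ, A ≤ aC u (s, t)) ∧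
  ∃ c : ℝ, TendstoUniformly (fun s t : ℝ => (u (s, t)).2) (fun t : ℝ => (t + c, x₀, 0)) atTop

/-- The average of `F (s, ·)` over the circle `ℝ / T ℤ`. -/
def mean (T : ℝ) (F : ℝ × ℝ → ℝ) (s : ℝ) : ℝ := (∫ t in (0 : ℝ)..T, F (s, t)) / T

/-- The map `Y = (a - s, z - t, x, y)`. -/
def mapY (u : ℝ × ℝ → SPt) (q : ℝ × ℝ) : SPt :=
  (aC u q - q.1, zC u q - q.2, xC u q, yC u q)

/-- `P Y`, where `P` is, on each circle `{s} × ℝ / T ℤ`, the `L²`-orthogonal projection to the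
kernel of the asymptotic operator, which consists of the constant combinations of `∂/∂a`, `∂/∂z`,
`∂/∂x`. -/
def mapPY (T : ℝ) (u : ℝ × ℝ → SPt) (q : ℝ × ℝ) : SPt :=
  (mean T (fun q => (mapY u q).1) q.1, mean T (fun q => (mapY u q).2.1) q.1,
    mean T (fun q => (mapY u q).2.2.1) q.1, 0)

/-- `Q Y = Y - P Y`, the non-kernel part of `Y`. -/
def mapQY (T : ℝ) (u : ℝ × ℝ → SPt) (q : ℝ × ℝ) : SPt := mapY u q - mapPY T u q

/-- The norm of `F (s, ·)` in `L²(ℝ / T ℤ, ℝ⁴)`. -/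
def normL2 (T : ℝ) (F : ℝ × ℝ → SPt) (s : ℝ) : ℝ :=
  Real.sqrt (∫ t in (0 : ℝ)..T, ((F (s, t)).1 ^ 2 + (F (s, t)).2.1 ^ 2
    + (F (s, t)).2.2.1 ^ 2 + (F (s, t)).2.2.2 ^ 2))

/-- The hypothesis that `u` is `ε`-close to the torus in `C^k`, with a priori bounds `B n` for the
derivatives of every order `n`: for `s > 0`, `|z - t| ≤ ε`, the function `y` and its derivatives of
order at most `k` and the derivatives of `x` of orders `1` to `k` are bounded by `ε`, and all other
derivatives of order `n ≥ 1` of the components of `u` are bounded by `B n`. -/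
structure IsClose (k : ℕ) (ε : ℝ) (B : ℕ → ℝ) (u : ℝ × ℝ → SPt) : Prop where
  z_close : ∀ q : ℝ × ℝ, 0 < q.1 → |zC u q - q.2| ≤ ε
  x_close : ∀ n, 1 ≤ n → n ≤ k → ∀ q : ℝ × ℝ, 0 < q.1 → ‖iteratedFDeriv ℝ n (xC u) q‖ ≤ ε
  y_close : ∀ n, n ≤ k → ∀ q : ℝ × ℝ, 0 < q.1 → ‖iteratedFDeriv ℝ n (yC u) q‖ ≤ ε
  a_bound : ∀ n, 1 ≤ n → ∀ q : ℝ × ℝ, 0 < q.1 → ‖iteratedFDeriv ℝ n (aC u) q‖ ≤ B n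
  z_bound : ∀ n, 1 ≤ n → ∀ q : ℝ × ℝ, 0 < q.1 → ‖iteratedFDeriv ℝ n (zC u) q‖ ≤ B n
  x_bound : ∀ n, k < n → ∀ q : ℝ × ℝ, 0 < q.1 → ‖iteratedFDeriv ℝ n (xC u) q‖ ≤ B n
  y_bound : ∀ n, k < n → ∀ q : ℝ × ℝ, 0 < q.1 → ‖iteratedFDeriv ℝ n (yC u) q‖ ≤ B n

/-- For `s > 0`, `x` stays at distance at least `η` from every critical point of `f` other than
(the translates by integers of) `x₀`. -/
def StaysAway (f : ℝ → ℝ) (η x₀ : ℝ) (u : ℝ × ℝ → SPt) : Prop :=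
  ∀ x₁ : ℝ, deriv f x₁ = 0 → (∀ n : ℤ, x₁ ≠ x₀ + n) →
    ∀ q : ℝ × ℝ, 0 < q.1 → η ≤ |xC u q - x₁|

/-- `F` and its derivatives of order at most `k` are bounded by `K e^{-r s}` for `s > 0`. -/
def ExpSmall {E : Type*} [NormedAddCommGroup E] [NormedSpace ℝ E] (k : ℕ) (K r : ℝ)
    (F : ℝ × ℝ → E) : Prop :=
  ∀ n, n ≤ k → ∀ q : ℝ × ℝ, 0 < q.1 → ‖iteratedFDeriv ℝ n F q‖ ≤ K * Real.exp (-r * q.1)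

/-- `ξ` is a trajectory of the gradient flow of `δ f`. -/
def IsGradientTrajectory (f : ℝ → ℝ) (δ : ℝ) (ξ : ℝ → ℝ) : Prop :=
  ∀ s, HasDerivAt ξ (δ * deriv f (ξ s)) s

end MorseBott

end

namespace MorseBott

/-! ## Interpolation -/

/-! Write w = z - t, Y = (a - s, w, x, y), and let κ be the rotation rate of the linearized Reeb
flow, ∂R/∂y = κ ∂/∂x on the torus. Expanding J_δ near y = 0 (`Torus.exists_Jδ_expansion`) turns the
holomorphic curve equation into ∂_s Y = A Y + (e^{δ f(x)} - 1, 0, δ f'(x), 0) + error, with A Y =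
(∂_t w, -∂_t a, ∂_t y, κ y - ∂_t x). The error is at most μ (|∂_t Y| + |y|), where μ is as small as
desired once ε and δ are small (`Torus.exists_cylinderData`). The operator A is symmetric. By the
Morse-Bott condition the integral of κ over the circle is nonzero (`Torus.integral_twist_ne_zero`),
so the kernel of A consists of the constants in a, z, x, and ‖A Y‖ controls ∂_t Y, y and the
non-kernel part QY (`CircleData.sq_y_le`, `CircleData.integral_sumSq_le`).

The energy is E(s) = ⟨A Y, Y⟩, which after integration by parts is ∫ (κ y² - 2 y ∂_t x - 2 w ∂_t a)
dt. Its derivative is 2 ⟨A Y, ∂_s Y⟩ + ∫ ∂_s κ y². The drift terms in e^{δ f} and δ f' are paired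
with ∂_t w and ∂_t y, which have mean zero, so only the oscillation of x over the circle enters.
Hence E' ≥ ‖A Y‖² (`CircleData.operatorSq_le_variation`), while |E| ≤ const ‖A Y‖²
(`CircleData.abs_energy_le`). Thus E' ≥ R |E|, and since E is bounded it decays like e^{-R s}, with
R depending only on the geometry (`decay_of_deriv_ge`).

Decay of E passes to its derivative by Landau interpolation: a function on a half-plane with bounded
derivatives has derivatives bounded by any power θ < 1 of its supremum (`halfPlane_interpolation`).
So E', hence ‖A Y‖², hence QY and y in the supremum norm decay (`exists_qPart_decay`), and
interpolating again gives their derivatives. At the start |E| ≤ const ‖QY‖^{1+θ}, because the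
averages of Y drop out of E (`exists_energy_le_qNorm`). The interpolations leave the power θ⁴ of the
norm and the rate θ³ R / 2; taking θ near 1 in terms of p gives the power 2/p and the rate R / 4.

It remains to follow the averages. On the line t = 0, w has exponentially small derivative, x solves
x' = δ f'(x) up to an exponentially small error, and a - s has derivative e^{δ f(x)} - 1 up to such
an error. Since the Lipschitz constant of δ f' is at most half the decay rate, an approximate
trajectory is shadowed by an exact one, found as a limit of solutions started at late times and
followed backward (`exists_asymptotic_trajectory`). -/

theorem rpow_le_mul_rpow {x b α β : ℝ} (hx : 0 ≤ x) (hxb : x ≤ b) (hα : 0 < α) (hαβ : α ≤ β) :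
    x ^ β ≤ b ^ (β - α) * x ^ α := by
  rcases hx.eq_or_lt with rfl | hx
  · rw [Real.zero_rpow hα.ne', Real.zero_rpow (hα.trans_le hαβ).ne']
    simp
  · have : x ^ β = x ^ (β - α) * x ^ α := by
      rw [← Real.rpow_add hx]
      ring_nf
    rw [this]
    gcongr

theorem le_rpow_inv_of_rpow_le {x y s : ℝ} (hx : 0 ≤ x) (hs : 0 < s) (h : x ^ s ≤ y) :
    x ≤ y ^ (1 / s) := by
  have h1 : (x ^ s) ^ (1 / s) ≤ y ^ (1 / s) :=
    Real.rpow_le_rpow (Real.rpow_nonneg hx s) h (by positivity)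
  rwa [← Real.rpow_mul hx, mul_one_div_cancel hs.ne', Real.rpow_one] at h1

/-- Induction on N through the shifted sequence: d 2 ≤ C (d 1)^θ with θ = N/(N+1) turns
log-convexity at 0 into (d 1)^(2-θ) ≤ A C d 0, and 1/(2-θ) = (N+1)/(N+2). -/
theorem logConvex_first_nat (A : ℝ) (hA : 0 ≤ A) (N : ℕ) : ∀ B : ℕ → ℝ, ∃ C : ℝ, 0 < C ∧
    ∀ d : ℕ → ℝ, (∀ j, 0 ≤ d j) → (∀ j, d j ≤ B j) →
      (∀ j, d (j + 1) ^ 2 ≤ A * d j * d (j + 2)) → d 1 ≤ C * d 0 ^ ((N : ℝ) / (N + 1)) := by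
  induction N with
  | zero =>
    intro B
    refine ⟨|B 1| + 1, by positivity, fun d _ hB _ => ?_⟩
    have := (hB 1).trans (le_abs_self _)
    simp
    linarith
  | succ N ih =>
    intro B
    obtain ⟨C, hC, h⟩ := ih fun j => B (j + 1)
    refine ⟨(A * C) ^ (((N + 1 : ℕ) : ℝ) / ((N + 1 : ℕ) + 1)) + 1, by positivity, ?_⟩
    intro d hd hB hA'
    have h1 := h (fun j => d (j + 1)) (fun j => hd _) (fun j => hB _) (fun j => hA' _)
    simp only [zero_add] at h1
    set θ : ℝ := (N : ℝ) / (N + 1) with hθ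
    have hN : (0 : ℝ) ≤ N := Nat.cast_nonneg N
    have hθ1 : 2 - θ = ((N : ℝ) + 2) / (N + 1) := by
      rw [hθ]; field_simp; ring
    have hpos : 0 < 2 - θ := by rw [hθ1]; positivity
    have hexp : ((N + 1 : ℕ) : ℝ) / ((N + 1 : ℕ) + 1) = 1 / (2 - θ) := by
      rw [hθ1]; push_cast; field_simp; ring
    rw [hexp]
    have key : d 1 ^ (2 - θ) ≤ A * C * d 0 := by
      rcases (hd 1).eq_or_lt with h0 | h0
      · rw [← h0, Real.zero_rpow hpos.ne']
        exact mul_nonneg (mul_nonneg hA hC.le) (hd 0)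
      · have h2 : d 1 ^ 2 ≤ A * d 0 * (C * d 1 ^ θ) :=
          (hA' 0).trans (mul_le_mul_of_nonneg_left h1 (mul_nonneg hA (hd 0)))
        have h3 : d 1 ^ (2 - θ) = d 1 ^ 2 / d 1 ^ θ := by
          rw [Real.rpow_sub h0]; norm_num
        rw [h3, div_le_iff₀ (Real.rpow_pos_of_pos h0 θ)]
        linarith
    have h4 := le_rpow_inv_of_rpow_le (hd 1) hpos key
    rw [Real.mul_rpow (by positivity) (hd 0)] at h4
    have h5 := Real.rpow_nonneg (hd 0) (1 / (2 - θ))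
    linarith

/-- In a bounded log-convex sequence every term is controlled by any power less than one of the
initial term. -/
theorem logConvex_interpolation {A : ℝ} (hA : 0 ≤ A) (n : ℕ) :
    ∀ {θ : ℝ}, 0 < θ → θ < 1 → ∀ B : ℕ → ℝ, ∃ C : ℝ, 0 < C ∧
    ∀ d : ℕ → ℝ, (∀ j, 0 ≤ d j) → (∀ j, d j ≤ B j) →
      (∀ j, d (j + 1) ^ 2 ≤ A * d j * d (j + 2)) → d n ≤ C * d 0 ^ θ := by
  induction n with
  | zero =>
    intro θ h0 h1 B
    refine ⟨(|B 0| + 1) ^ (1 - θ), by positivity, fun d hd hB _ => ?_⟩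
    have := rpow_le_mul_rpow (hd 0) ((hB 0).trans ((le_abs_self _).trans
      (le_add_of_nonneg_right zero_le_one))) h0 h1.le
    rwa [Real.rpow_one] at this
  | succ n ih =>
    intro θ h0 h1 B
    -- The exponent is split as √θ · √θ: one factor is spent on passing from `d (n + 1)` to `d 1` in
    -- the shifted sequence, the other on passing from `d 1` to `d 0`.
    have hs0 : 0 < √θ := Real.sqrt_pos.2 h0
    have hs1 : √θ < 1 := by rw [Real.sqrt_lt' one_pos]; simpa using h1
    obtain ⟨C, hC, h⟩ := ih hs0 hs1 fun j => B (j + 1)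
    obtain ⟨N, hN⟩ : ∃ N : ℕ, √θ ≤ (N : ℝ) / (N + 1) := by
      obtain ⟨N, hN⟩ := exists_nat_gt (1 / (1 - √θ))
      refine ⟨N, ?_⟩
      rw [div_lt_iff₀ (by linarith)] at hN
      rw [le_div_iff₀ (by positivity)]
      nlinarith
    obtain ⟨D, hD, h'⟩ := logConvex_first_nat A hA N B
    set β := (N : ℝ) / (N + 1)
    set E := D * (|B 0| + 1) ^ (β - √θ)
    have hE : 0 < E := by positivity
    refine ⟨C * E ^ √θ, by positivity, fun d hd hB hd2 => ?_⟩
    have e1 := h (fun j => d (j + 1)) (fun j => hd _) (fun j => hB _) (fun j => hd2 _)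
    simp only [zero_add] at e1
    have e2 : d 1 ≤ E * d 0 ^ √θ := by
      refine (h' d hd hB hd2).trans ?_
      rw [mul_assoc]
      exact mul_le_mul_of_nonneg_left (rpow_le_mul_rpow (hd 0) ((hB 0).trans
        ((le_abs_self _).trans (le_add_of_nonneg_right zero_le_one))) hs0 hN) hD.le
    have e3 : d 1 ^ √θ ≤ (E * d 0 ^ √θ) ^ √θ := Real.rpow_le_rpow (hd 1) e2 hs0.le
    rw [Real.mul_rpow hE.le (Real.rpow_nonneg (hd 0) _), ← Real.rpow_mul (hd 0),
      Real.mul_self_sqrt h0.le] at e3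
    calc d (n + 1) ≤ C * d 1 ^ √θ := e1
      _ ≤ C * (E ^ √θ * d 0 ^ θ) := by gcongr
      _ = _ := by ring

/-- The open half-plane `s > 0`. -/
def openHalf : Set (ℝ × ℝ) := {q | 0 < q.1}

theorem isOpen_openHalf : IsOpen openHalf := isOpen_lt continuous_const continuous_fst

/-! ### Landau inequalities and interpolation on a half-plane -/

section
variable {E : Type*} [NormedAddCommGroup E] [NormedSpace ℝ E]

/-- Optimization over the step length: ℓ = X / (2b) balances the two sides. When b = 0, arbitrarily
long steps force X = 0; when X = 0, small steps show that m is nonnegative. -/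
theorem sq_le_of_forall_le {X m b : ℝ} (hX : 0 ≤ X) (hb : 0 ≤ b)
    (h : ∀ ℓ : ℝ, 0 < ℓ → ℓ * X ≤ 2 * m + b * ℓ ^ 2) : X ^ 2 ≤ 8 * m * b := by
  rcases hX.eq_or_lt with rfl | hX
  · rcases hb.eq_or_lt with rfl | hb
    · simp
    · by_contra! hc
      have hm : m < 0 := by nlinarith
      have := h (√(-m / b)) (Real.sqrt_pos.2 (div_pos (by linarith) hb))
      rw [Real.sq_sqrt (div_nonneg (by linarith) hb.le)] at this
      have h2 : b * (-m / b) = -m := by field_simp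
      linarith
  rcases hb.eq_or_lt with rfl | hb
  · exfalso
    have h1 := h ((2 * |m| + 1) / X) (by positivity)
    rw [div_mul_cancel₀ _ hX.ne'] at h1
    have := le_abs_self m
    simp at h1
    linarith
  · have h1 := h (X / (2 * b)) (by positivity)
    have e1 : X / (2 * b) * X = X ^ 2 / (2 * b) := by ring
    have e2 : b * (X / (2 * b)) ^ 2 = X ^ 2 / (4 * b) := by field_simp; norm_num
    rw [e1, e2] at h1
    have e3 : X ^ 2 / (2 * b) - X ^ 2 / (4 * b) = X ^ 2 / (4 * b) := by field_simp; norm_num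
    have h2 : X ^ 2 / (4 * b) ≤ 2 * m := by linarith
    rw [div_le_iff₀ (by positivity)] at h2
    linarith

/-- Landau's inequality on a half-plane, along one direction. -/
theorem landau_direction {G : ℝ × ℝ → E} (hG : DifferentiableOn ℝ G openHalf) {s₁ m b : ℝ}
    (hs : 0 < s₁) (hb : 0 ≤ b) (hm : ∀ q : ℝ × ℝ, s₁ ≤ q.1 → ‖G q‖ ≤ m)
    (h2 : ∀ q q' : ℝ × ℝ, s₁ ≤ q.1 → s₁ ≤ q'.1 → ‖fderiv ℝ G q' - fderiv ℝ G q‖ ≤ b * ‖q' - q‖)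
    {e : ℝ × ℝ} (he : ‖e‖ ≤ 1) (he0 : 0 ≤ e.1) {q : ℝ × ℝ} (hq : s₁ ≤ q.1) :
    ‖fderiv ℝ G q e‖ ^ 2 ≤ 8 * m * b := by
  refine sq_le_of_forall_le (norm_nonneg _) hb fun ℓ hℓ => ?_
  -- Since e points away from the boundary, segments of any length stay in the half-plane. No upper
  -- limit on ℓ is needed, so no lower order term appears.
  have hreg : ∀ τ ∈ Set.Icc (0 : ℝ) ℓ, s₁ ≤ (q + τ • e).1 := by
    intro τ hτ
    have := mul_nonneg hτ.1 he0
    simp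
    linarith
  have hd : ∀ τ ∈ Set.Icc (0 : ℝ) ℓ,
      HasDerivWithinAt (fun τ : ℝ => G (q + τ • e) - τ • fderiv ℝ G q e)
        (fderiv ℝ G (q + τ • e) e - fderiv ℝ G q e) (Set.Icc 0 ℓ) τ := by
    intro τ hτ
    have hmem : q + τ • e ∈ openHalf := hs.trans_le (hreg τ hτ)
    have h1 : HasFDerivAt G (fderiv ℝ G (q + τ • e)) (q + τ • e) :=
      ((hG _ hmem).differentiableAt (isOpen_openHalf.mem_nhds hmem)).hasFDerivAt
    have h3 : HasDerivAt (fun τ : ℝ => q + τ • e) e τ := by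
      simpa using ((hasDerivAt_id τ).smul_const e).const_add q
    have h4 : HasDerivAt (fun τ : ℝ => τ • fderiv ℝ G q e) (fderiv ℝ G q e) τ := by
      simpa using (hasDerivAt_id τ).smul_const (fderiv ℝ G q e)
    exact ((h1.comp_hasDerivAt τ h3).sub h4).hasDerivWithinAt
  have hbd : ∀ τ ∈ Set.Ico (0 : ℝ) ℓ, ‖fderiv ℝ G (q + τ • e) e - fderiv ℝ G q e‖ ≤ b * ℓ := by
    intro τ hτ
    have hr := hreg τ (Set.Ico_subset_Icc_self hτ)
    have h5 := h2 q (q + τ • e) hq hr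
    have h6 : ‖(fderiv ℝ G (q + τ • e) - fderiv ℝ G q) e‖ ≤ b * ‖q + τ • e - q‖ * 1 :=
      (ContinuousLinearMap.le_opNorm _ _).trans
        (mul_le_mul h5 he (norm_nonneg _) (by positivity))
    have h7 : ‖q + τ • e - q‖ ≤ ℓ := by
      rw [add_sub_cancel_left, norm_smul, Real.norm_eq_abs, abs_of_nonneg hτ.1]
      nlinarith [hτ.1, hτ.2, norm_nonneg e]
    calc _ = ‖(fderiv ℝ G (q + τ • e) - fderiv ℝ G q) e‖ := by simp
      _ ≤ _ := h6
      _ ≤ b * ℓ := by rw [mul_one]; gcongr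
  have := norm_image_sub_le_of_norm_deriv_le_segment' hd hbd ℓ (Set.right_mem_Icc.2 hℓ.le)
  simp only [zero_smul, add_zero, sub_zero] at this
  have hr := hreg ℓ (Set.right_mem_Icc.2 hℓ.le)
  have e1 := hm _ hr
  have e2 := hm _ hq
  have e3 : ‖ℓ • fderiv ℝ G q e‖ = ℓ * ‖fderiv ℝ G q e‖ := by
    rw [norm_smul, Real.norm_eq_abs, abs_of_pos hℓ]
  have e4 : ℓ • fderiv ℝ G q e = G (q + ℓ • e) - G q
      - (G (q + ℓ • e) - ℓ • fderiv ℝ G q e - G q) := by abel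
  have e5 := norm_sub_le (G (q + ℓ • e) - G q) (G (q + ℓ • e) - ℓ • fderiv ℝ G q e - G q)
  rw [← e4, e3] at e5
  have e6 := norm_sub_le (G (q + ℓ • e)) (G q)
  nlinarith

theorem norm_clm_le_of_axes {L : ℝ × ℝ →L[ℝ] E} {c : ℝ} (h1 : ‖L (1, 0)‖ ≤ c)
    (h2 : ‖L (0, 1)‖ ≤ c) : ‖L‖ ≤ 2 * c := by
  have hc : 0 ≤ c := (norm_nonneg _).trans h1
  refine L.opNorm_le_bound (by positivity) fun v => ?_
  have hv : L v = v.1 • L (1, 0) + v.2 • L (0, 1) := by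
    rw [← map_smul, ← map_smul, ← map_add]
    simp
  rw [hv]
  refine (norm_add_le _ _).trans ?_
  rw [norm_smul, norm_smul]
  have a1 : ‖v.1‖ * ‖L (1, 0)‖ ≤ ‖v‖ * c :=
    mul_le_mul (norm_fst_le v) h1 (norm_nonneg _) (norm_nonneg _)
  have a2 : ‖v.2‖ * ‖L (0, 1)‖ ≤ ‖v‖ * c :=
    mul_le_mul (norm_snd_le v) h2 (norm_nonneg _) (norm_nonneg _)
  linarith

/-- Landau's inequality on a half-plane. -/
theorem landau {G : ℝ × ℝ → E} (hG : DifferentiableOn ℝ G openHalf) {s₁ m b : ℝ}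
    (hs : 0 < s₁) (hb : 0 ≤ b) (hm : ∀ q : ℝ × ℝ, s₁ ≤ q.1 → ‖G q‖ ≤ m)
    (h2 : ∀ q q' : ℝ × ℝ, s₁ ≤ q.1 → s₁ ≤ q'.1 → ‖fderiv ℝ G q' - fderiv ℝ G q‖ ≤ b * ‖q' - q‖)
    {q : ℝ × ℝ} (hq : s₁ ≤ q.1) : ‖fderiv ℝ G q‖ ^ 2 ≤ 32 * m * b := by
  have hm0 : 0 ≤ m := (norm_nonneg _).trans (hm q hq)
  have a1 := landau_direction hG hs hb hm h2 (e := (1, 0)) (by simp) (by simp) hq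
  have a2 := landau_direction hG hs hb hm h2 (e := (0, 1)) (by simp) (by simp) hq
  have h8 : 0 ≤ 8 * m * b := by positivity
  have := norm_clm_le_of_axes (Real.le_sqrt_of_sq_le a1) (Real.le_sqrt_of_sq_le a2)
  calc ‖fderiv ℝ G q‖ ^ 2 ≤ (2 * √(8 * m * b)) ^ 2 := by gcongr
    _ = 32 * m * b := by rw [mul_pow, Real.sq_sqrt h8]; ring

theorem differentiableOn_iteratedFDeriv {F : ℝ × ℝ → E} (hF : ContDiffOn ℝ ∞ F openHalf) (n : ℕ) :
    DifferentiableOn ℝ (iteratedFDeriv ℝ n F) openHalf := fun q hq =>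
  (((hF.contDiffAt (isOpen_openHalf.mem_nhds hq)).differentiableAt_iteratedFDeriv
    (by exact_mod_cast ENat.natCast_lt_top n))).differentiableWithinAt

theorem norm_iteratedFDeriv_sub_le {F : ℝ × ℝ → E} (hF : ContDiffOn ℝ ∞ F openHalf) (n : ℕ)
    {s₁ b : ℝ} (hs : 0 < s₁) (h : ∀ q : ℝ × ℝ, s₁ ≤ q.1 → ‖iteratedFDeriv ℝ (n + 1) F q‖ ≤ b)
    {q q' : ℝ × ℝ} (hq : s₁ ≤ q.1) (hq' : s₁ ≤ q'.1) :
    ‖iteratedFDeriv ℝ n F q' - iteratedFDeriv ℝ n F q‖ ≤ b * ‖q' - q‖ := by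
  have hconv : Convex ℝ {q : ℝ × ℝ | s₁ ≤ q.1} :=
    convex_halfSpace_ge (LinearMap.isLinear (LinearMap.fst ℝ ℝ ℝ)) s₁
  refine hconv.norm_image_sub_le_of_norm_fderiv_le (𝕜 := ℝ) (fun p hp => ?_) (fun p hp => ?_)
    hq hq'
  · have hp' : p ∈ openHalf := hs.trans_le hp
    exact (differentiableOn_iteratedFDeriv hF n p hp').differentiableAt
      (isOpen_openHalf.mem_nhds hp')
  · rw [norm_fderiv_iteratedFDeriv]
    exact h p hp

/-- Landau's inequality between consecutive derivatives. -/
theorem landau_iteratedFDeriv {F : ℝ × ℝ → E} (hF : ContDiffOn ℝ ∞ F openHalf) (n : ℕ)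
    {s₁ m b : ℝ} (hs : 0 < s₁)
    (hm : ∀ q : ℝ × ℝ, s₁ ≤ q.1 → ‖iteratedFDeriv ℝ n F q‖ ≤ m)
    (hb : ∀ q : ℝ × ℝ, s₁ ≤ q.1 → ‖iteratedFDeriv ℝ (n + 2) F q‖ ≤ b)
    {q : ℝ × ℝ} (hq : s₁ ≤ q.1) : ‖iteratedFDeriv ℝ (n + 1) F q‖ ^ 2 ≤ 32 * m * b := by
  rw [← norm_fderiv_iteratedFDeriv]
  refine landau (differentiableOn_iteratedFDeriv hF n) hs ((norm_nonneg _).trans (hb q hq)) hm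
    (fun p p' hp hp' => ?_) hq
  have h1 := norm_iteratedFDeriv_sub_le hF (n + 1) hs hb hp hp'
  rw [iteratedFDeriv_succ_eq_comp_left] at h1
  simp only [Function.comp_apply] at h1
  have h2 := (continuousMultilinearCurryLeftEquiv ℝ (fun _ : Fin (n + 1) => ℝ × ℝ) E).symm.dist_map
    (fderiv ℝ (iteratedFDeriv ℝ n F) p') (fderiv ℝ (iteratedFDeriv ℝ n F) p)
  rw [dist_eq_norm, dist_eq_norm] at h2
  exact h2.symm.trans_le h1

/-- A function on a half-plane whose derivatives are bounded has derivatives controlled by any power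
less than one of its supremum. -/
theorem halfPlane_interpolation (n : ℕ) {θ : ℝ} (h0 : 0 < θ) (h1 : θ < 1) (B : ℕ → ℝ) :
    ∃ C : ℝ, 0 < C ∧ ∀ F : ℝ × ℝ → E, ContDiffOn ℝ ∞ F openHalf →
    (∀ j, 1 ≤ j → ∀ q : ℝ × ℝ, 0 < q.1 → ‖iteratedFDeriv ℝ j F q‖ ≤ B j) →
    ∀ s₁ m : ℝ, 0 < s₁ → m ≤ B 0 → (∀ q : ℝ × ℝ, s₁ ≤ q.1 → ‖F q‖ ≤ m) →
    ∀ q : ℝ × ℝ, s₁ ≤ q.1 → ‖iteratedFDeriv ℝ n F q‖ ≤ C * m ^ θ := by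
  obtain ⟨C, hC, h⟩ := logConvex_interpolation (A := 32) (by norm_num) n h0 h1 B
  refine ⟨C, hC, fun F hF hB s₁ m hs hmB hm q hq => ?_⟩
  have hbd : ∀ j, ∀ q : ℝ × ℝ, s₁ ≤ q.1 → ‖iteratedFDeriv ℝ j F q‖ ≤ B j := by
    intro j q hq
    rcases Nat.eq_zero_or_pos j with rfl | hj
    · rw [norm_iteratedFDeriv_zero]
      exact (hm q hq).trans hmB
    · exact hB j hj q (hs.trans_le hq)
  have hne : Nonempty {q : ℝ × ℝ // s₁ ≤ q.1} := ⟨⟨q, hq⟩⟩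
  -- The suprema of the derivatives over s ≥ s₁ form a log-convex sequence with constant 32, by
  -- Landau's inequality. The constant does not involve s₁, so the interpolation is uniform in the
  -- half-plane.
  set d : ℕ → ℝ := fun j => ⨆ q : {q : ℝ × ℝ // s₁ ≤ q.1}, ‖iteratedFDeriv ℝ j F q‖ with hd
  have hbdd : ∀ j, BddAbove (Set.range fun q : {q : ℝ × ℝ // s₁ ≤ q.1} =>
      ‖iteratedFDeriv ℝ j F q‖) := by
    rintro j
    refine ⟨B j, ?_⟩
    rintro _ ⟨p, rfl⟩
    exact hbd j p p.2
  have hle : ∀ j, ∀ q : ℝ × ℝ, s₁ ≤ q.1 → ‖iteratedFDeriv ℝ j F q‖ ≤ d j :=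
    fun j q hq => le_ciSup (hbdd j) ⟨q, hq⟩
  have hd0 : ∀ j, 0 ≤ d j := fun j => (norm_nonneg _).trans (hle j q hq)
  have key := h d hd0 (fun j => ciSup_le fun p => hbd j p p.2) (fun j => ?_)
  · refine (hle n q hq).trans (key.trans ?_)
    have : d 0 ≤ m := ciSup_le fun p => by
      rw [norm_iteratedFDeriv_zero]
      exact hm p p.2
    gcongr
    exact hd0 0
  · have h3 : 0 ≤ 32 * d j * d (j + 2) := by
      have := hd0 j
      have := hd0 (j + 2)
      positivity
    have h2 : d (j + 1) ≤ √(32 * d j * d (j + 2)) := ciSup_le fun p =>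
      Real.le_sqrt_of_sq_le (landau_iteratedFDeriv hF j hs (hle j) (hle (j + 2)) p.2)
    calc d (j + 1) ^ 2 ≤ √(32 * d j * d (j + 2)) ^ 2 := by
          have := hd0 (j + 1)
          gcongr
      _ = _ := Real.sq_sqrt h3

/-- Interpolation is applied on the half-plane to the right of the point itself, where the supremum
is at most K e^{-r s}. The power θ then acts on both K and the exponential, which costs a factor θ
in the rate. -/
theorem expSmall_of_sup (k : ℕ) {θ : ℝ} (h0 : 0 < θ) (h1 : θ < 1) (B : ℕ → ℝ) :
    ∃ C : ℝ, 0 < C ∧ ∀ F : ℝ × ℝ → E, ContDiffOn ℝ ∞ F openHalf →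
    (∀ j, 1 ≤ j → ∀ q : ℝ × ℝ, 0 < q.1 → ‖iteratedFDeriv ℝ j F q‖ ≤ B j) →
    ∀ r K : ℝ, 0 ≤ r → 0 ≤ K → K ≤ B 0 →
    (∀ q : ℝ × ℝ, 0 < q.1 → ‖F q‖ ≤ K * Real.exp (-r * q.1)) →
    ExpSmall k (C * K ^ θ) (θ * r) F := by
  choose C hC h using fun n : ℕ => halfPlane_interpolation (E := E) n h0 h1 B
  refine ⟨∑ n ∈ Finset.range (k + 1), C n, Finset.sum_pos (fun n _ => hC n) (by simp), ?_⟩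
  intro F hF hB r K hr hK hK0 hs n hn q hq
  have hexp : Real.exp (-r * q.1) ≤ 1 := Real.exp_le_one_iff.2 (by nlinarith)
  have := h n F hF hB q.1 (K * Real.exp (-r * q.1)) hq
    ((mul_le_of_le_one_right hK hexp).trans hK0) (fun p hp => ?_) q le_rfl
  · rw [Real.mul_rpow hK (Real.exp_pos _).le, ← Real.exp_mul] at this
    have e : -r * q.1 * θ = -(θ * r) * q.1 := by ring
    rw [e] at this
    refine this.trans ?_
    rw [← mul_assoc]
    gcongr
    exact Finset.single_le_sum (fun i _ => (hC i).le) (by simpa using Nat.lt_succ_of_le hn)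
  · refine (hs p (hq.trans_le hp)).trans ?_
    exact mul_le_mul_of_nonneg_left (Real.exp_le_exp.2 (by nlinarith)) hK

end

end MorseBott

namespace MorseBott

/-! ## Functions with bounded derivatives on the half-plane -/

section
variable {E : Type*} [NormedAddCommGroup E] [NormedSpace ℝ E]
variable {E' : Type*} [NormedAddCommGroup E'] [NormedSpace ℝ E']

/-- `F` is smooth on the half-plane `s > 0` and its derivatives of order `n ≥ j` are bounded by
`B n` there. -/
structure HalfBdd (j : ℕ) (B : ℕ → ℝ) (F : ℝ × ℝ → E) : Prop where
  smooth : ContDiffOn ℝ ∞ F openHalf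
  bound : ∀ n, j ≤ n → ∀ q : ℝ × ℝ, 0 < q.1 → ‖iteratedFDeriv ℝ n F q‖ ≤ B n

theorem contDiffAt_of_half {F : ℝ × ℝ → E} (h : ContDiffOn ℝ ∞ F openHalf) {q : ℝ × ℝ}
    (hq : 0 < q.1) : ContDiffAt ℝ ∞ F q := h.contDiffAt (isOpen_openHalf.mem_nhds hq)

theorem natCast_le_infty (n : ℕ) : (n : ℕ∞ω) ≤ ∞ := by
  exact_mod_cast le_top

theorem iteratedFDeriv_congr_half {F G : ℝ × ℝ → E} (h : ∀ q : ℝ × ℝ, 0 < q.1 → F q = G q)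
    (n : ℕ) {q : ℝ × ℝ} (hq : 0 < q.1) : iteratedFDeriv ℝ n F q = iteratedFDeriv ℝ n G q := by
  have : F =ᶠ[𝓝 q] G := by
    filter_upwards [isOpen_openHalf.mem_nhds hq] with p hp using h p hp
  exact this.iteratedFDeriv ℝ n |>.self_of_nhds

namespace HalfBdd

variable {j : ℕ} {B B' : ℕ → ℝ} {F G : ℝ × ℝ → E}

theorem mono (h : HalfBdd j B F) {j' : ℕ} (hj : j ≤ j') (hB : ∀ n, j' ≤ n → B n ≤ B' n) :
    HalfBdd j' B' F :=
  ⟨h.smooth, fun n hn q hq => (h.bound n (hj.trans hn) q hq).trans (hB n hn)⟩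

theorem add (hF : HalfBdd j B F) (hG : HalfBdd j B' G) :
    HalfBdd j (fun n => B n + B' n) fun q => F q + G q := by
  refine ⟨hF.smooth.add hG.smooth, fun n hn q hq => ?_⟩
  rw [fun_iteratedFDeriv_add_apply ((contDiffAt_of_half hF.smooth hq).of_le (natCast_le_infty n))
    ((contDiffAt_of_half hG.smooth hq).of_le (natCast_le_infty n))]
  exact (norm_add_le _ _).trans (add_le_add (hF.bound n hn q hq) (hG.bound n hn q hq))

theorem clm (hF : HalfBdd j B F) (L : E →L[ℝ] E') :
    HalfBdd j (fun n => ‖L‖ * B n) fun q => L (F q) :=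
  ⟨L.contDiff.comp_contDiffOn hF.smooth, fun n hn q hq =>
    (L.norm_iteratedFDeriv_comp_left (contDiffAt_of_half hF.smooth hq) (natCast_le_infty n)).trans
      (mul_le_mul_of_nonneg_left (hF.bound n hn q hq) (norm_nonneg _))⟩

theorem neg (hF : HalfBdd j B F) : HalfBdd j B fun q => -F q := by
  refine ⟨hF.smooth.neg, fun n hn q hq => ?_⟩
  rw [show (fun q => -F q) = -F from rfl, iteratedFDeriv_neg_apply, norm_neg]
  exact hF.bound n hn q hq

theorem sub (hF : HalfBdd j B F) (hG : HalfBdd j B' G) :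
    HalfBdd j (fun n => B n + B' n) fun q => F q - G q := by
  simpa only [sub_eq_add_neg] using hF.add hG.neg

theorem prodMk {G : ℝ × ℝ → E'} (hF : HalfBdd j B F) (hG : HalfBdd j B' G) :
    HalfBdd j (fun n => |B n| + |B' n|) fun q => (F q, G q) := by
  refine ⟨hF.smooth.prodMk hG.smooth, fun n hn q hq => ?_⟩
  rw [iteratedFDeriv_prodMk (contDiffAt_of_half hF.smooth hq) (contDiffAt_of_half hG.smooth hq)
    (natCast_le_infty n), ContinuousMultilinearMap.opNorm_prod]
  refine max_le ?_ ?_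
  · exact (hF.bound n hn q hq).trans ((le_abs_self _).trans (le_add_of_nonneg_right (abs_nonneg _)))
  · exact (hG.bound n hn q hq).trans ((le_abs_self _).trans (le_add_of_nonneg_left (abs_nonneg _)))

theorem fderiv (hF : HalfBdd (j + 1) B F) : HalfBdd j (fun n => B (n + 1)) (fderiv ℝ F) :=
  ⟨hF.smooth.fderiv_of_isOpen isOpen_openHalf (by simp), fun n hn q hq => by
    rw [norm_iteratedFDeriv_fderiv]; exact hF.bound (n + 1) (by omega) q hq⟩

theorem fderiv_apply (hF : HalfBdd (j + 1) B F) {v : ℝ × ℝ} (hv : ‖v‖ ≤ 1) :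
    HalfBdd j (fun n => B (n + 1)) fun q => _root_.fderiv ℝ F q v := by
  have h := hF.fderiv
  refine ⟨h.smooth.clm_apply contDiffOn_const, fun n hn q hq => ?_⟩
  refine (norm_iteratedFDeriv_clm_apply_const (contDiffAt_of_half h.smooth hq)
    (natCast_le_infty n)).trans ?_
  have h1 := h.bound n hn q hq
  exact (mul_le_of_le_one_left (norm_nonneg _) hv).trans h1

end HalfBdd

/-- The bound of `HalfBdd.mul`. -/
noncomputable def mulBound (B B' : ℕ → ℝ) (n : ℕ) : ℝ :=
  ∑ i ∈ Finset.range (n + 1), (n.choose i : ℝ) * |B i| * |B' (n - i)|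

theorem HalfBdd.mul {B B' : ℕ → ℝ} {F G : ℝ × ℝ → ℝ} (hF : HalfBdd 0 B F) (hG : HalfBdd 0 B' G) :
    HalfBdd 0 (mulBound B B') fun q => F q * G q := by
  refine ⟨hF.smooth.mul hG.smooth, fun n _ q hq => ?_⟩
  have h := norm_iteratedFDerivWithin_mul_le hF.smooth hG.smooth isOpen_openHalf.uniqueDiffOn
    (show q ∈ openHalf from hq) (natCast_le_infty n)
  rw [iteratedFDerivWithin_of_isOpen n isOpen_openHalf hq] at h
  refine h.trans (Finset.sum_le_sum fun i _ => ?_)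
  rw [iteratedFDerivWithin_of_isOpen i isOpen_openHalf hq,
    iteratedFDerivWithin_of_isOpen (n - i) isOpen_openHalf hq]
  gcongr
  · exact (hF.bound i (Nat.zero_le _) q hq).trans (le_abs_self _)
  · exact (hG.bound (n - i) (Nat.zero_le _) q hq).trans (le_abs_self _)

/-- The bound of `norm_iteratedFDeriv_comp_half_le`. -/
noncomputable def compBound (A B : ℕ → ℝ) (n : ℕ) : ℝ :=
  n.factorial * (∑ i ∈ Finset.range (n + 1), |A i|) * (1 + ∑ i ∈ Finset.range (n + 1), |B i|) ^ n

theorem norm_iteratedFDeriv_comp_half_le {g : E → E'} {Ω : Set E} (hΩ : IsOpen Ω)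
    (hg : ContDiffOn ℝ ∞ g Ω) {F : ℝ × ℝ → E} (hF : ContDiffOn ℝ ∞ F openHalf)
    (hm : ∀ q : ℝ × ℝ, 0 < q.1 → F q ∈ Ω) {A B : ℕ → ℝ} {n : ℕ} {q : ℝ × ℝ} (hq : 0 < q.1)
    (hA : ∀ i, i ≤ n → ‖iteratedFDeriv ℝ i g (F q)‖ ≤ A i)
    (hB : ∀ i, 1 ≤ i → i ≤ n → ‖iteratedFDeriv ℝ i F q‖ ≤ B i) :
    ‖iteratedFDeriv ℝ n (fun p => g (F p)) q‖ ≤ compBound A B n := by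
  -- The composition estimate asks for the i-th derivative of F to be at most D^i. The summand 1
  -- makes D ≥ 1, so that D ≤ D^i for i ≥ 1.
  have h := norm_iteratedFDerivWithin_comp_le (C := ∑ i ∈ Finset.range (n + 1), |A i|)
    (D := 1 + ∑ i ∈ Finset.range (n + 1), |B i|) hg hF (natCast_le_infty n)
    hΩ.uniqueDiffOn isOpen_openHalf.uniqueDiffOn (fun q hq => hm q hq) (show q ∈ openHalf from hq)
    (fun i hi => ?_) (fun i hi hin => ?_)
  · rw [iteratedFDerivWithin_of_isOpen n isOpen_openHalf hq] at h
    exact h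
  · rw [iteratedFDerivWithin_of_isOpen i hΩ (hm q hq)]
    refine (hA i hi).trans ((le_abs_self _).trans ?_)
    exact Finset.single_le_sum (f := fun i => |A i|) (fun _ _ => abs_nonneg _)
      (by simpa using Nat.lt_succ_of_le hi)
  · rw [iteratedFDerivWithin_of_isOpen i isOpen_openHalf hq]
    have h1 : |B i| ≤ ∑ i ∈ Finset.range (n + 1), |B i| :=
      Finset.single_le_sum (f := fun i => |B i|) (fun _ _ => abs_nonneg _)
        (by simpa using Nat.lt_succ_of_le hin)
    have h2 : (0 : ℝ) ≤ ∑ i ∈ Finset.range (n + 1), |B i| :=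
      Finset.sum_nonneg fun _ _ => abs_nonneg _
    calc _ ≤ |B i| := (hB i hi hin).trans (le_abs_self _)
      _ ≤ 1 + ∑ i ∈ Finset.range (n + 1), |B i| := by linarith
      _ ≤ _ := le_self_pow₀ (by linarith) (by omega)

theorem HalfBdd.comp {g : E → E'} {Ω : Set E} (hΩ : IsOpen Ω)
    (hg : ContDiffOn ℝ ∞ g Ω) {F : ℝ × ℝ → E} {A B : ℕ → ℝ} (hF : HalfBdd 1 B F)
    (hm : ∀ q : ℝ × ℝ, 0 < q.1 → F q ∈ Ω)
    (hA : ∀ i, ∀ q : ℝ × ℝ, 0 < q.1 → ‖iteratedFDeriv ℝ i g (F q)‖ ≤ A i) :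
    HalfBdd 0 (compBound A B) fun q => g (F q) :=
  ⟨hg.comp hF.smooth fun q hq => hm q hq, fun _ _ _ hq =>
    norm_iteratedFDeriv_comp_half_le hΩ hg hF.smooth hm hq (fun i _ => hA i _ hq)
      (fun i hi _ => hF.bound i hi _ hq)⟩

/-! ## Integration over the circle -/

/-- The function `(s, t) ↦ ∫_0^T F (s, τ) dτ`. -/
noncomputable def circleInt (T : ℝ) (F : ℝ × ℝ → E) (q : ℝ × ℝ) : E := ∫ t in (0 : ℝ)..T, F (q.1, t)

/-- The projection `(s, t) ↦ (s, 0)`. -/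
noncomputable def projS : ℝ × ℝ →L[ℝ] ℝ × ℝ :=
  (ContinuousLinearMap.inl ℝ ℝ ℝ).comp (ContinuousLinearMap.fst ℝ ℝ ℝ)

theorem norm_projS_le : ‖projS‖ ≤ 1 :=
  ContinuousLinearMap.opNorm_le_bound _ zero_le_one fun v => by
    simp [projS, Prod.norm_def]

theorem continuous_slice {X : Type*} [TopologicalSpace X] {F : ℝ × ℝ → X}
    (hF : ContinuousOn F openHalf) {s : ℝ} (hs : 0 < s) :
    Continuous fun t : ℝ => F (s, t) :=
  hF.comp_continuous (by fun_prop) fun _ => hs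

/-- Differentiation under the integral sign, with domination by compactness of q.1 / 2 ≤ s ≤ 2 q.1,
0 ≤ t ≤ T. The factor `projS` appears because only the s-coordinate of the base point enters the
integrand. -/
theorem hasFDerivAt_circleInt {T : ℝ} {F : ℝ × ℝ → E} (hF : ContDiffOn ℝ 1 F openHalf)
    {q : ℝ × ℝ} (hq : 0 < q.1) :
    HasFDerivAt (circleInt T F) (circleInt T (fun p => (fderiv ℝ F p).comp projS) q) q := by
  have hc : ContinuousOn (fun p => (fderiv ℝ F p).comp projS) openHalf :=
    (hF.continuousOn_fderiv_of_isOpen isOpen_openHalf (by simp)).clm_comp continuousOn_const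
  set K : Set (ℝ × ℝ) := Set.Icc (q.1 / 2) (2 * q.1) ×ˢ Set.uIcc 0 T with hK
  have hKc : IsCompact K := isCompact_Icc.prod isCompact_uIcc
  have hKs : K ⊆ openHalf := fun p hp => by
    have := hp.1.1
    simp only [openHalf, Set.mem_ofPred_eq]
    linarith
  obtain ⟨C, hC⟩ := hKc.exists_bound_of_continuousOn (hc.mono hKs)
  have hopen : IsOpen {p : ℝ × ℝ | q.1 / 2 < p.1 ∧ p.1 < 2 * q.1} :=
    (isOpen_lt continuous_const continuous_fst).inter (isOpen_lt continuous_fst continuous_const)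
  have hnhds : {p : ℝ × ℝ | q.1 / 2 < p.1 ∧ p.1 < 2 * q.1} ∈ 𝓝 q :=
    hopen.mem_nhds ⟨by linarith, by linarith⟩
  refine intervalIntegral.hasFDerivAt_integral_of_dominated_of_fderiv_le
    (F := fun p t => F (p.1, t)) (F' := fun p t => (fderiv ℝ F (p.1, t)).comp projS)
    (bound := fun _ => C) hnhds ?_ ?_ ?_ ?_ ?_ ?_
  · filter_upwards [isOpen_openHalf.mem_nhds hq] with p hp
    exact (continuous_slice hF.continuousOn hp).aestronglyMeasurable
  · exact (continuous_slice hF.continuousOn hq).intervalIntegrable _ _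
  · exact (continuous_slice hc hq).aestronglyMeasurable
  · refine Eventually.of_forall fun t ht p hp => ?_
    exact hC (p.1, t) ⟨⟨hp.1.le, hp.2.le⟩, Set.uIoc_subset_uIcc ht⟩
  · exact intervalIntegrable_const
  · refine Eventually.of_forall fun t ht p hp => ?_
    have hp0 : (p.1, t) ∈ openHalf := by
      have := hp.1
      simp only [openHalf, Set.mem_ofPred_eq]
      linarith
    have h1 : HasFDerivAt F (fderiv ℝ F (p.1, t)) (p.1, t) :=
      (((hF _ hp0).contDiffAt (isOpen_openHalf.mem_nhds hp0)).differentiableAt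
        (by simp)).hasFDerivAt
    have h2 : HasFDerivAt (fun p : ℝ × ℝ => (p.1, t)) projS p := by
      have h3 : (fun p : ℝ × ℝ => (p.1, t)) = fun p => projS p + (0, t) := by
        funext p
        simp [projS]
      rw [h3]
      exact projS.hasFDerivAt.add_const _
    exact h1.comp p h2

theorem fderiv_circleInt {T : ℝ} {F : ℝ × ℝ → E} (hF : ContDiffOn ℝ ∞ F openHalf)
    {q : ℝ × ℝ} (hq : 0 < q.1) :
    fderiv ℝ (circleInt T F) q = circleInt T (fun p => (fderiv ℝ F p).comp projS) q :=
  (hasFDerivAt_circleInt (hF.of_le (by exact_mod_cast le_top)) hq).fderiv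

theorem contDiffOn_fderiv_comp_projS {F : ℝ × ℝ → E} (hF : ContDiffOn ℝ ∞ F openHalf) :
    ContDiffOn ℝ ∞ (fun p => (fderiv ℝ F p).comp projS) openHalf :=
  (hF.fderiv_of_isOpen isOpen_openHalf (by simp)).clm_comp contDiffOn_const

end

/-- The derivative of a circle integral is again a circle integral, of a function with values in
linear maps; hence the induction on the order lets the target space vary. -/
theorem contDiffOn_circleInt (T : ℝ) {E : Type*} [NormedAddCommGroup E] [NormedSpace ℝ E]
    {F : ℝ × ℝ → E} (hF : ContDiffOn ℝ ∞ F openHalf) :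
    ContDiffOn ℝ ∞ (circleInt T F) openHalf := by
  have hd : DifferentiableOn ℝ (circleInt T F) openHalf := fun q hq =>
    (hasFDerivAt_circleInt (hF.of_le (by exact_mod_cast le_top)) hq).differentiableAt
      |>.differentiableWithinAt
  rw [contDiffOn_infty]
  intro n
  induction n generalizing E with
  | zero => exact contDiffOn_zero.2 hd.continuousOn
  | succ n ih =>
    rw [show ((n + 1 : ℕ) : ℕ∞ω) = (n : ℕ∞ω) + 1 by norm_cast,
      contDiffOn_succ_iff_fderiv_of_isOpen isOpen_openHalf]
    refine ⟨hd, fun h => absurd h (by simp), ?_⟩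
    have h2 := contDiffOn_fderiv_comp_projS hF
    refine (ih h2 fun q hq => ?_).congr fun q hq => fderiv_circleInt hF hq
    exact (hasFDerivAt_circleInt (h2.of_le (by exact_mod_cast le_top)) hq).differentiableAt
      |>.differentiableWithinAt

theorem norm_iteratedFDeriv_circleInt_le {T : ℝ} (hT : 0 ≤ T) (n : ℕ) {E : Type*}
    [NormedAddCommGroup E] [NormedSpace ℝ E] {F : ℝ × ℝ → E} (hF : ContDiffOn ℝ ∞ F openHalf)
    {b : ℝ} (hb : ∀ q : ℝ × ℝ, 0 < q.1 → ‖iteratedFDeriv ℝ n F q‖ ≤ b) {q : ℝ × ℝ} (hq : 0 < q.1) :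
    ‖iteratedFDeriv ℝ n (circleInt T F) q‖ ≤ T * b := by
  induction n generalizing E with
  | zero =>
    simp only [norm_iteratedFDeriv_zero] at hb ⊢
    have := intervalIntegral.norm_integral_le_of_norm_le_const (a := 0) (b := T)
      (f := fun t => F (q.1, t)) (C := b) fun t _ => hb (q.1, t) hq
    rw [sub_zero, abs_of_nonneg hT] at this
    rw [mul_comm]
    exact this
  | succ n ih =>
    rw [← norm_iteratedFDeriv_fderiv,
      iteratedFDeriv_congr_half (fun q hq => fderiv_circleInt hF hq) n hq]
    refine ih (contDiffOn_fderiv_comp_projS hF) fun p hp => ?_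
    have hs := hF.fderiv_of_isOpen isOpen_openHalf (m := ∞) (by simp)
    set L : (ℝ × ℝ →L[ℝ] E) →L[ℝ] (ℝ × ℝ →L[ℝ] E) :=
      (ContinuousLinearMap.compL ℝ (ℝ × ℝ) (ℝ × ℝ) E).flip projS
    have hL : ‖L‖ ≤ 1 := ContinuousLinearMap.opNorm_le_bound _ zero_le_one fun f => by
      refine (ContinuousLinearMap.opNorm_comp_le f projS).trans ?_
      have := norm_projS_le
      nlinarith [norm_nonneg f]
    have h1 := L.norm_iteratedFDeriv_comp_left (contDiffAt_of_half hs hp) (natCast_le_infty n)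
    rw [norm_iteratedFDeriv_fderiv] at h1
    have h2 := hb p hp
    exact h1.trans ((mul_le_of_le_one_left (norm_nonneg _) hL).trans h2)

theorem HalfBdd.circleInt {E : Type*} [NormedAddCommGroup E] [NormedSpace ℝ E] {j : ℕ} {B : ℕ → ℝ}
    {F : ℝ × ℝ → E} (hF : HalfBdd j B F) {T : ℝ} (hT : 0 ≤ T) :
    HalfBdd j (fun n => T * B n) (circleInt T F) :=
  ⟨contDiffOn_circleInt T hF.smooth, fun n hn _ hq =>
    norm_iteratedFDeriv_circleInt_le hT n hF.smooth (fun q hq => hF.bound n hn q hq) hq⟩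

end MorseBott

namespace MorseBott

/-! ## Periodic functions near the torus -/

section
variable {E : Type*} [NormedAddCommGroup E] [NormedSpace ℝ E]

/-- `F` is smooth over the region `|y| < ρ`, and periodic in `z` and `x`. -/
structure TorusSmooth (T ρ : ℝ) (F : Pt → E) : Prop where
  smooth : ContDiffOn ℝ ∞ F {p | |p.2.2| < ρ}
  periodic_z : ∀ z x y : ℝ, F (z + T, x, y) = F (z, x, y)
  periodic_x : ∀ z x y : ℝ, F (z, x + 1, y) = F (z, x, y)

variable {T ρ : ℝ} {F : Pt → E}

theorem TorusSmooth.contDiffAt (hF : TorusSmooth T ρ F) {p : Pt} (hp : |p.2.2| < ρ) :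
    ContDiffAt ℝ ∞ F p := hF.smooth.contDiffAt ((Torus.isOpen_region ρ).mem_nhds hp)

theorem TorusSmooth.differentiableAt (hF : TorusSmooth T ρ F) {p : Pt} (hp : |p.2.2| < ρ) :
    DifferentiableAt ℝ F p := (hF.contDiffAt hp).differentiableAt (by simp)

theorem TorusSmooth.comp_add_z (hF : TorusSmooth T ρ F) : (fun p => F (p + (T, 0, 0))) = F := by
  funext p
  rw [show p + (T, 0, 0) = (p.1 + T, p.2.1, p.2.2) by ext <;> simp]
  exact hF.periodic_z p.1 p.2.1 p.2.2

theorem TorusSmooth.comp_add_x (hF : TorusSmooth T ρ F) : (fun p => F (p + (0, 1, 0))) = F := by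
  funext p
  rw [show p + (0, 1, 0) = (p.1, p.2.1 + 1, p.2.2) by ext <;> simp]
  exact hF.periodic_x p.1 p.2.1 p.2.2

theorem TorusSmooth.fderiv (hF : TorusSmooth T ρ F) : TorusSmooth T ρ (fderiv ℝ F) := by
  refine ⟨hF.smooth.fderiv_of_isOpen (Torus.isOpen_region ρ) (by simp), fun z x y => ?_,
    fun z x y => ?_⟩
  · have h := fderiv_comp_add_right (𝕜 := ℝ) (f := F) (x := (z, x, y)) (T, 0, 0)
    rw [hF.comp_add_z] at h
    simpa using h.symm
  · have h := fderiv_comp_add_right (𝕜 := ℝ) (f := F) (x := (z, x, y)) (0, 1, 0)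
    rw [hF.comp_add_x] at h
    simpa using h.symm

/-- Periodicity in z and x reduces the bound to the compact fundamental domain [0, T] × [0, 1] ×
[-ρ', ρ']. -/
theorem TorusSmooth.exists_bound_iteratedFDeriv (hT : 0 < T) (hF : TorusSmooth T ρ F) {ρ' : ℝ}
    (hρ : ρ' < ρ) (n : ℕ) :
    ∃ C : ℝ, 0 ≤ C ∧ ∀ p : Pt, |p.2.2| ≤ ρ' → ‖iteratedFDeriv ℝ n F p‖ ≤ C := by
  set G := iteratedFDeriv ℝ n F with hG
  have hz : ∀ z x y : ℝ, G (z + T, x, y) = G (z, x, y) := fun z x y => by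
    have h := iteratedFDeriv_comp_add_right (𝕜 := ℝ) (f := F) n (T, 0, 0) (z, x, y)
    rw [hF.comp_add_z] at h
    simpa using h.symm
  have hx : ∀ z x y : ℝ, G (z, x + 1, y) = G (z, x, y) := fun z x y => by
    have h := iteratedFDeriv_comp_add_right (𝕜 := ℝ) (f := F) n (0, 1, 0) (z, x, y)
    rw [hF.comp_add_x] at h
    simpa using h.symm
  have hc : ContinuousOn G {p | |p.2.2| < ρ} := fun p hp =>
    ((hF.contDiffAt hp).continuousAt_iteratedFDeriv (natCast_le_infty n)).continuousWithinAt
  have hK : IsCompact (Set.Icc (0 : ℝ) T ×ˢ Set.Icc (0 : ℝ) 1 ×ˢ Set.Icc (-ρ') ρ') :=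
    isCompact_Icc.prod (isCompact_Icc.prod isCompact_Icc)
  obtain ⟨C, hC⟩ := hK.exists_bound_of_continuousOn (hc.mono fun p hp =>
    (abs_le.2 ⟨hp.2.2.1, hp.2.2.2⟩).trans_lt hρ)
  refine ⟨|C|, abs_nonneg C, fun p hp => ?_⟩
  obtain ⟨z, hz1, hz2⟩ := Function.Periodic.exists_mem_Ico₀
    (f := fun z => G (z, p.2.1, p.2.2)) (c := T) (fun z => hz z _ _) hT p.1
  obtain ⟨x, hx1, hx2⟩ := Function.Periodic.exists_mem_Ico₀
    (f := fun x => G (z, x, p.2.2)) (c := 1) (fun x => hx _ x _) one_pos p.2.1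
  have e : G p = G (z, x, p.2.2) := hz2.trans hx2
  rw [e]
  exact (hC (z, x, p.2.2)
    ⟨Set.Ico_subset_Icc_self hz1, Set.Ico_subset_Icc_self hx1, abs_le.1 hp⟩).trans (le_abs_self C)

theorem TorusSmooth.exists_bound (hT : 0 < T) (hF : TorusSmooth T ρ F) {ρ' : ℝ} (hρ : ρ' < ρ) :
    ∃ C : ℝ, 0 ≤ C ∧ ∀ p : Pt, |p.2.2| ≤ ρ' → ‖F p‖ ≤ C := by
  obtain ⟨C, h0, hC⟩ := hF.exists_bound_iteratedFDeriv hT hρ 0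
  exact ⟨C, h0, fun p hp => by simpa using hC p hp⟩

theorem hasDerivAt_slice_y {p : Pt} (hF : DifferentiableAt ℝ F p) :
    HasDerivAt (fun y : ℝ => F (p.1, p.2.1, y)) (_root_.fderiv ℝ F p (0, 0, 1)) p.2.2 := by
  have h : HasDerivAt (fun y : ℝ => ((p.1, p.2.1, y) : Pt)) (0, 0, 1) p.2.2 :=
    (hasDerivAt_const _ _).prodMk ((hasDerivAt_const _ _).prodMk (hasDerivAt_id _))
  exact hF.hasFDerivAt.comp_hasDerivAt p.2.2 h

theorem TorusSmooth.exists_lipschitz (hT : 0 < T) (hF : TorusSmooth T ρ F) {ρ' : ℝ} (hρ : ρ' < ρ) :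
    ∃ C : ℝ, 0 ≤ C ∧ ∀ p : Pt, |p.2.2| ≤ ρ' → ‖F p - F (p.1, p.2.1, 0)‖ ≤ C * |p.2.2| := by
  obtain ⟨C, h0, hC⟩ := hF.fderiv.exists_bound hT hρ
  refine ⟨C, h0, fun p hp => ?_⟩
  have hsub : ∀ y ∈ Set.uIcc 0 p.2.2, |y| ≤ ρ' := fun y hy => by
    have := Set.abs_sub_left_of_mem_uIcc hy
    simp only [sub_zero] at this
    exact this.trans hp
  have := (convex_uIcc 0 p.2.2).norm_image_sub_le_of_norm_hasDerivWithin_le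
    (f := fun y : ℝ => F (p.1, p.2.1, y))
    (f' := fun y => _root_.fderiv ℝ F (p.1, p.2.1, y) (0, 0, 1)) (C := C)
    (fun y hy => (hasDerivAt_slice_y (p := (p.1, p.2.1, y))
      (hF.differentiableAt ((hsub y hy).trans_lt hρ))).hasDerivWithinAt)
    (fun y hy => (ContinuousLinearMap.le_of_opNorm_le _ (hC (p.1, p.2.1, y) (hsub y hy)) _).trans
      (by simp [Prod.norm_def])) Set.left_mem_uIcc Set.right_mem_uIcc
  simpa using this

theorem TorusSmooth.exists_taylor (hT : 0 < T) (hF : TorusSmooth T ρ F) {ρ' : ℝ} (hρ : ρ' < ρ) :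
    ∃ C : ℝ, 0 ≤ C ∧ ∀ p : Pt, |p.2.2| ≤ ρ' →
      ‖F p - F (p.1, p.2.1, 0) - p.2.2 • _root_.fderiv ℝ F (p.1, p.2.1, 0) (0, 0, 1)‖
        ≤ C * |p.2.2| ^ 2 := by
  obtain ⟨C, h0, hC⟩ := hF.fderiv.exists_lipschitz hT hρ
  refine ⟨C, h0, fun p hp => ?_⟩
  have hsub : ∀ y ∈ Set.uIcc 0 p.2.2, |y| ≤ |p.2.2| := fun y hy => by
    have := Set.abs_sub_left_of_mem_uIcc hy
    simpa only [sub_zero] using this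
  have := (convex_uIcc 0 p.2.2).norm_image_sub_le_of_norm_hasDerivWithin_le
    (f := fun y : ℝ => F (p.1, p.2.1, y) - y • _root_.fderiv ℝ F (p.1, p.2.1, 0) (0, 0, 1))
    (f' := fun y => _root_.fderiv ℝ F (p.1, p.2.1, y) (0, 0, 1)
      - _root_.fderiv ℝ F (p.1, p.2.1, 0) (0, 0, 1)) (C := C * |p.2.2|)
    (fun y hy => ?_) (fun y hy => ?_) Set.left_mem_uIcc Set.right_mem_uIcc
  · simp only [zero_smul, sub_zero, Real.norm_eq_abs] at this
    refine le_trans (le_of_eq ?_) (this.trans (le_of_eq (by ring)))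
    congr 1
    abel
  · have h1 := hasDerivAt_slice_y (p := (p.1, p.2.1, y))
      (hF.differentiableAt (((hsub y hy).trans hp).trans_lt hρ))
    have h2 := (hasDerivAt_id y).smul_const (_root_.fderiv ℝ F (p.1, p.2.1, 0) (0, 0, 1))
    simp only [one_smul] at h2
    exact (h1.sub h2).hasDerivWithinAt
  · rw [← sub_apply]
    refine (ContinuousLinearMap.le_of_opNorm_le _ (hC (p.1, p.2.1, y)
      ((hsub y hy).trans hp)) _).trans ?_
    have h1 := hsub y hy
    have h2 : ‖((0, 0, 1) : Pt)‖ = 1 := by simp [Prod.norm_def]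
    rw [h2, mul_one]
    exact mul_le_mul_of_nonneg_left h1 h0

end

/-! ## The local geometry of a Morse-Bott torus -/

/-- The vector field `∂/∂z`. -/
def dZ : SPt := (0, 1, 0, 0)

namespace Torus

variable (M : Torus)

theorem torusSmooth_h : TorusSmooth M.T M.ρ M.h := ⟨M.h_smooth, M.h_periodic_z, M.h_periodic_x⟩

theorem torusSmooth_J : TorusSmooth M.T M.ρ M.J :=
  ⟨M.J_compatible.smooth, M.J_periodic_z, M.J_periodic_x⟩

theorem torusSmooth_reeb : TorusSmooth M.T M.ρ (reeb M.h) := by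
  have h := M.torusSmooth_h
  have h' := h.fderiv
  refine ⟨reeb_smooth M.h_smooth M.h_pos, fun z x y => ?_, fun z x y => ?_⟩
  · simp only [reeb, h.periodic_z, h'.periodic_z]
  · simp only [reeb, h.periodic_x, h'.periodic_x]

variable {M}

theorem mem_region_zero (z x : ℝ) : |((z, x, 0) : Pt).2.2| < M.ρ := by
  simpa using M.ρ_pos

theorem reeb_torus (z x : ℝ) : reeb M.h (z, x, 0) = (1, 0, 0) := by
  simp [reeb, M.h_torus, M.dh_torus]

theorem J_dA {p : Pt} (hp : |p.2.2| < M.ρ) : M.J p dA = (0, reeb M.h p) :=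
  M.J_compatible.map_dA p hp

theorem J_torus_dA (z x : ℝ) : M.J (z, x, 0) dA = dZ := by
  rw [J_dA (mem_region_zero z x), reeb_torus]
  rfl

theorem J_torus_dZ (z x : ℝ) : M.J (z, x, 0) dZ = -dA := by
  have h := M.J_compatible.map_reeb (z, x, 0) (mem_region_zero z x)
  rwa [reeb_torus] at h

theorem J_torus_dY (z x : ℝ) : M.J (z, x, 0) dY = -dX := by
  have h := M.J_compatible.sq_contact (z, x, 0) (0, 1, 0) (mem_region_zero z x)
    (by simp [form_apply])
  have e : M.J (z, x, 0) (0, 0, 1, 0) = dY := M.J_torus z x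
  rw [e] at h
  exact h

theorem J_torus_apply (z x : ℝ) (V : SPt) :
    M.J (z, x, 0) V = (-V.2.1, V.1, -V.2.2.2, V.2.2.1) := by
  have e : V = V.1 • dA + V.2.1 • dZ + V.2.2.1 • dX + V.2.2.2 • dY := by
    ext <;> simp [dA, dZ, dX, dY]
  conv_lhs => rw [e]
  simp only [map_add, map_smul, J_torus_dA, J_torus_dZ, J_torus_dY, M.J_torus]
  ext <;> simp [dA, dZ, dX, dY]

variable (M)

/-- The coefficient `κ` of the linearized Reeb flow along the torus:
`∂R/∂y = κ ∂/∂x` at `(z, x, 0)`. -/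
noncomputable def twist (p : Pt) : ℝ := (fderiv ℝ (reeb M.h) (p.1, p.2.1, 0) (0, 0, 1)).2.1

variable {M}

theorem fderiv_h_fderiv_apply_dx (z x : ℝ) :
    fderiv ℝ (fderiv ℝ M.h) (z, x, 0) (0, 1, 0) = 0 := by
  have hd := M.torusSmooth_h.fderiv.differentiableAt (mem_region_zero (M := M) z x)
  have h1 : HasDerivAt (fun x : ℝ => ((z, x, 0) : Pt)) (0, 1, 0) x :=
    (hasDerivAt_const _ _).prodMk ((hasDerivAt_id _).prodMk (hasDerivAt_const _ _))
  have h2 := hd.hasFDerivAt.comp_hasDerivAt x h1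
  have h3 : (fderiv ℝ M.h ∘ fun x : ℝ => ((z, x, 0) : Pt)) = fun _ => 0 := by
    funext x
    exact M.dh_torus z x
  rw [h3] at h2
  exact h2.unique (hasDerivAt_const _ _)

/-- Since dh vanishes along the torus, so does its derivative in the tangential direction x;
symmetry of second derivatives exchanges x and y. This keeps ∂R/∂y tangent to the torus. -/
theorem fderiv_h_symm (z x : ℝ) :
    fderiv ℝ (fderiv ℝ M.h) (z, x, 0) (0, 0, 1) (0, 1, 0) = 0 := by
  have h := (M.torusSmooth_h.contDiffAt (mem_region_zero (M := M) z x)).isSymmSndFDerivAt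
    (by simpa using natCast_le_infty 2)
  rw [h.eq, fderiv_h_fderiv_apply_dx]
  rfl

/-- The z-component of R is 1/h + y R_x, where R_x is its x-component, and dh and R_x vanish on the
torus. In the y-component, the derivative of the numerator h_x + y h_z is h_xy + h_z, which vanishes
there. -/
theorem fderiv_reeb_dy (z x y : ℝ) :
    fderiv ℝ (reeb M.h) (z, x, 0) (0, 0, 1) = (0, M.twist (z, x, y), 0) := by
  set p : Pt := (z, x, 0) with hp
  have hmem : |p.2.2| < M.ρ := mem_region_zero z x
  have hR := hasDerivAt_slice_y (M.torusSmooth_reeb.differentiableAt hmem)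
  have hh := hasDerivAt_slice_y (M.torusSmooth_h.differentiableAt hmem)
  have hdh := hasDerivAt_slice_y (M.torusSmooth_h.fderiv.differentiableAt hmem)
  have hh0 : fderiv ℝ M.h p (0, 0, 1) = 0 := by rw [hp, M.dh_torus]; rfl
  rw [hh0] at hh
  simp only [hp] at hR hh hdh
  have hR1 : HasDerivAt (fun y : ℝ => (reeb M.h (z, x, y)).1) _ 0 :=
    hR.fst
  have hR2 : HasDerivAt (fun y : ℝ => (reeb M.h (z, x, y)).2.1) _ 0 := hR.snd.fst
  have hR3 : HasDerivAt (fun y : ℝ => (reeb M.h (z, x, y)).2.2) _ 0 := hR.snd.snd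
  have hone : M.h (z, x, 0) ≠ 0 := by rw [M.h_torus]; exact one_ne_zero
  have c1 : (fderiv ℝ (reeb M.h) (z, x, 0) (0, 0, 1)).1 = 0 := by
    have e : (fun y : ℝ => (reeb M.h (z, x, y)).1)
        = fun y => (M.h (z, x, y))⁻¹ + y * (reeb M.h (z, x, y)).2.1 := by
      funext y
      simp [reeb]
      ring
    rw [e] at hR1
    have h2 := (hh.inv hone).add ((hasDerivAt_id (0 : ℝ)).mul hR2)
    have h3 := hR1.unique h2
    rw [h3]
    simp [reeb_torus]
  have c3 : (fderiv ℝ (reeb M.h) (z, x, 0) (0, 0, 1)).2.2 = 0 := by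
    have hx : HasDerivAt (fun y : ℝ => fderiv ℝ M.h (z, x, y) (0, 1, 0)) 0 0 := by
      have := hdh.clm_apply (hasDerivAt_const (0 : ℝ) ((0, 1, 0) : Pt))
      simpa [fderiv_h_symm] using this
    have hz : HasDerivAt (fun y : ℝ => fderiv ℝ M.h (z, x, y) (1, 0, 0)) _ 0 :=
      hdh.clm_apply (hasDerivAt_const (0 : ℝ) ((1, 0, 0) : Pt))
    have h2 := ((hx.add ((hasDerivAt_id (0 : ℝ)).mul hz)).neg).div (hh.pow 2) (pow_ne_zero 2 hone)
    have h3 := hR3.unique h2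
    rw [h3]
    simp [M.dh_torus]
  exact Prod.ext c1 (Prod.ext rfl c3)

theorem fderiv_reeb_torus (z x y : ℝ) (ζ : Pt) :
    fderiv ℝ (reeb M.h) (z, x, 0) ζ = (0, M.twist (z, x, y) * ζ.2.2, 0) := by
  have hd := M.torusSmooth_reeb.differentiableAt (mem_region_zero (M := M) z x)
  have hz : fderiv ℝ (reeb M.h) (z, x, 0) (1, 0, 0) = 0 := by
    have h1 : HasDerivAt (fun z : ℝ => ((z, x, 0) : Pt)) (1, 0, 0) z :=
      (hasDerivAt_id _).prodMk (hasDerivAt_const _ _)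
    have h2 := hd.hasFDerivAt.comp_hasDerivAt z h1
    have h3 : (reeb M.h ∘ fun z : ℝ => ((z, x, 0) : Pt)) = fun _ => (1, 0, 0) := by
      funext z
      exact reeb_torus z x
    rw [h3] at h2
    exact h2.unique (hasDerivAt_const _ _)
  have hx : fderiv ℝ (reeb M.h) (z, x, 0) (0, 1, 0) = 0 := by
    have h1 : HasDerivAt (fun x : ℝ => ((z, x, 0) : Pt)) (0, 1, 0) x :=
      (hasDerivAt_const _ _).prodMk ((hasDerivAt_id _).prodMk (hasDerivAt_const _ _))
    have h2 := hd.hasFDerivAt.comp_hasDerivAt x h1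
    have h3 : (reeb M.h ∘ fun x : ℝ => ((z, x, 0) : Pt)) = fun _ => (1, 0, 0) := by
      funext x
      exact reeb_torus z x
    rw [h3] at h2
    exact h2.unique (hasDerivAt_const _ _)
  have e : ζ = ζ.1 • ((1, 0, 0) : Pt) + ζ.2.1 • ((0, 1, 0) : Pt) + ζ.2.2 • ((0, 0, 1) : Pt) := by
    ext <;> simp
  conv_lhs => rw [e]
  simp only [map_add, map_smul, hz, hx, fderiv_reeb_dy z x y]
  ext <;> simp [mul_comm]

theorem contDiff_twist : ContDiff ℝ ∞ M.twist := by
  have h := M.torusSmooth_reeb.fderiv.smooth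
  have h1 : ContDiff ℝ ∞ fun p : Pt => fderiv ℝ (reeb M.h) (p.1, p.2.1, 0) := by
    rw [← contDiffOn_univ]
    refine h.comp (t := {p : Pt | |p.2.2| < M.ρ}) (s := Set.univ)
      (f := fun p : Pt => ((p.1, p.2.1, 0) : Pt)) (ContDiff.contDiffOn (by fun_prop)) ?_
    intro p _
    exact mem_region_zero p.1 p.2.1
  exact (h1.clm_apply contDiff_const).snd.fst

theorem torusSmooth_twist (ρ : ℝ) : TorusSmooth M.T ρ M.twist := by
  have h := M.torusSmooth_reeb.fderiv
  refine ⟨contDiff_twist.contDiffOn, fun z x y => ?_, fun z x y => ?_⟩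
  · simp only [twist, h.periodic_z]
  · simp only [twist, h.periodic_x]

/-- The field (0, ∫₀ᵗ κ, 1) solves the linearized flow. If the total integral of κ vanished it would
close up after time T without being tangent to the torus, against the Morse-Bott condition. -/
theorem integral_twist_ne_zero (x : ℝ) : ∫ t in (0 : ℝ)..M.T, M.twist (t, x, 0) ≠ 0 := by
  intro h0
  have hc : Continuous fun t : ℝ => M.twist (t, x, 0) :=
    contDiff_twist.continuous.comp (by fun_prop)
  have hmb := M.morse_bott x (fun t => (0, ∫ τ in (0 : ℝ)..t, M.twist (τ, x, 0), 1))
    (fun t => ?_) (by simp [h0]) 0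
  · simp at hmb
  · rw [fderiv_reeb_torus t x 0]
    have h1 : HasDerivAt (fun t : ℝ => ∫ τ in (0 : ℝ)..t, M.twist (τ, x, 0))
        (M.twist (t, x, 0)) t :=
      intervalIntegral.integral_hasDerivAt_right (hc.intervalIntegrable _ _)
        (hc.stronglyMeasurableAtFilter _ _) hc.continuousAt
    simpa using (hasDerivAt_const t (0 : ℝ)).prodMk (h1.prodMk (hasDerivAt_const t (1 : ℝ)))

/-- The nonvanishing is uniform by continuity and periodicity in x. The resulting constant enters
the rate of decay. -/
theorem exists_integral_twist_bound :
    ∃ c : ℝ, 0 < c ∧ ∀ x : ℝ, c ≤ |∫ t in (0 : ℝ)..M.T, M.twist (t, x, 0)| := by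
  have hc : Continuous fun x : ℝ => |∫ t in (0 : ℝ)..M.T, M.twist (t, x, 0)| := by
    refine (intervalIntegral.continuous_parametric_intervalIntegral_of_continuous'
      (f := fun x t : ℝ => M.twist (t, x, 0)) ?_ 0 M.T).abs
    exact contDiff_twist.continuous.comp (by fun_prop)
  obtain ⟨x₁, -, h1⟩ := isCompact_Icc.exists_isMinOn (s := Set.Icc (0 : ℝ) 1) (by simp)
    hc.continuousOn
  refine ⟨_, abs_pos.2 (integral_twist_ne_zero (M := M) x₁), fun x => ?_⟩
  obtain ⟨x', hx', hxx⟩ := Function.Periodic.exists_mem_Ico₀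
    (f := fun x => |∫ t in (0 : ℝ)..M.T, M.twist (t, x, 0)|) (c := 1)
    (fun x => by simp only [(torusSmooth_twist (M := M) 1).periodic_x]) one_pos x
  exact (h1 (Set.Ico_subset_Icc_self hx')).trans_eq hxx.symm

/-- Differentiate J R = -∂/∂a in y: at the torus R = ∂/∂z and ∂R/∂y = κ ∂/∂x, which J maps to κ
∂/∂y. Thus κ is visible in J to first order. -/
theorem fderiv_J_dy (z x y : ℝ) :
    fderiv ℝ M.J (z, x, 0) (0, 0, 1) dZ = -(M.twist (z, x, y) • dY) := by
  set p : Pt := (z, x, 0) with hp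
  have hmem : |p.2.2| < M.ρ := mem_region_zero z x
  have hR := hasDerivAt_slice_y (M.torusSmooth_reeb.differentiableAt hmem)
  have hJ := hasDerivAt_slice_y (M.torusSmooth_J.differentiableAt hmem)
  simp only [hp] at hR hJ
  have h1 := hJ.clm_apply ((hasDerivAt_const (0 : ℝ) (0 : ℝ)).prodMk hR)
  have h2 : (fun y : ℝ => M.J (z, x, y) ((0 : ℝ), reeb M.h (z, x, y))) =ᶠ[𝓝 0] fun _ => -dA := by
    have : ∀ᶠ y : ℝ in 𝓝 0, |y| < M.ρ :=
      (isOpen_lt continuous_abs continuous_const).mem_nhds (by simpa using M.ρ_pos)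
    filter_upwards [this] with y hy
    exact M.J_compatible.map_reeb (z, x, y) hy
  have h3 := h1.unique ((hasDerivAt_const (0 : ℝ) (-dA)).congr_of_eventuallyEq h2)
  rw [reeb_torus, fderiv_reeb_dy z x y] at h3
  have h4 : M.J (z, x, 0) ((0 : ℝ), (0 : ℝ), M.twist (z, x, y), (0 : ℝ))
      = M.twist (z, x, y) • dY := by
    rw [J_torus_apply]
    simp [dY]
  rw [h4] at h3
  exact eq_neg_of_add_eq_zero_left h3

/-- Expansion of `J ∂/∂z` to second order in `y`. -/
theorem exists_J_dZ_bound {ρ' : ℝ} (hρ : ρ' < M.ρ) : ∃ C : ℝ, 0 ≤ C ∧ ∀ p : Pt, |p.2.2| ≤ ρ' →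
    ‖M.J p dZ + dA + (M.twist p * p.2.2) • dY‖ ≤ C * |p.2.2| ^ 2 := by
  obtain ⟨C, h0, hC⟩ := M.torusSmooth_J.exists_taylor M.T_pos hρ
  refine ⟨C, h0, fun p hp => ?_⟩
  have h1 := ContinuousLinearMap.le_of_opNorm_le _ (hC p hp) dZ
  have h2 : ‖dZ‖ = 1 := by simp [dZ, Prod.norm_def]
  rw [h2, mul_one] at h1
  refine le_trans (le_of_eq ?_) h1
  congr 1
  simp only [sub_apply, smul_apply, J_torus_dZ,
    fderiv_J_dy p.1 p.2.1 p.2.2]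
  rw [smul_neg, sub_neg_eq_add, sub_neg_eq_add, smul_smul, mul_comm]

end Torus

end MorseBott

namespace MorseBott

/-! ## Expansion of `J_δ` near the torus -/

theorem exists_bound_iteratedFDeriv_of_periodic {f : ℝ → ℝ} (hf : ContDiff ℝ ∞ f)
    (hp : ∀ x, f (x + 1) = f x) (n : ℕ) : ∃ C : ℝ, 0 ≤ C ∧ ∀ x, ‖iteratedFDeriv ℝ n f x‖ ≤ C := by
  have hper : Function.Periodic (iteratedFDeriv ℝ n f) 1 := fun x => by
    have h := iteratedFDeriv_comp_add_right (𝕜 := ℝ) (f := f) n 1 x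
    rw [show (fun x => f (x + 1)) = f from funext hp] at h
    exact h.symm
  have hc : Continuous (iteratedFDeriv ℝ n f) :=
    hf.continuous_iteratedFDeriv (natCast_le_infty n)
  obtain ⟨C, hC⟩ := isCompact_Icc.exists_bound_of_continuousOn
    (hc.continuousOn (s := Set.Icc (0 : ℝ) 1))
  refine ⟨|C|, abs_nonneg C, fun x => ?_⟩
  obtain ⟨y, hy, hxy⟩ := hper.exists_mem_Ico₀ one_pos x
  rw [hxy]
  exact (hC y (Set.Ico_subset_Icc_self hy)).trans (le_abs_self C)

/-- A common bound of a perturbing function and its first two derivatives. -/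
theorem IsPerturbingFunction.exists_bound {f : ℝ → ℝ} (hf : IsPerturbingFunction f) :
    ∃ C : ℝ, 0 ≤ C ∧ (∀ x, |f x| ≤ C) ∧ (∀ x, |deriv f x| ≤ C) ∧ ∀ x, |deriv (deriv f) x| ≤ C := by
  obtain ⟨C₀, h0, b0⟩ := exists_bound_iteratedFDeriv_of_periodic hf.smooth hf.periodic 0
  obtain ⟨C₁, h1, b1⟩ := exists_bound_iteratedFDeriv_of_periodic hf.smooth hf.periodic 1
  obtain ⟨C₂, h2, b2⟩ := exists_bound_iteratedFDeriv_of_periodic hf.smooth hf.periodic 2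
  refine ⟨C₀ + C₁ + C₂, by positivity, fun x => ?_, fun x => ?_, fun x => ?_⟩
  · have := b0 x
    rw [norm_iteratedFDeriv_zero, Real.norm_eq_abs] at this
    linarith
  · have := b1 x
    rw [norm_iteratedFDeriv_eq_norm_iteratedDeriv, iteratedDeriv_one, Real.norm_eq_abs] at this
    linarith
  · have := b2 x
    rw [norm_iteratedFDeriv_eq_norm_iteratedDeriv, iteratedDeriv_succ, iteratedDeriv_one,
      Real.norm_eq_abs] at this
    linarith

theorem norm_dA : ‖dA‖ = 1 := by simp [dA, Prod.norm_def]

theorem norm_dY : ‖dY‖ = 1 := by simp [dY, Prod.norm_def]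

namespace Torus

variable {M : Torus} {f : ℝ → ℝ} {δ : ℝ}

theorem fderiv_hδ_apply (hf : ContDiff ℝ ∞ f) {p : Pt} (hp : |p.2.2| < M.ρ) (v : Pt) :
    fderiv ℝ (M.hδ f δ) p v
      = Real.exp (δ * f p.2.1) * (fderiv ℝ M.h p v + δ * deriv f p.2.1 * v.2.1 * M.h p) := by
  have h1 : HasFDerivAt (fun p : Pt => p.2.1)
      ((ContinuousLinearMap.fst ℝ ℝ ℝ).comp (ContinuousLinearMap.snd ℝ ℝ (ℝ × ℝ))) p :=
    ((ContinuousLinearMap.fst ℝ ℝ ℝ).comp (ContinuousLinearMap.snd ℝ ℝ (ℝ × ℝ))).hasFDerivAt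
  have h2 : HasDerivAt (fun x => Real.exp (δ * f x))
      (Real.exp (δ * f p.2.1) * (δ * deriv f p.2.1)) p.2.1 :=
    (((hf.differentiable (by simp)) p.2.1).hasDerivAt.const_mul δ).exp
  have h3 := h2.comp_hasFDerivAt p h1
  have h4 : HasFDerivAt (M.hδ f δ) _ p :=
    h3.mul (M.torusSmooth_h.differentiableAt hp).hasFDerivAt
  rw [h4.fderiv]
  simp
  ring

theorem reeb_hδ (hf : ContDiff ℝ ∞ f) {p : Pt} (hp : |p.2.2| < M.ρ) :
    reeb (M.hδ f δ) p = Real.exp (-(δ * f p.2.1)) •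
      (reeb M.h p - (δ * deriv f p.2.1 / M.h p) • ((0, 0, 1) : Pt)) := by
  have hh : M.h p ≠ 0 := (M.h_pos p hp).ne'
  have he : Real.exp (δ * f p.2.1) ≠ 0 := (Real.exp_pos _).ne'
  rw [Real.exp_neg]
  simp only [reeb, fderiv_hδ_apply hf hp, hδ]
  ext
  · simp
    field_simp
  · simp
    field_simp
  · simp
    field_simp
    ring

/-- Insert R_δ = e^{-δ f} (R - (δ f'/h) ∂/∂y). In the product λ_δ(v) R_δ the exponentials cancel, so
the contact projection changes only by a multiple of ∂/∂y, and J R = -∂/∂a does the rest. -/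
theorem Jδ_formula (hf : ContDiff ℝ ∞ f) {p : Pt} (hp : |p.2.2| < M.ρ) (V : SPt) :
    M.Jδ f δ p V = M.J p V
      + V.1 • ((0, (Real.exp (-(δ * f p.2.1)) - 1) • reeb M.h p
          - (Real.exp (-(δ * f p.2.1)) * (δ * deriv f p.2.1 / M.h p)) • ((0, 0, 1) : Pt)) : SPt)
      + (form M.h p V.2 * (1 - Real.exp (δ * f p.2.1))) • dA
      + (form M.h p V.2 * (δ * deriv f p.2.1 / M.h p)) • M.J p dY := by
  have hee : Real.exp (δ * f p.2.1) * Real.exp (-(δ * f p.2.1)) = 1 := by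
    rw [← Real.exp_add]; simp
  set c := δ * deriv f p.2.1 / M.h p
  set e := Real.exp (δ * f p.2.1)
  set e' := Real.exp (-(δ * f p.2.1))
  set ϖ := form M.h p V.2
  have hV : M.J p V = V.1 • (0, reeb M.h p) + M.J p (0, V.2) := by
    rw [← J_dA hp, ← map_smul, ← map_add]
    congr 1
    ext <;> simp [dA]
  have hred : ((0 : ℝ), V.2 - form (M.hδ f δ) p V.2 • reeb (M.hδ f δ) p)
      = ((0 : ℝ), V.2) - ϖ • ((0 : ℝ), reeb M.h p) + (ϖ * c) • dY := by
    rw [form_hδ, reeb_hδ hf hp, smul_smul, show e * ϖ * e' = ϖ by linear_combination ϖ * hee]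
    ext <;> simp [dY] <;> ring
  rw [Jδ_apply, hred, map_add, map_sub, map_smul, map_smul, M.J_compatible.map_reeb p hp, hV,
    form_hδ, reeb_hδ hf hp]
  simp only [smul_sub, smul_neg, smul_smul, sub_smul, one_smul, mul_sub, mul_one]
  ext <;> simp [dA] <;> ring

variable (M) in
/-- The expansion of `-J_δ` near `∂/∂z` over the torus, with an error quadratic in
`(δ, y)` and the deviation from the Reeb direction. -/
theorem exists_Jδ_expansion (hf : ContDiff ℝ ∞ f) {F₀ : ℝ} (hF : 0 ≤ F₀) (hf0 : ∀ x, |f x| ≤ F₀)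
    (hf1 : ∀ x, |deriv f x| ≤ F₀) :
    ∃ C : ℝ, 0 ≤ C ∧ ∀ δ : ℝ, 0 ≤ δ → δ * F₀ ≤ 1 → ∀ p : Pt, |p.2.2| ≤ M.ρ / 2 → ∀ V : SPt,
      ‖-M.Jδ f δ p V - ((Real.exp (δ * f p.2.1) + (V.2.1 - 1), -V.1,
        δ * deriv f p.2.1 + V.2.2.2, M.twist p * p.2.2 - V.2.2.1) : SPt)‖
        ≤ C * (δ + |p.2.2|) * (‖V - dZ‖ + |p.2.2|) := by
  have hρ : M.ρ / 2 < M.ρ := by have := M.ρ_pos; linarith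
  obtain ⟨C₁, h1, b1⟩ := exists_J_dZ_bound (M := M) hρ
  obtain ⟨C₂, h2, b2⟩ := M.torusSmooth_J.exists_lipschitz M.T_pos hρ
  obtain ⟨C₃, h3, b3⟩ := M.torusSmooth_J.exists_bound M.T_pos hρ
  obtain ⟨C₄, h4, b4⟩ := M.torusSmooth_h.exists_lipschitz M.T_pos hρ
  obtain ⟨C₅, h5, b5⟩ := M.torusSmooth_h.exists_bound M.T_pos hρ
  obtain ⟨C₆, h6, b6⟩ := M.torusSmooth_reeb.exists_bound M.T_pos hρ
  have hinv : TorusSmooth M.T M.ρ fun p => (M.h p)⁻¹ :=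
    ⟨M.h_smooth.inv fun p hp => (M.h_pos p hp).ne', fun z x y => by rw [M.h_periodic_z],
      fun z x y => by rw [M.h_periodic_x]⟩
  obtain ⟨C₇, h7, b7⟩ := hinv.exists_bound M.T_pos hρ
  have hρ0 := M.ρ_pos
  set W := C₅ * (1 + M.ρ)
  have hW : 0 ≤ W := by positivity
  refine ⟨C₁ + 2 * F₀ * C₄ + F₀ * C₂ + (C₂ + (2 * F₀ * C₆ + 3 * (F₀ * C₇)) + W * (2 * F₀)
    + W * (F₀ * C₇) * C₃), by positivity, ?_⟩
  intro δ hδ hδF p hp V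
  have hpρ := hp.trans_lt hρ
  set y := p.2.2 with hy
  set w := V - dZ with hw
  set e := Real.exp (δ * f p.2.1) with he
  set e' := Real.exp (-(δ * f p.2.1)) with he'
  have hab : |δ * f p.2.1| ≤ δ * F₀ := by
    rw [abs_mul, abs_of_nonneg hδ]
    exact mul_le_mul_of_nonneg_left (hf0 _) hδ
  have hE : |1 - e| ≤ 2 * F₀ * δ := by
    rw [abs_sub_comm]
    refine (Real.abs_exp_sub_one_le (hab.trans hδF)).trans ?_
    linarith
  have hE' : |e' - 1| ≤ 2 * F₀ * δ := by
    refine (Real.abs_exp_sub_one_le (by rw [abs_neg]; exact hab.trans hδF)).trans ?_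
    rw [abs_neg]
    linarith
  have hE3 : |e'| ≤ 3 := by
    have : |e'| ≤ |e' - 1| + |1| := by simpa using abs_add_le (e' - 1) 1
    rw [abs_one] at this
    linarith
  have hg : |δ * deriv f p.2.1| ≤ F₀ * δ := by
    rw [abs_mul, abs_of_nonneg hδ, mul_comm]
    exact mul_le_mul_of_nonneg_right (hf1 _) hδ
  have hhpos := M.h_pos p hpρ
  have hc : |δ * deriv f p.2.1 / M.h p| ≤ F₀ * C₇ * δ := by
    rw [div_eq_mul_inv, abs_mul]
    calc _ ≤ F₀ * δ * C₇ := mul_le_mul hg (b7 p hp) (abs_nonneg _) (by positivity)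
      _ = _ := by ring
  have hform : ∀ v : SPt, |form M.h p v.2| ≤ W * ‖v‖ := by
    intro v
    rw [form_apply, abs_mul]
    have a1 : |M.h p| ≤ C₅ := b5 p hp
    have a2 : |v.2.1| ≤ ‖v‖ := (norm_fst_le v.2).trans (norm_snd_le v)
    have a3 : |v.2.2.1| ≤ ‖v‖ :=
      ((norm_fst_le v.2.2).trans (norm_snd_le v.2)).trans (norm_snd_le v)
    have a4 : |v.2.1 - p.2.2 * v.2.2.1| ≤ (1 + M.ρ) * ‖v‖ := by
      refine (abs_sub _ _).trans ?_
      rw [abs_mul]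
      have : |p.2.2| * |v.2.2.1| ≤ M.ρ * ‖v‖ := mul_le_mul hpρ.le a3 (abs_nonneg _) hρ0.le
      linarith
    calc _ ≤ C₅ * ((1 + M.ρ) * ‖v‖) := mul_le_mul a1 a4 (abs_nonneg _) h5
      _ = W * ‖v‖ := by ring
  set D := δ + |y| with hD
  have hyD : |y| ≤ D := by linarith
  have hδD : δ ≤ D := by have := abs_nonneg y; linarith
  have hD0 : 0 ≤ D := hδ.trans hδD
  have hw0 := norm_nonneg w
  have hy0 := abs_nonneg y
  -- With V = dZ + w, the main terms cancel exactly. The remainders coming from dZ vanish on the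
  -- torus and carry a factor |y|, those from w carry ‖w‖, and each has a further factor δ or |y|,
  -- bounded by D.
  have hsplit : -M.Jδ f δ p V - ((e + (V.2.1 - 1), -V.1,
        δ * deriv f p.2.1 + V.2.2.2, M.twist p * y - V.2.2.1) : SPt)
      = -((M.J p dZ + dA + (M.twist p * y) • dY) + ((1 - e) * (M.h p - 1)) • dA
          + (δ * deriv f p.2.1) • (M.J p - M.J (p.1, p.2.1, 0)) dY)
        - ((M.J p - M.J (p.1, p.2.1, 0)) w
          + w.1 • ((0, (e' - 1) • reeb M.h p
            - (e' * (δ * deriv f p.2.1 / M.h p)) • ((0, 0, 1) : Pt)) : SPt)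
          + (form M.h p w.2 * (1 - e)) • dA
          + (form M.h p w.2 * (δ * deriv f p.2.1 / M.h p)) • M.J p dY) := by
    have e1 : V = dZ + w := by rw [hw]; abel
    have e2 : form M.h p dZ.2 = M.h p := by simp [form_apply, dZ]
    have e3 := Jδ_formula (δ := δ) hf hpρ dZ
    rw [e2, mul_div_cancel₀ _ hhpos.ne'] at e3
    have e4 : M.Jδ f δ p V = M.Jδ f δ p dZ + M.Jδ f δ p w := by rw [← map_add, ← e1]
    rw [e4, e3, Jδ_formula hf hpρ w]
    simp only [sub_apply, J_torus_apply]
    have v1 : V.1 = w.1 := by simp [hw, dZ]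
    have v2 : V.2.1 = 1 + w.2.1 := by simp [hw, dZ]
    have v3 : V.2.2.1 = w.2.2.1 := by simp [hw, dZ]
    have v4 : V.2.2.2 = w.2.2.2 := by simp [hw, dZ]
    rw [v1, v2, v3, v4]
    ext <;> simp [dA, dY, dZ, ← he, ← he'] <;> ring
  rw [hsplit]
  have n1 : ‖M.J p dZ + dA + (M.twist p * y) • dY‖ ≤ C₁ * D * |y| := by
    refine (b1 p hp).trans ?_
    rw [pow_two, ← mul_assoc]
    gcongr
  have n2 : ‖((1 - e) * (M.h p - 1)) • dA‖ ≤ 2 * F₀ * C₄ * D * |y| := by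
    rw [norm_smul, norm_dA, mul_one, Real.norm_eq_abs, abs_mul]
    have := b4 p hp
    rw [M.h_torus, Real.norm_eq_abs] at this
    calc _ ≤ (2 * F₀ * δ) * (C₄ * |y|) := mul_le_mul hE this (abs_nonneg _) (by positivity)
      _ ≤ (2 * F₀ * D) * (C₄ * |y|) := by gcongr
      _ = _ := by ring
  have n3 : ‖(δ * deriv f p.2.1) • (M.J p - M.J (p.1, p.2.1, 0)) dY‖ ≤ F₀ * C₂ * D * |y| := by
    rw [norm_smul, Real.norm_eq_abs]
    have := ContinuousLinearMap.le_of_opNorm_le _ (b2 p hp) dY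
    rw [norm_dY, mul_one] at this
    calc _ ≤ (F₀ * δ) * (C₂ * |y|) := mul_le_mul hg this (norm_nonneg _) (by positivity)
      _ ≤ (F₀ * D) * (C₂ * |y|) := by gcongr
      _ = _ := by ring
  have n4 : ‖(M.J p - M.J (p.1, p.2.1, 0)) w‖ ≤ C₂ * D * ‖w‖ := by
    refine (ContinuousLinearMap.le_of_opNorm_le _ (b2 p hp) w).trans ?_
    gcongr
  have n5 : ‖w.1 • ((0, (e' - 1) • reeb M.h p
      - (e' * (δ * deriv f p.2.1 / M.h p)) • ((0, 0, 1) : Pt)) : SPt)‖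
      ≤ (2 * F₀ * C₆ + 3 * (F₀ * C₇)) * D * ‖w‖ := by
    rw [norm_smul, Prod.norm_mk, norm_zero, max_eq_right (norm_nonneg _)]
    have a1 : ‖(e' - 1) • reeb M.h p‖ ≤ 2 * F₀ * δ * C₆ := by
      rw [norm_smul, Real.norm_eq_abs]
      exact mul_le_mul hE' (b6 p hp) (norm_nonneg _) (by positivity)
    have a2 : ‖(e' * (δ * deriv f p.2.1 / M.h p)) • ((0, 0, 1) : Pt)‖ ≤ 3 * (F₀ * C₇ * δ) := by
      rw [norm_smul, Real.norm_eq_abs, abs_mul]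
      have : ‖((0, 0, 1) : Pt)‖ = 1 := by simp [Prod.norm_def]
      rw [this, mul_one]
      exact mul_le_mul hE3 hc (abs_nonneg _) (by norm_num)
    have a3 := norm_sub_le ((e' - 1) • reeb M.h p)
      ((e' * (δ * deriv f p.2.1 / M.h p)) • ((0, 0, 1) : Pt))
    have a4 : ‖w.1‖ ≤ ‖w‖ := norm_fst_le w
    have a5 : ‖(e' - 1) • reeb M.h p - (e' * (δ * deriv f p.2.1 / M.h p)) • ((0, 0, 1) : Pt)‖
        ≤ (2 * F₀ * C₆ + 3 * (F₀ * C₇)) * D := by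
      have : (2 * F₀ * C₆ + 3 * (F₀ * C₇)) * δ ≤ (2 * F₀ * C₆ + 3 * (F₀ * C₇)) * D := by gcongr
      linarith
    calc _ ≤ ‖w‖ * ((2 * F₀ * C₆ + 3 * (F₀ * C₇)) * D) :=
          mul_le_mul a4 a5 (norm_nonneg _) hw0
      _ = _ := by ring
  have n6 : ‖(form M.h p w.2 * (1 - e)) • dA‖ ≤ W * (2 * F₀) * D * ‖w‖ := by
    rw [norm_smul, norm_dA, mul_one, Real.norm_eq_abs, abs_mul]
    calc _ ≤ (W * ‖w‖) * (2 * F₀ * δ) := mul_le_mul (hform w) hE (abs_nonneg _) (by positivity)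
      _ ≤ (W * ‖w‖) * (2 * F₀ * D) := by gcongr
      _ = _ := by ring
  have n7 : ‖(form M.h p w.2 * (δ * deriv f p.2.1 / M.h p)) • M.J p dY‖
      ≤ W * (F₀ * C₇) * C₃ * D * ‖w‖ := by
    rw [norm_smul, Real.norm_eq_abs, abs_mul]
    have := ContinuousLinearMap.le_of_opNorm_le _ (b3 p hp) dY
    rw [norm_dY, mul_one] at this
    calc _ ≤ (W * ‖w‖) * (F₀ * C₇ * δ) * C₃ := mul_le_mul (mul_le_mul (hform w) hc (abs_nonneg _)
          (by positivity)) this (norm_nonneg _) (by positivity)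
      _ ≤ (W * ‖w‖) * (F₀ * C₇ * D) * C₃ := by gcongr
      _ = _ := by ring
  refine (norm_sub_le _ _).trans ?_
  rw [norm_neg]
  have t1 := norm_add₃_le (a := M.J p dZ + dA + (M.twist p * y) • dY)
    (b := ((1 - e) * (M.h p - 1)) • dA)
    (c := (δ * deriv f p.2.1) • (M.J p - M.J (p.1, p.2.1, 0)) dY)
  have t2 := norm_add₄_le (a := (M.J p - M.J (p.1, p.2.1, 0)) w)
    (b := w.1 • ((0, (e' - 1) • reeb M.h p
      - (e' * (δ * deriv f p.2.1 / M.h p)) • ((0, 0, 1) : Pt)) : SPt))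
    (c := (form M.h p w.2 * (1 - e)) • dA)
    (d := (form M.h p w.2 * (δ * deriv f p.2.1 / M.h p)) • M.J p dY)
  have s1 : (C₁ + 2 * F₀ * C₄ + F₀ * C₂) * D * |y|
      ≤ (C₁ + 2 * F₀ * C₄ + F₀ * C₂) * D * (‖w‖ + |y|) := by gcongr; linarith
  have s2 : (C₂ + (2 * F₀ * C₆ + 3 * (F₀ * C₇)) + W * (2 * F₀) + W * (F₀ * C₇) * C₃) * D * ‖w‖
      ≤ (C₂ + (2 * F₀ * C₆ + 3 * (F₀ * C₇)) + W * (2 * F₀) + W * (F₀ * C₇) * C₃) * D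
        * (‖w‖ + |y|) := by gcongr; linarith
  linarith

end Torus

end MorseBott

namespace MorseBott

/-! ## Estimates on a circle -/

theorem sq_integral_abs_le {T : ℝ} (hT : 0 < T) {g : ℝ → ℝ} (hg : Continuous g) :
    (∫ t in (0 : ℝ)..T, |g t|) ^ 2 ≤ T * ∫ t in (0 : ℝ)..T, g t ^ 2 := by
  set m := (∫ t in (0 : ℝ)..T, |g t|) / T with hm
  have h1 : 0 ≤ ∫ t in (0 : ℝ)..T, (|g t| - m) ^ 2 :=
    intervalIntegral.integral_nonneg hT.le fun t _ => sq_nonneg _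
  have h2 : ∫ t in (0 : ℝ)..T, (|g t| - m) ^ 2
      = (∫ t in (0 : ℝ)..T, g t ^ 2) - 2 * m * (∫ t in (0 : ℝ)..T, |g t|) + T * m ^ 2 := by
    have e : ∀ t, (|g t| - m) ^ 2 = g t ^ 2 - 2 * m * |g t| + m ^ 2 := fun t => by
      rw [← sq_abs (g t)]; ring
    simp only [e]
    rw [intervalIntegral.integral_add (Continuous.intervalIntegrable (by fun_prop) _ _)
      (Continuous.intervalIntegrable (by fun_prop) _ _),
      intervalIntegral.integral_sub (Continuous.intervalIntegrable (by fun_prop) _ _)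
      (Continuous.intervalIntegrable (by fun_prop) _ _), intervalIntegral.integral_const_mul]
    simp
  have h3 : ∫ t in (0 : ℝ)..T, |g t| = T * m := by rw [hm]; field_simp
  rw [h2, h3] at h1
  rw [h3]
  nlinarith

theorem abs_sub_zero_le_integral {T : ℝ} {g g' : ℝ → ℝ} (hg : ∀ t, HasDerivAt g (g' t) t)
    (hg' : Continuous g') {t : ℝ} (ht : t ∈ Set.Icc 0 T) :
    |g t - g 0| ≤ ∫ τ in (0 : ℝ)..T, |g' τ| := by
  have h1 : ∫ τ in (0 : ℝ)..t, g' τ = g t - g 0 :=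
    intervalIntegral.integral_eq_sub_of_hasDerivAt (fun τ _ => hg τ) (hg'.intervalIntegrable _ _)
  rw [← h1]
  refine (intervalIntegral.abs_integral_le_integral_abs ht.1).trans ?_
  exact intervalIntegral.integral_mono_interval le_rfl ht.1 ht.2
    (Eventually.of_forall fun _ => abs_nonneg _) (hg'.abs.intervalIntegrable _ _)

/-- Against a function b of mean zero, g may be replaced by g - g 0, so only the oscillation of g
matters. This is how the averages of w and x disappear from the estimates. -/
theorem abs_integral_mul_sub_le {T : ℝ} (hT : 0 < T) {g b : ℝ → ℝ} (hg : Continuous g)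
    (hb : Continuous b) (hb0 : ∫ t in (0 : ℝ)..T, b t = 0) {c : ℝ}
    (hc : ∀ t ∈ Set.Icc 0 T, |g t - g 0| ≤ c) :
    |∫ t in (0 : ℝ)..T, g t * b t| ≤ c * ∫ t in (0 : ℝ)..T, |b t| := by
  have h1 : ∫ t in (0 : ℝ)..T, g t * b t = ∫ t in (0 : ℝ)..T, (g t - g 0) * b t := by
    simp only [sub_mul]
    rw [intervalIntegral.integral_sub (Continuous.intervalIntegrable (by fun_prop) _ _)
      (Continuous.intervalIntegrable (by fun_prop) _ _), intervalIntegral.integral_const_mul, hb0]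
    ring
  rw [h1]
  refine (intervalIntegral.abs_integral_le_integral_abs hT.le).trans ?_
  rw [← intervalIntegral.integral_const_mul]
  refine intervalIntegral.integral_mono_on hT.le (Continuous.intervalIntegrable (by fun_prop) _ _)
    (Continuous.intervalIntegrable (by fun_prop) _ _) fun t ht => ?_
  rw [abs_mul]
  exact mul_le_mul_of_nonneg_right (hc t ht) (abs_nonneg _)

/-- The restrictions to a circle of the components `x`, `y`, `w = z - t` of a map, of the
`t`-derivatives `α`, `ζ`, `χ`, `η` of `a`, `z - t`, `x`, `y`, and of the twist `κ`. -/
structure CircleData (T K c₀ : ℝ) (α ζ χ η x y w κ : ℝ → ℝ) : Prop where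
  T_pos : 0 < T
  c₀_pos : 0 < c₀
  cont_α : Continuous α
  cont_ζ : Continuous ζ
  cont_χ : Continuous χ
  cont_η : Continuous η
  cont_κ : Continuous κ
  deriv_x : ∀ t, HasDerivAt x (χ t) t
  deriv_y : ∀ t, HasDerivAt y (η t) t
  deriv_w : ∀ t, HasDerivAt w (ζ t) t
  integral_α : ∫ t in (0 : ℝ)..T, α t = 0
  integral_ζ : ∫ t in (0 : ℝ)..T, ζ t = 0
  integral_χ : ∫ t in (0 : ℝ)..T, χ t = 0
  integral_η : ∫ t in (0 : ℝ)..T, η t = 0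
  abs_κ_le : ∀ t, |κ t| ≤ K
  integral_κ : c₀ ≤ |∫ t in (0 : ℝ)..T, κ t|

/-- The squared `L²`-norm of the asymptotic operator. -/
noncomputable def operatorSq (T : ℝ) (α ζ χ η y κ : ℝ → ℝ) : ℝ :=
  ∫ t in (0 : ℝ)..T, (α t ^ 2 + ζ t ^ 2 + η t ^ 2 + (κ t * y t - χ t) ^ 2)

/-- The squared sum of the derivatives and `y`. -/
def sumSq (α ζ χ η y : ℝ → ℝ) (t : ℝ) : ℝ := (|α t| + |ζ t| + |χ t| + |η t| + |y t|) ^ 2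

/-- Constant in the supremum estimate for `y`. -/
noncomputable def supConst (T K c₀ : ℝ) : ℝ := 2 * T * ((1 + K * T / c₀) ^ 2 + (1 / c₀) ^ 2)

/-- Constant in the coercivity estimate. -/
noncomputable def coerciveConst (T K c₀ : ℝ) : ℝ :=
  5 * (1 + (T * supConst T K c₀ + (2 * K ^ 2 * (T * supConst T K c₀) + 2)))

/-- Constant in the estimate of the energy by the asymptotic operator. -/
noncomputable def energyConst (T K c₀ : ℝ) : ℝ := (K + 1 + T) * coerciveConst T K c₀

namespace CircleData

variable {T K c₀ : ℝ} {α ζ χ η x y w κ : ℝ → ℝ}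

theorem K_nonneg (h : CircleData T K c₀ α ζ χ η x y w κ) : 0 ≤ K :=
  (abs_nonneg _).trans (h.abs_κ_le 0)

theorem cont_x (h : CircleData T K c₀ α ζ χ η x y w κ) : Continuous x :=
  continuous_iff_continuousAt.2 fun t => (h.deriv_x t).continuousAt

theorem cont_y (h : CircleData T K c₀ α ζ χ η x y w κ) : Continuous y :=
  continuous_iff_continuousAt.2 fun t => (h.deriv_y t).continuousAt

theorem cont_w (h : CircleData T K c₀ α ζ χ η x y w κ) : Continuous w :=
  continuous_iff_continuousAt.2 fun t => (h.deriv_w t).continuousAt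

theorem supConst_nonneg (h : CircleData T K c₀ α ζ χ η x y w κ) : 0 ≤ supConst T K c₀ := by
  have := h.T_pos
  unfold supConst
  positivity

theorem operatorSq_terms (h : CircleData T K c₀ α ζ χ η x y w κ) :
    operatorSq T α ζ χ η y κ = (∫ t in (0 : ℝ)..T, α t ^ 2) + (∫ t in (0 : ℝ)..T, ζ t ^ 2)
      + (∫ t in (0 : ℝ)..T, η t ^ 2) + ∫ t in (0 : ℝ)..T, (κ t * y t - χ t) ^ 2 := by
  have := h.cont_α
  have := h.cont_ζ
  have := h.cont_η
  have := h.cont_χ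
  have := h.cont_κ
  have := h.cont_y
  unfold operatorSq
  rw [intervalIntegral.integral_add (Continuous.intervalIntegrable (by fun_prop) _ _)
      (Continuous.intervalIntegrable (by fun_prop) _ _),
    intervalIntegral.integral_add (Continuous.intervalIntegrable (by fun_prop) _ _)
      (Continuous.intervalIntegrable (by fun_prop) _ _),
    intervalIntegral.integral_add (Continuous.intervalIntegrable (by fun_prop) _ _)
      (Continuous.intervalIntegrable (by fun_prop) _ _)]

theorem integral_sq_nonneg {T : ℝ} (hT : 0 < T) (g : ℝ → ℝ) : 0 ≤ ∫ t in (0 : ℝ)..T, g t ^ 2 :=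
  intervalIntegral.integral_nonneg hT.le fun _ _ => sq_nonneg _

theorem operatorSq_nonneg (h : CircleData T K c₀ α ζ χ η x y w κ) :
    0 ≤ operatorSq T α ζ χ η y κ :=
  intervalIntegral.integral_nonneg h.T_pos.le fun _ _ => by positivity

/-- This is where nondegeneracy enters. As χ has mean zero, y(0) ∫κ = ∫(κ y - χ) - ∫κ (y - y(0)).
Both terms on the right are controlled by the operator, the second because the oscillation of y is
at most ∫|η|. Dividing by |∫κ| ≥ c₀ bounds y(0), and then y. -/
theorem sq_y_le (h : CircleData T K c₀ α ζ χ η x y w κ) {t : ℝ} (ht : t ∈ Set.Icc 0 T) :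
    y t ^ 2 ≤ supConst T K c₀ * operatorSq T α ζ χ η y κ := by
  have hT := h.T_pos
  have hc := h.c₀_pos
  have hK := h.K_nonneg
  have c1 := h.cont_η
  have c2 := h.cont_χ
  have c3 := h.cont_κ
  have c4 := h.cont_y
  set H := ∫ τ in (0 : ℝ)..T, |η τ| with hH
  set G := ∫ τ in (0 : ℝ)..T, |κ τ * y τ - χ τ| with hG
  have hH0 : 0 ≤ H := intervalIntegral.integral_nonneg hT.le fun _ _ => abs_nonneg _
  have hG0 : 0 ≤ G := intervalIntegral.integral_nonneg hT.le fun _ _ => abs_nonneg _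
  have hy : ∀ t ∈ Set.Icc 0 T, |y t - y 0| ≤ H := fun t ht =>
    abs_sub_zero_le_integral h.deriv_y h.cont_η ht
  have e1 : y 0 * ∫ τ in (0 : ℝ)..T, κ τ = (∫ τ in (0 : ℝ)..T, (κ τ * y τ - χ τ))
      - ∫ τ in (0 : ℝ)..T, κ τ * (y τ - y 0) := by
    rw [← intervalIntegral.integral_sub (Continuous.intervalIntegrable (by fun_prop) _ _)
      (Continuous.intervalIntegrable (by fun_prop) _ _)]
    have e : ∀ τ, κ τ * y τ - χ τ - κ τ * (y τ - y 0) = y 0 * κ τ - χ τ := fun τ => by ring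
    simp only [e]
    rw [intervalIntegral.integral_sub (Continuous.intervalIntegrable (by fun_prop) _ _)
      (Continuous.intervalIntegrable (by fun_prop) _ _), intervalIntegral.integral_const_mul,
      h.integral_χ, sub_zero]
  have e2 : |∫ τ in (0 : ℝ)..T, (κ τ * y τ - χ τ)| ≤ G :=
    intervalIntegral.abs_integral_le_integral_abs hT.le
  have e3 : |∫ τ in (0 : ℝ)..T, κ τ * (y τ - y 0)| ≤ K * H * T := by
    have := intervalIntegral.norm_integral_le_of_norm_le_const (a := 0) (b := T)
      (f := fun τ => κ τ * (y τ - y 0)) (C := K * H) fun τ hτ => by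
        rw [Set.uIoc_of_le hT.le] at hτ
        rw [Real.norm_eq_abs, abs_mul]
        exact mul_le_mul (h.abs_κ_le τ) (hy τ (Set.Ioc_subset_Icc_self hτ)) (abs_nonneg _) hK
    rwa [sub_zero, abs_of_pos hT] at this
  have e4 : |y 0| * c₀ ≤ G + K * H * T := by
    calc |y 0| * c₀ ≤ |y 0| * |∫ τ in (0 : ℝ)..T, κ τ| :=
          mul_le_mul_of_nonneg_left h.integral_κ (abs_nonneg _)
      _ = |y 0 * ∫ τ in (0 : ℝ)..T, κ τ| := (abs_mul _ _).symm
      _ ≤ G + K * H * T := by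
          rw [e1]
          exact (abs_sub _ _).trans (add_le_add e2 e3)
  have e5 : |y 0| ≤ (G + K * H * T) / c₀ := by rwa [le_div_iff₀ hc]
  have e6 : |y t| ≤ H * (1 + K * T / c₀) + G * (1 / c₀) := by
    have h1 : |y t| ≤ |y t - y 0| + |y 0| := by simpa using abs_add_le (y t - y 0) (y 0)
    have h2 := hy t ht
    have h3 : H * (1 + K * T / c₀) + G * (1 / c₀) = H + (G + K * H * T) / c₀ := by
      field_simp
      ring
    linarith
  have e7 : H ^ 2 ≤ T * operatorSq T α ζ χ η y κ := by
    refine (sq_integral_abs_le hT c1).trans (mul_le_mul_of_nonneg_left ?_ hT.le)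
    rw [h.operatorSq_terms]
    have := integral_sq_nonneg hT α
    have := integral_sq_nonneg hT ζ
    have := integral_sq_nonneg hT fun t => κ t * y t - χ t
    linarith
  have e8 : G ^ 2 ≤ T * operatorSq T α ζ χ η y κ := by
    refine (sq_integral_abs_le hT (by fun_prop)).trans (mul_le_mul_of_nonneg_left ?_ hT.le)
    rw [h.operatorSq_terms]
    have := integral_sq_nonneg hT α
    have := integral_sq_nonneg hT ζ
    have := integral_sq_nonneg hT η
    linarith
  set A := 1 + K * T / c₀
  set B := 1 / c₀
  calc y t ^ 2 = |y t| ^ 2 := (sq_abs _).symm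
    _ ≤ (H * A + G * B) ^ 2 := by gcongr
    _ ≤ 2 * (H ^ 2 * A ^ 2 + G ^ 2 * B ^ 2) := by nlinarith [sq_nonneg (H * A - G * B)]
    _ ≤ 2 * ((T * operatorSq T α ζ χ η y κ) * A ^ 2 + (T * operatorSq T α ζ χ η y κ) * B ^ 2) := by
        gcongr
    _ = _ := by
        unfold supConst
        ring

theorem integral_sq_y_le (h : CircleData T K c₀ α ζ χ η x y w κ) :
    ∫ t in (0 : ℝ)..T, y t ^ 2 ≤ T * supConst T K c₀ * operatorSq T α ζ χ η y κ := by
  have hT := h.T_pos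
  have c4 := h.cont_y
  have : ∫ t in (0 : ℝ)..T, y t ^ 2
      ≤ ∫ _ in (0 : ℝ)..T, supConst T K c₀ * operatorSq T α ζ χ η y κ :=
    intervalIntegral.integral_mono_on hT.le (Continuous.intervalIntegrable (by fun_prop) _ _)
      (Continuous.intervalIntegrable (by fun_prop) _ _) fun t ht => h.sq_y_le ht
  rw [intervalIntegral.integral_const, sub_zero, smul_eq_mul] at this
  linarith

theorem integral_sq_χ_le (h : CircleData T K c₀ α ζ χ η x y w κ) :
    ∫ t in (0 : ℝ)..T, χ t ^ 2
      ≤ (2 * K ^ 2 * (T * supConst T K c₀) + 2) * operatorSq T α ζ χ η y κ := by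
  have hT := h.T_pos
  have c2 := h.cont_χ
  have c3 := h.cont_κ
  have c4 := h.cont_y
  have h1 : ∫ t in (0 : ℝ)..T, χ t ^ 2
      ≤ ∫ t in (0 : ℝ)..T, (2 * K ^ 2 * y t ^ 2 + 2 * (κ t * y t - χ t) ^ 2) := by
    refine intervalIntegral.integral_mono_on hT.le (Continuous.intervalIntegrable (by fun_prop) _ _)
      (Continuous.intervalIntegrable (by fun_prop) _ _) fun t _ => ?_
    have h2 : κ t ^ 2 ≤ K ^ 2 := by
      rw [← sq_abs]
      have := h.abs_κ_le t
      gcongr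
    have h3 : κ t ^ 2 * y t ^ 2 ≤ K ^ 2 * y t ^ 2 := by gcongr
    nlinarith [sq_nonneg (2 * (κ t * y t) - χ t)]
  rw [intervalIntegral.integral_add (Continuous.intervalIntegrable (by fun_prop) _ _)
    (Continuous.intervalIntegrable (by fun_prop) _ _), intervalIntegral.integral_const_mul,
    intervalIntegral.integral_const_mul] at h1
  have h4 := mul_le_mul_of_nonneg_left h.integral_sq_y_le (show 0 ≤ 2 * K ^ 2 by positivity)
  have h5 := h.operatorSq_terms
  have := integral_sq_nonneg hT α
  have := integral_sq_nonneg hT ζ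
  have := integral_sq_nonneg hT η
  nlinarith

theorem cont_sumSq (h : CircleData T K c₀ α ζ χ η x y w κ) : Continuous (sumSq α ζ χ η y) := by
  have := h.cont_α
  have := h.cont_ζ
  have := h.cont_η
  have := h.cont_χ
  have := h.cont_y
  unfold sumSq
  fun_prop

theorem integral_sumSq_nonneg (h : CircleData T K c₀ α ζ χ η x y w κ) :
    0 ≤ ∫ t in (0 : ℝ)..T, sumSq α ζ χ η y t :=
  intervalIntegral.integral_nonneg h.T_pos.le fun _ _ => sq_nonneg _

/-- Coercivity of the asymptotic operator. -/
theorem integral_sumSq_le (h : CircleData T K c₀ α ζ χ η x y w κ) :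
    ∫ t in (0 : ℝ)..T, sumSq α ζ χ η y t ≤ coerciveConst T K c₀ * operatorSq T α ζ χ η y κ := by
  have hT := h.T_pos
  have c0 := h.cont_α
  have c1 := h.cont_ζ
  have c2 := h.cont_χ
  have c3 := h.cont_η
  have c4 := h.cont_y
  have c5 := h.cont_sumSq
  have h1 : ∫ t in (0 : ℝ)..T, sumSq α ζ χ η y t
      ≤ ∫ t in (0 : ℝ)..T, 5 * (α t ^ 2 + ζ t ^ 2 + χ t ^ 2 + η t ^ 2 + y t ^ 2) := by
    refine intervalIntegral.integral_mono_on hT.le (Continuous.intervalIntegrable (by fun_prop) _ _)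
      (Continuous.intervalIntegrable (by fun_prop) _ _) fun t _ => ?_
    unfold sumSq
    rw [← sq_abs (α t), ← sq_abs (ζ t), ← sq_abs (χ t), ← sq_abs (η t), ← sq_abs (y t)]
    set p := |α t|
    set q := |ζ t|
    set r := |χ t|
    set s := |η t|
    set u := |y t|
    nlinarith [sq_nonneg (p - q), sq_nonneg (p - r), sq_nonneg (p - s), sq_nonneg (p - u),
      sq_nonneg (q - r), sq_nonneg (q - s), sq_nonneg (q - u), sq_nonneg (r - s),
      sq_nonneg (r - u), sq_nonneg (s - u)]
  rw [intervalIntegral.integral_const_mul,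
    intervalIntegral.integral_add (Continuous.intervalIntegrable (by fun_prop) _ _)
      (Continuous.intervalIntegrable (by fun_prop) _ _),
    intervalIntegral.integral_add (Continuous.intervalIntegrable (by fun_prop) _ _)
      (Continuous.intervalIntegrable (by fun_prop) _ _),
    intervalIntegral.integral_add (Continuous.intervalIntegrable (by fun_prop) _ _)
      (Continuous.intervalIntegrable (by fun_prop) _ _),
    intervalIntegral.integral_add (Continuous.intervalIntegrable (by fun_prop) _ _)
      (Continuous.intervalIntegrable (by fun_prop) _ _)] at h1
  have h2 := h.integral_sq_y_le
  have h3 := h.integral_sq_χ_le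
  have h4 := h.operatorSq_terms
  have h5 := integral_sq_nonneg hT fun t => κ t * y t - χ t
  unfold coerciveConst
  linarith

theorem integral_le_sumSq (h : CircleData T K c₀ α ζ χ η x y w κ) {g : ℝ → ℝ} (hg : Continuous g)
    {c : ℝ} (hgs : ∀ t, |g t| ≤ c * sumSq α ζ χ η y t) :
    |∫ t in (0 : ℝ)..T, g t| ≤ c * ∫ t in (0 : ℝ)..T, sumSq α ζ χ η y t := by
  have c5 := h.cont_sumSq
  refine (intervalIntegral.abs_integral_le_integral_abs h.T_pos.le).trans ?_
  rw [← intervalIntegral.integral_const_mul]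
  exact intervalIntegral.integral_mono_on h.T_pos.le
    (Continuous.intervalIntegrable (by fun_prop) _ _)
    (Continuous.intervalIntegrable (by fun_prop) _ _) fun t _ => hgs t

theorem integral_sq_le_sumSq (h : CircleData T K c₀ α ζ χ η x y w κ) {g : ℝ → ℝ}
    (hg : Continuous g)
    (hgs : ∀ t, |g t| ≤ |α t| + |ζ t| + |χ t| + |η t| + |y t|) :
    ∫ t in (0 : ℝ)..T, g t ^ 2 ≤ ∫ t in (0 : ℝ)..T, sumSq α ζ χ η y t := by
  have := h.integral_le_sumSq (g := fun t => g t ^ 2) (c := 1) (by fun_prop) fun t => by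
    rw [one_mul, abs_of_nonneg (sq_nonneg _), ← sq_abs]
    unfold sumSq
    have := hgs t
    gcongr
  rw [one_mul] at this
  exact (le_abs_self _).trans this

theorem two_mul_integral_abs_le (h : CircleData T K c₀ α ζ χ η x y w κ) {g b : ℝ → ℝ}
    (hg : Continuous g) (hb : Continuous b)
    (hgs : ∀ t, |g t| ≤ |α t| + |ζ t| + |χ t| + |η t| + |y t|)
    (hbs : ∀ t, |b t| ≤ |α t| + |ζ t| + |χ t| + |η t| + |y t|) :
    (∫ t in (0 : ℝ)..T, |g t|) * (∫ t in (0 : ℝ)..T, |b t|)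
      ≤ T * ∫ t in (0 : ℝ)..T, sumSq α ζ χ η y t := by
  have hT := h.T_pos
  have h1 := sq_integral_abs_le hT hg
  have h2 := sq_integral_abs_le hT hb
  have h3 := mul_le_mul_of_nonneg_left (h.integral_sq_le_sumSq hg hgs) hT.le
  have h4 := mul_le_mul_of_nonneg_left (h.integral_sq_le_sumSq hb hbs) hT.le
  nlinarith [sq_nonneg ((∫ t in (0 : ℝ)..T, |g t|) - ∫ t in (0 : ℝ)..T, |b t|)]

/-- The energy is bounded by the asymptotic operator. -/
theorem abs_energy_le (h : CircleData T K c₀ α ζ χ η x y w κ) :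
    |∫ t in (0 : ℝ)..T, (κ t * y t ^ 2 - 2 * (χ t * y t) - 2 * (α t * w t))|
      ≤ 2 * energyConst T K c₀ * operatorSq T α ζ χ η y κ := by
  have hT := h.T_pos
  have c0 := h.cont_α
  have c1 := h.cont_ζ
  have c2 := h.cont_χ
  have c4 := h.cont_y
  have c5 := h.cont_sumSq
  have c6 := h.cont_w
  have c7 := h.cont_κ
  have hK := h.K_nonneg
  rw [intervalIntegral.integral_sub (Continuous.intervalIntegrable (by fun_prop) _ _)
      (Continuous.intervalIntegrable (by fun_prop) _ _), intervalIntegral.integral_const_mul]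
  have h1 : |∫ t in (0 : ℝ)..T, (κ t * y t ^ 2 - 2 * (χ t * y t))|
      ≤ (K + 1) * ∫ t in (0 : ℝ)..T, sumSq α ζ χ η y t := by
    refine h.integral_le_sumSq (by fun_prop) fun t => ?_
    refine (abs_sub _ _).trans ?_
    rw [abs_mul, abs_mul, abs_mul, abs_two, abs_of_nonneg (sq_nonneg (y t)), ← sq_abs (y t)]
    have p1 := abs_nonneg (α t)
    have p2 := abs_nonneg (ζ t)
    have p3 := abs_nonneg (χ t)
    have p4 := abs_nonneg (η t)
    have p5 := abs_nonneg (y t)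
    have a1 : |y t| ^ 2 ≤ sumSq α ζ χ η y t := by
      unfold sumSq
      gcongr
      linarith
    have a2 : 2 * (|χ t| * |y t|) ≤ sumSq α ζ χ η y t := by
      unfold sumSq
      calc 2 * (|χ t| * |y t|) ≤ (|χ t| + |y t|) ^ 2 := by nlinarith
        _ ≤ _ := by gcongr; linarith
    have a3 := mul_le_mul (h.abs_κ_le t) a1 (by positivity) hK
    linarith
  -- As α has mean zero, w counts only through its oscillation, which is at most ∫|ζ|.
  have h2 : |∫ t in (0 : ℝ)..T, α t * w t| ≤ T * ∫ t in (0 : ℝ)..T, sumSq α ζ χ η y t := by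
    have := abs_integral_mul_sub_le hT c6 c0 h.integral_α fun t ht =>
      abs_sub_zero_le_integral h.deriv_w c1 ht
    simp only [mul_comm (w _)] at this
    refine this.trans (h.two_mul_integral_abs_le c1 c0 (fun t => ?_) (fun t => ?_))
    · linarith [abs_nonneg (α t), abs_nonneg (χ t), abs_nonneg (η t), abs_nonneg (y t)]
    · linarith [abs_nonneg (ζ t), abs_nonneg (χ t), abs_nonneg (η t), abs_nonneg (y t)]
  refine (abs_sub _ _).trans ?_
  rw [abs_mul, abs_two]
  have h3 : (K + 1 + 2 * T) * (∫ t in (0 : ℝ)..T, sumSq α ζ χ η y t)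
      ≤ (K + 1 + 2 * T) * (coerciveConst T K c₀ * operatorSq T α ζ χ η y κ) :=
    mul_le_mul_of_nonneg_left h.integral_sumSq_le (by positivity)
  have h4 : 0 ≤ coerciveConst T K c₀ * operatorSq T α ζ χ η y κ :=
    h.integral_sumSq_nonneg.trans h.integral_sumSq_le
  unfold energyConst
  nlinarith

/-- The variation of the energy dominates the asymptotic operator, for maps which satisfy the
Cauchy-Riemann equations up to a small error. -/
theorem operatorSq_le_variation (h : CircleData T K c₀ α ζ χ η x y w κ) {μ : ℝ} (hμ : 0 ≤ μ)
    (hsmall : μ * (2 * (1 + K) + 1 + 4 * T) * coerciveConst T K c₀ ≤ 1)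
    {a' w' x' y' κ' : ℝ → ℝ} (ca : Continuous a') (cw : Continuous w') (cx : Continuous x')
    (cy : Continuous y') (cκ : Continuous κ') {g₀ g₁ : ℝ → ℝ} (cg₀ : Continuous g₀)
    (cg₁ : Continuous g₁) (lg₀ : ∀ x₁ x₂, |g₀ x₁ - g₀ x₂| ≤ μ * |x₁ - x₂|)
    (lg₁ : ∀ x₁ x₂, |g₁ x₁ - g₁ x₂| ≤ μ * |x₁ - x₂|) (hκ' : ∀ t, |κ' t| ≤ μ)
    (e₁ : ∀ t, |a' t - g₀ (x t) - ζ t| ≤ μ * (|α t| + |ζ t| + |χ t| + |η t| + |y t|))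
    (e₂ : ∀ t, |w' t + α t| ≤ μ * (|α t| + |ζ t| + |χ t| + |η t| + |y t|))
    (e₃ : ∀ t, |x' t - g₁ (x t) - η t| ≤ μ * (|α t| + |ζ t| + |χ t| + |η t| + |y t|))
    (e₄ : ∀ t, |y' t + χ t - κ t * y t| ≤ μ * (|α t| + |ζ t| + |χ t| + |η t| + |y t|)) :
    operatorSq T α ζ χ η y κ ≤ ∫ t in (0 : ℝ)..T, (κ' t * y t ^ 2 + 2 * (κ t * y t * y' t)
      + 2 * (x' t * η t) - 2 * (χ t * y' t) + 2 * (a' t * ζ t) - 2 * (α t * w' t)) := by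
  have hT := h.T_pos
  have c0 := h.cont_α
  have c1 := h.cont_ζ
  have c2 := h.cont_χ
  have c3 := h.cont_η
  have c4 := h.cont_y
  have c5 := h.cont_sumSq
  have c6 := h.cont_w
  have c7 := h.cont_κ
  have c8 := h.cont_x
  have hK := h.K_nonneg
  set R : ℝ → ℝ := fun t => κ' t * y t ^ 2 + 2 * ((κ t * y t - χ t) * (y' t + χ t - κ t * y t))
    + 2 * ((x' t - g₁ (x t) - η t) * η t) + 2 * ((a' t - g₀ (x t) - ζ t) * ζ t)
    - 2 * (α t * (w' t + α t)) with hR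
  have cR : Continuous R := by fun_prop
  -- Substituting the equations for a', w', x', y' produces two copies of the squared operator; R
  -- collects the errors, and the drifts g₀, g₁ remain paired with ζ, η.
  have split : ∫ t in (0 : ℝ)..T, (κ' t * y t ^ 2 + 2 * (κ t * y t * y' t)
      + 2 * (x' t * η t) - 2 * (χ t * y' t) + 2 * (a' t * ζ t) - 2 * (α t * w' t))
      = 2 * operatorSq T α ζ χ η y κ + (∫ t in (0 : ℝ)..T, R t)
        + 2 * (∫ t in (0 : ℝ)..T, g₀ (x t) * ζ t) + 2 * ∫ t in (0 : ℝ)..T, g₁ (x t) * η t := by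
    unfold operatorSq
    rw [← intervalIntegral.integral_const_mul, ← intervalIntegral.integral_const_mul,
      ← intervalIntegral.integral_const_mul, ← intervalIntegral.integral_add,
      ← intervalIntegral.integral_add, ← intervalIntegral.integral_add]
    · congr 1
      funext t
      simp only [hR]
      ring
    all_goals exact Continuous.intervalIntegrable (by fun_prop) _ _
  have b1 : |∫ t in (0 : ℝ)..T, R t|
      ≤ μ * (2 * (1 + K) + 1) * ∫ t in (0 : ℝ)..T, sumSq α ζ χ η y t := by
    refine h.integral_le_sumSq cR fun t => ?_
    set S := |α t| + |ζ t| + |χ t| + |η t| + |y t| with hS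
    have p1 := abs_nonneg (α t)
    have p2 := abs_nonneg (ζ t)
    have p3 := abs_nonneg (χ t)
    have p4 := abs_nonneg (η t)
    have p5 := abs_nonneg (y t)
    have hS0 : 0 ≤ S := by positivity
    have q1 : |κ' t * y t ^ 2| ≤ μ * S ^ 2 := by
      rw [abs_mul, abs_of_nonneg (sq_nonneg (y t)), ← sq_abs]
      have : |y t| ≤ S := by linarith
      exact mul_le_mul (hκ' t) (by gcongr) (by positivity) hμ
    have q2 : |κ t * y t - χ t| ≤ K * |y t| + |χ t| := by
      refine (abs_sub _ _).trans ?_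
      rw [abs_mul]
      have := mul_le_mul_of_nonneg_right (h.abs_κ_le t) p5
      linarith
    have q3 : |(κ t * y t - χ t) * (y' t + χ t - κ t * y t)| ≤ (K * |y t| + |χ t|) * (μ * S) := by
      rw [abs_mul]
      exact mul_le_mul q2 (e₄ t) (abs_nonneg _) (by positivity)
    have q4 : |(x' t - g₁ (x t) - η t) * η t| ≤ (μ * S) * |η t| := by
      rw [abs_mul]
      exact mul_le_mul_of_nonneg_right (e₃ t) p4
    have q5 : |(a' t - g₀ (x t) - ζ t) * ζ t| ≤ (μ * S) * |ζ t| := by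
      rw [abs_mul]
      exact mul_le_mul_of_nonneg_right (e₁ t) p2
    have q6 : |α t * (w' t + α t)| ≤ |α t| * (μ * S) := by
      rw [abs_mul]
      exact mul_le_mul_of_nonneg_left (e₂ t) p1
    have q7 : |R t| ≤ |κ' t * y t ^ 2| + 2 * |(κ t * y t - χ t) * (y' t + χ t - κ t * y t)|
        + 2 * |(x' t - g₁ (x t) - η t) * η t| + 2 * |(a' t - g₀ (x t) - ζ t) * ζ t|
        + 2 * |α t * (w' t + α t)| := by
      have d0 := abs_nonneg (κ' t * y t ^ 2)
      refine abs_le.2 ⟨?_, ?_⟩ <;> simp only [hR] <;>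
      linarith [neg_abs_le (κ' t * y t ^ 2), le_abs_self (κ' t * y t ^ 2),
        neg_abs_le ((κ t * y t - χ t) * (y' t + χ t - κ t * y t)),
        le_abs_self ((κ t * y t - χ t) * (y' t + χ t - κ t * y t)),
        neg_abs_le ((x' t - g₁ (x t) - η t) * η t), le_abs_self ((x' t - g₁ (x t) - η t) * η t),
        neg_abs_le ((a' t - g₀ (x t) - ζ t) * ζ t), le_abs_self ((a' t - g₀ (x t) - ζ t) * ζ t),
        neg_abs_le (α t * (w' t + α t)), le_abs_self (α t * (w' t + α t))]
    have q8 : (K * |y t| + |χ t|) + |η t| + |ζ t| + |α t| ≤ (1 + K) * S := by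
      have : K * |y t| ≤ K * S := by
        gcongr
        linarith
      linarith
    have q9 := mul_le_mul_of_nonneg_right q8 (mul_nonneg hμ hS0)
    have : sumSq α ζ χ η y t = S ^ 2 := rfl
    rw [this]
    nlinarith
  -- The drifts are not small compared with the derivatives pointwise. Their oscillation over the
  -- circle is, since it is at most μ ∫|χ|, and ζ, η annihilate constants.
  have b2 : ∀ g : ℝ → ℝ, Continuous g → (∀ x₁ x₂, |g x₁ - g x₂| ≤ μ * |x₁ - x₂|) →
      ∀ b : ℝ → ℝ, Continuous b → ∫ t in (0 : ℝ)..T, b t = 0 →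
      (∀ t, |b t| ≤ |α t| + |ζ t| + |χ t| + |η t| + |y t|) →
      |∫ t in (0 : ℝ)..T, g (x t) * b t| ≤ μ * T * ∫ t in (0 : ℝ)..T, sumSq α ζ χ η y t := by
    intro g cg lg b cb hb0 hbs
    have i1 := abs_integral_mul_sub_le hT (g := fun t => g (x t)) (by fun_prop) cb hb0 fun t ht =>
      (lg _ _).trans (mul_le_mul_of_nonneg_left (abs_sub_zero_le_integral h.deriv_x c2 ht) hμ)
    refine i1.trans ?_
    rw [mul_assoc, mul_assoc]
    refine mul_le_mul_of_nonneg_left (h.two_mul_integral_abs_le c2 cb (fun t => ?_) hbs) hμ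
    linarith [abs_nonneg (α t), abs_nonneg (ζ t), abs_nonneg (η t), abs_nonneg (y t)]
  have b3 := b2 g₀ cg₀ lg₀ ζ c1 h.integral_ζ fun t => by
    linarith [abs_nonneg (α t), abs_nonneg (χ t), abs_nonneg (η t), abs_nonneg (y t)]
  have b4 := b2 g₁ cg₁ lg₁ η c3 h.integral_η fun t => by
    linarith [abs_nonneg (α t), abs_nonneg (χ t), abs_nonneg (ζ t), abs_nonneg (y t)]
  -- All errors together are absorbed by one of the two copies of the squared operator; this is the
  -- purpose of the smallness condition on μ.
  have b5 : μ * (2 * (1 + K) + 1 + 4 * T) * (∫ t in (0 : ℝ)..T, sumSq α ζ χ η y t)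
      ≤ operatorSq T α ζ χ η y κ := by
    calc _ ≤ μ * (2 * (1 + K) + 1 + 4 * T)
          * (coerciveConst T K c₀ * operatorSq T α ζ χ η y κ) :=
          mul_le_mul_of_nonneg_left h.integral_sumSq_le (by positivity)
      _ = (μ * (2 * (1 + K) + 1 + 4 * T) * coerciveConst T K c₀) * operatorSq T α ζ χ η y κ := by
          ring
      _ ≤ 1 * operatorSq T α ζ χ η y κ :=
          mul_le_mul_of_nonneg_right hsmall h.operatorSq_nonneg
      _ = _ := one_mul _
  rw [split]
  linarith [neg_abs_le (∫ t in (0 : ℝ)..T, R t),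
    neg_abs_le (∫ t in (0 : ℝ)..T, g₀ (x t) * ζ t), neg_abs_le (∫ t in (0 : ℝ)..T, g₁ (x t) * η t)]

end CircleData

end MorseBott

namespace MorseBott

/-! ## Partial derivatives on the half-cylinder -/

/-- The partial derivative `∂F/∂s`. -/
noncomputable def dS (F : ℝ × ℝ → ℝ) (q : ℝ × ℝ) : ℝ := fderiv ℝ F q (1, 0)

/-- The partial derivative `∂F/∂t`. -/
noncomputable def dT (F : ℝ × ℝ → ℝ) (q : ℝ × ℝ) : ℝ := fderiv ℝ F q (0, 1)

/-- `F` descends to the half-cylinder `(0, ∞) × ℝ / T ℤ`. -/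
def CirclePeriodic (T : ℝ) (F : ℝ × ℝ → ℝ) : Prop := ∀ s t : ℝ, 0 < s → F (s, t + T) = F (s, t)

section
variable {T : ℝ} {F G : ℝ × ℝ → ℝ} {j : ℕ} {B : ℕ → ℝ}

theorem HalfBdd.dT (hF : HalfBdd (j + 1) B F) : HalfBdd j (fun n => B (n + 1)) (dT F) :=
  hF.fderiv_apply (v := (0, 1)) (by simp [Prod.norm_def])

theorem contDiffOn_dS (hF : ContDiffOn ℝ ∞ F openHalf) : ContDiffOn ℝ ∞ (dS F) openHalf :=
  (hF.fderiv_of_isOpen isOpen_openHalf (by simp)).clm_apply contDiffOn_const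

theorem contDiffOn_dT (hF : ContDiffOn ℝ ∞ F openHalf) : ContDiffOn ℝ ∞ (dT F) openHalf :=
  (hF.fderiv_of_isOpen isOpen_openHalf (by simp)).clm_apply contDiffOn_const

theorem differentiableAt_half (hF : ContDiffOn ℝ ∞ F openHalf) {q : ℝ × ℝ} (hq : 0 < q.1) :
    DifferentiableAt ℝ F q := (contDiffAt_of_half hF hq).differentiableAt (by simp)

theorem hasDerivAt_dS (hF : ContDiffOn ℝ ∞ F openHalf) {s : ℝ} (hs : 0 < s) (t : ℝ) :
    HasDerivAt (fun s => F (s, t)) (dS F (s, t)) s :=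
  (differentiableAt_half hF (q := (s, t)) hs).hasFDerivAt.comp_hasDerivAt s
    ((hasDerivAt_id s).prodMk (hasDerivAt_const s t))

theorem hasDerivAt_dT (hF : ContDiffOn ℝ ∞ F openHalf) {s : ℝ} (hs : 0 < s) (t : ℝ) :
    HasDerivAt (fun t => F (s, t)) (dT F (s, t)) t :=
  (differentiableAt_half hF (q := (s, t)) hs).hasFDerivAt.comp_hasDerivAt t
    ((hasDerivAt_const t s).prodMk (hasDerivAt_id t))

theorem continuous_slice_smooth (hF : ContDiffOn ℝ ∞ F openHalf) {s : ℝ} (hs : 0 < s) :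
    Continuous fun t => F (s, t) := continuous_slice hF.continuousOn hs

theorem dS_dT_comm (hF : ContDiffOn ℝ ∞ F openHalf) {q : ℝ × ℝ} (hq : 0 < q.1) :
    dS (dT F) q = dT (dS F) q := by
  have hd : DifferentiableAt ℝ (fderiv ℝ F) q :=
    ((hF.fderiv_of_isOpen isOpen_openHalf (m := ∞) (by simp)).contDiffAt
      (isOpen_openHalf.mem_nhds hq)).differentiableAt (by simp)
  have h1 : ∀ v w : ℝ × ℝ,
      fderiv ℝ (fun p => fderiv ℝ F p v) q w = fderiv ℝ (fderiv ℝ F) q w v := by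
    intro v w
    rw [(hd.hasFDerivAt.clm_apply (hasFDerivAt_const v q)).fderiv]
    simp
  have h2 := (contDiffAt_of_half hF hq).isSymmSndFDerivAt (by simpa using natCast_le_infty 2)
  unfold dS dT
  rw [h1, h1]
  exact h2.eq _ _

theorem CirclePeriodic.fderiv_eq (hp : CirclePeriodic T F) {s : ℝ} (hs : 0 < s) (t : ℝ) :
    fderiv ℝ F (s, t + T) = fderiv ℝ F (s, t) := by
  have h := fderiv_comp_add_right (𝕜 := ℝ) (f := F) (x := (s, t)) (0, T)
  have e : (fun q => F (q + (0, T))) =ᶠ[𝓝 (s, t)] F := by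
    filter_upwards [isOpen_openHalf.mem_nhds (show (s, t) ∈ openHalf from hs)] with q hq
    have := hp q.1 q.2 hq
    simpa [Prod.add_def] using this
  rw [e.fderiv_eq] at h
  simpa using h.symm

theorem CirclePeriodic.dS (hp : CirclePeriodic T F) : CirclePeriodic T (dS F) := fun s t hs => by
  unfold MorseBott.dS
  rw [hp.fderiv_eq hs]

theorem CirclePeriodic.dT (hp : CirclePeriodic T F) : CirclePeriodic T (dT F) := fun s t hs => by
  unfold MorseBott.dT
  rw [hp.fderiv_eq hs]

theorem CirclePeriodic.apply_T (hp : CirclePeriodic T F) {s : ℝ} (hs : 0 < s) :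
    F (s, T) = F (s, 0) := by simpa using hp s 0 hs

theorem integral_dT (hF : ContDiffOn ℝ ∞ F openHalf) (hp : CirclePeriodic T F) {s : ℝ}
    (hs : 0 < s) : ∫ t in (0 : ℝ)..T, dT F (s, t) = 0 := by
  rw [intervalIntegral.integral_eq_sub_of_hasDerivAt (fun t _ => hasDerivAt_dT hF hs t)
    ((continuous_slice_smooth (contDiffOn_dT hF) hs).intervalIntegrable _ _), hp.apply_T hs,
    sub_self]

theorem integral_dT_mul (hF : ContDiffOn ℝ ∞ F openHalf) (hp : CirclePeriodic T F)
    (hG : ContDiffOn ℝ ∞ G openHalf) (hpG : CirclePeriodic T G) {s : ℝ} (hs : 0 < s) :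
    ∫ t in (0 : ℝ)..T, dT F (s, t) * G (s, t) = -∫ t in (0 : ℝ)..T, F (s, t) * dT G (s, t) := by
  have h := intervalIntegral.integral_mul_deriv_eq_deriv_mul (a := 0) (b := T)
    (fun t _ => hasDerivAt_dT hF hs t) (fun t _ => hasDerivAt_dT hG hs t)
    ((continuous_slice_smooth (contDiffOn_dT hF) hs).intervalIntegrable _ _)
    ((continuous_slice_smooth (contDiffOn_dT hG) hs).intervalIntegrable _ _)
  rw [hp.apply_T hs, hpG.apply_T hs] at h
  linarith

theorem dS_circleInt (hF : ContDiffOn ℝ ∞ F openHalf) {q : ℝ × ℝ} (hq : 0 < q.1) :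
    dS (circleInt T F) q = circleInt T (dS F) q := by
  unfold dS
  rw [fderiv_circleInt hF hq]
  unfold circleInt
  have hc : Continuous fun t => (fderiv ℝ F (q.1, t)).comp projS :=
    continuous_slice (F := fun p => (fderiv ℝ F p).comp projS)
      (contDiffOn_fderiv_comp_projS hF).continuousOn hq
  rw [ContinuousLinearMap.intervalIntegral_apply (hc.intervalIntegrable _ _)]
  simp [projS]

theorem circlePeriodic_of_mem {P : ℝ → Prop} (hT : 0 < T) (hp : CirclePeriodic T F) {s : ℝ}
    (hs : 0 < s) (h : ∀ t ∈ Set.Icc 0 T, P (F (s, t))) (t : ℝ) : P (F (s, t)) := by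
  have hper : Function.Periodic (fun t => F (s, t)) T := fun t => hp s t hs
  obtain ⟨t', ht', e⟩ := hper.exists_mem_Ico₀ hT t
  exact (congrArg P e).mpr (h t' (Set.Ico_subset_Icc_self ht'))

end

/-! ## Decay of the energy -/

/-- The inequality φ' ≥ c |φ| allows growth or decay only. A positive value would make φ e^{-c s}
nondecreasing and φ unbounded. Hence φ ≤ 0, and then φ e^{c s} is nondecreasing, which is decay of
|φ|. -/
theorem decay_of_deriv_ge {φ φ' : ℝ → ℝ} {c b : ℝ} (hc : 0 < c)
    (hd : ∀ s, 0 < s → HasDerivAt φ (φ' s) s) (hge : ∀ s, 0 < s → c * |φ s| ≤ φ' s)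
    (hb : ∀ s, 0 < s → |φ s| ≤ b) {σ s : ℝ} (hσ : 0 < σ) (hs : σ ≤ s) :
    |φ s| ≤ |φ σ| * Real.exp (-c * (s - σ)) := by
  have mono : ∀ k : ℝ, (∀ s, 0 < s → 0 ≤ φ' s + k * φ s) →
      MonotoneOn (fun s => φ s * Real.exp (k * s)) (Set.Ioi 0) := by
    intro k hk
    have hder : ∀ s, 0 < s → HasDerivAt (fun s => φ s * Real.exp (k * s))
        ((φ' s + k * φ s) * Real.exp (k * s)) s := by
      intro s hs
      have h1 : HasDerivAt (fun s => Real.exp (k * s)) (Real.exp (k * s) * k) s := by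
        simpa using ((hasDerivAt_id s).const_mul k).exp
      exact ((hd s hs).mul h1).congr_deriv (by ring)
    refine monotoneOn_of_deriv_nonneg (convex_Ioi 0)
      (fun s hs => (hder s hs).continuousAt.continuousWithinAt) (fun s hs => ?_) (fun s hs => ?_)
    · rw [interior_Ioi] at hs
      exact (hder s hs).differentiableAt.differentiableWithinAt
    · rw [interior_Ioi] at hs
      rw [(hder s hs).deriv]
      exact mul_nonneg (hk s hs) (Real.exp_pos _).le
  have hneg : ∀ s, 0 < s → φ s ≤ 0 := by
    intro s₁ hs₁
    by_contra! hpos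
    have hm := mono (-c) fun s hs => by
      have := hge s hs
      have := mul_le_mul_of_nonneg_left (le_abs_self (φ s)) hc.le
      linarith
    -- Chosen so that e^v ≥ 1 + v already forces φ s₂ > b.
    set s₂ := s₁ + (b + 1) / (c * φ s₁) with hs₂
    have hb0 : 0 ≤ b := (abs_nonneg _).trans (hb s₁ hs₁)
    have h12 : s₁ ≤ s₂ := by
      have : 0 ≤ (b + 1) / (c * φ s₁) := by positivity
      linarith
    have h1 : φ s₁ * Real.exp (-c * s₁) ≤ φ s₂ * Real.exp (-c * s₂) :=
      hm hs₁ (hs₁.trans_le h12) h12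
    have h2 : φ s₁ * Real.exp (c * (s₂ - s₁)) ≤ φ s₂ := by
      have h3 := mul_le_mul_of_nonneg_right h1 (Real.exp_pos (c * s₂)).le
      rw [mul_assoc, mul_assoc, ← Real.exp_add, ← Real.exp_add] at h3
      have e1 : -c * s₁ + c * s₂ = c * (s₂ - s₁) := by ring
      have e2 : -c * s₂ + c * s₂ = 0 := by ring
      rwa [e1, e2, Real.exp_zero, mul_one] at h3
    have h4 := Real.add_one_le_exp (c * (s₂ - s₁))
    have h5 : φ s₁ * (c * (s₂ - s₁)) = b + 1 := by
      rw [hs₂]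
      field_simp
      ring
    have h6 := mul_le_mul_of_nonneg_left h4 hpos.le
    have h7 := (le_abs_self _).trans (hb s₂ (hs₁.trans_le h12))
    nlinarith
  have hm := mono c fun s hs => by
    have h1 := hge s hs
    rw [abs_of_nonpos (hneg s hs)] at h1
    linarith
  have h1 : φ σ * Real.exp (c * σ) ≤ φ s * Real.exp (c * s) := hm hσ (hσ.trans_le hs) hs
  rw [abs_of_nonpos (hneg s (hσ.trans_le hs)), abs_of_nonpos (hneg σ hσ)]
  have h3 := mul_le_mul_of_nonneg_right h1 (Real.exp_pos (-c * s)).le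
  rw [mul_assoc, mul_assoc, ← Real.exp_add, ← Real.exp_add] at h3
  have e1 : c * σ + -c * s = -c * (s - σ) := by ring
  have e2 : c * s + -c * s = 0 := by ring
  rw [e1, e2, Real.exp_zero, mul_one] at h3
  linarith

theorem integral_add_two_mul_add_two_mul {P Q R : ℝ → ℝ} (hP : Continuous P) (hQ : Continuous Q)
    (hR : Continuous R) {l r : ℝ} : ∫ t in l..r, (P t + 2 * Q t + 2 * R t)
      = (∫ t in l..r, P t) + 2 * (∫ t in l..r, Q t) + 2 * ∫ t in l..r, R t := by
  rw [intervalIntegral.integral_add (Continuous.intervalIntegrable (by fun_prop) _ _)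
      (Continuous.intervalIntegrable (by fun_prop) _ _),
    intervalIntegral.integral_add (Continuous.intervalIntegrable (by fun_prop) _ _)
      (Continuous.intervalIntegrable (by fun_prop) _ _),
    intervalIntegral.integral_const_mul, intervalIntegral.integral_const_mul]

theorem integral_sub_two_mul_sub_two_mul {P Q R : ℝ → ℝ} (hP : Continuous P) (hQ : Continuous Q)
    (hR : Continuous R) {l r : ℝ} : ∫ t in l..r, (P t - 2 * Q t - 2 * R t)
      = (∫ t in l..r, P t) - 2 * (∫ t in l..r, Q t) - 2 * ∫ t in l..r, R t := by
  rw [intervalIntegral.integral_sub (Continuous.intervalIntegrable (by fun_prop) _ _)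
      (Continuous.intervalIntegrable (by fun_prop) _ _),
    intervalIntegral.integral_sub (Continuous.intervalIntegrable (by fun_prop) _ _)
      (Continuous.intervalIntegrable (by fun_prop) _ _),
    intervalIntegral.integral_const_mul, intervalIntegral.integral_const_mul]

/-- A half-cylinder in the coordinates `(a, w, x, y)` with `w = z - t`, which satisfies the
Cauchy-Riemann equations for the asymptotic operator with twist `κ`, up to an error of relative size
`μ`, and whose derivatives are bounded. -/
structure CylinderData (T K c₀ μ : ℝ) (B : ℕ → ℝ) (g₀ g₁ : ℝ → ℝ) (a w x y κ : ℝ × ℝ → ℝ) :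
    Prop where
  T_pos : 0 < T
  c₀_pos : 0 < c₀
  μ_nonneg : 0 ≤ μ
  small : μ * (2 * (1 + K) + 1 + 4 * T) * coerciveConst T K c₀ ≤ 1
  a_bdd : HalfBdd 1 B a
  w_bdd : HalfBdd 0 B w
  x_bdd : HalfBdd 1 B x
  y_bdd : HalfBdd 0 B y
  κ_bdd : HalfBdd 0 B κ
  a_per : CirclePeriodic T a
  w_per : CirclePeriodic T w
  x_per : CirclePeriodic T x
  y_per : CirclePeriodic T y
  abs_κ_le : ∀ q : ℝ × ℝ, 0 < q.1 → |κ q| ≤ K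
  abs_dS_κ_le : ∀ q : ℝ × ℝ, 0 < q.1 → |dS κ q| ≤ μ
  integral_κ : ∀ s : ℝ, 0 < s → c₀ ≤ |∫ t in (0 : ℝ)..T, κ (s, t)|
  cont_g₀ : Continuous g₀
  cont_g₁ : Continuous g₁
  lip_g₀ : ∀ x₁ x₂, |g₀ x₁ - g₀ x₂| ≤ μ * |x₁ - x₂|
  lip_g₁ : ∀ x₁ x₂, |g₁ x₁ - g₁ x₂| ≤ μ * |x₁ - x₂|
  eq_a : ∀ q : ℝ × ℝ, 0 < q.1 → |dS a q - g₀ (x q) - dT w q|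
    ≤ μ * (|dT a q| + |dT w q| + |dT x q| + |dT y q| + |y q|)
  eq_w : ∀ q : ℝ × ℝ, 0 < q.1 → |dS w q + dT a q|
    ≤ μ * (|dT a q| + |dT w q| + |dT x q| + |dT y q| + |y q|)
  eq_x : ∀ q : ℝ × ℝ, 0 < q.1 → |dS x q - g₁ (x q) - dT y q|
    ≤ μ * (|dT a q| + |dT w q| + |dT x q| + |dT y q| + |y q|)
  eq_y : ∀ q : ℝ × ℝ, 0 < q.1 → |dS y q + dT x q - κ q * y q|
    ≤ μ * (|dT a q| + |dT w q| + |dT x q| + |dT y q| + |y q|)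

/-- The density of the energy. -/
noncomputable def energyDensity (a w x y κ : ℝ × ℝ → ℝ) (q : ℝ × ℝ) : ℝ :=
  κ q * (y q * y q) - 2 * (dT x q * y q) - 2 * (dT a q * w q)

/-- A bound for the derivatives of the energy. -/
noncomputable def energyBound (T : ℝ) (B : ℕ → ℝ) (n : ℕ) : ℝ :=
  T * (mulBound B (mulBound B B) n + ‖(2 : ℝ) • ContinuousLinearMap.id ℝ ℝ‖
      * mulBound (fun n => B (n + 1)) B n
    + ‖(2 : ℝ) • ContinuousLinearMap.id ℝ ℝ‖ * mulBound (fun n => B (n + 1)) B n)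

namespace CylinderData

variable {T K c₀ μ : ℝ} {B : ℕ → ℝ} {g₀ g₁ : ℝ → ℝ} {a w x y κ : ℝ × ℝ → ℝ}

theorem circleData (h : CylinderData T K c₀ μ B g₀ g₁ a w x y κ) {s : ℝ} (hs : 0 < s) :
    CircleData T K c₀ (fun t => dT a (s, t)) (fun t => dT w (s, t)) (fun t => dT x (s, t))
      (fun t => dT y (s, t)) (fun t => x (s, t)) (fun t => y (s, t)) (fun t => w (s, t))
      (fun t => κ (s, t)) where
  T_pos := h.T_pos
  c₀_pos := h.c₀_pos
  cont_α := continuous_slice_smooth (contDiffOn_dT h.a_bdd.smooth) hs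
  cont_ζ := continuous_slice_smooth (contDiffOn_dT h.w_bdd.smooth) hs
  cont_χ := continuous_slice_smooth (contDiffOn_dT h.x_bdd.smooth) hs
  cont_η := continuous_slice_smooth (contDiffOn_dT h.y_bdd.smooth) hs
  cont_κ := continuous_slice_smooth h.κ_bdd.smooth hs
  deriv_x := hasDerivAt_dT h.x_bdd.smooth hs
  deriv_y := hasDerivAt_dT h.y_bdd.smooth hs
  deriv_w := hasDerivAt_dT h.w_bdd.smooth hs
  integral_α := integral_dT h.a_bdd.smooth h.a_per hs
  integral_ζ := integral_dT h.w_bdd.smooth h.w_per hs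
  integral_χ := integral_dT h.x_bdd.smooth h.x_per hs
  integral_η := integral_dT h.y_bdd.smooth h.y_per hs
  abs_κ_le := fun t => h.abs_κ_le (s, t) hs
  integral_κ := h.integral_κ s hs

theorem energyDensity_bdd (h : CylinderData T K c₀ μ B g₀ g₁ a w x y κ) :
    HalfBdd 0 (energyBound T B) (circleInt T (energyDensity a w x y κ)) := by
  have h1 := h.κ_bdd.mul (h.y_bdd.mul h.y_bdd)
  have h2 := (h.x_bdd.dT.mul h.y_bdd).clm ((2 : ℝ) • ContinuousLinearMap.id ℝ ℝ)
  have h3 := (h.a_bdd.dT.mul h.w_bdd).clm ((2 : ℝ) • ContinuousLinearMap.id ℝ ℝ)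
  exact ((h1.sub h2).sub h3).circleInt h.T_pos.le

theorem energyDensity_smooth (h : CylinderData T K c₀ μ B g₀ g₁ a w x y κ) :
    ContDiffOn ℝ ∞ (energyDensity a w x y κ) openHalf :=
  ((h.κ_bdd.smooth.mul (h.y_bdd.smooth.mul h.y_bdd.smooth)).sub (contDiffOn_const.mul
    ((contDiffOn_dT h.x_bdd.smooth).mul h.y_bdd.smooth))).sub (contDiffOn_const.mul
    ((contDiffOn_dT h.a_bdd.smooth).mul h.w_bdd.smooth))

theorem dS_energyDensity (h : CylinderData T K c₀ μ B g₀ g₁ a w x y κ) {s : ℝ} (hs : 0 < s)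
    (t : ℝ) : dS (energyDensity a w x y κ) (s, t) = (dS κ (s, t) * y (s, t) ^ 2
      + 2 * (κ (s, t) * y (s, t) * dS y (s, t)) - 2 * (dT x (s, t) * dS y (s, t))
      - 2 * (dT a (s, t) * dS w (s, t))) - 2 * (dT (dS x) (s, t) * y (s, t))
      - 2 * (dT (dS a) (s, t) * w (s, t)) := by
  have hy := hasDerivAt_dS h.y_bdd.smooth hs t
  have hw := hasDerivAt_dS h.w_bdd.smooth hs t
  have hκ := hasDerivAt_dS h.κ_bdd.smooth hs t
  have hx := hasDerivAt_dS (contDiffOn_dT h.x_bdd.smooth) hs t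
  have ha := hasDerivAt_dS (contDiffOn_dT h.a_bdd.smooth) hs t
  rw [dS_dT_comm h.x_bdd.smooth (show 0 < ((s, t) : ℝ × ℝ).1 from hs)] at hx
  rw [dS_dT_comm h.a_bdd.smooth (show 0 < ((s, t) : ℝ × ℝ).1 from hs)] at ha
  have h1 := ((hκ.mul (hy.mul hy)).sub ((hx.mul hy).const_mul 2)).sub ((ha.mul hw).const_mul 2)
  rw [(hasDerivAt_dS h.energyDensity_smooth hs t).unique h1]
  simp only [Pi.mul_apply]
  ring

/-- Integration by parts in t removes the mixed derivatives of x and a. It expresses the symmetry of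
the asymptotic operator and gives the form required by `CircleData.operatorSq_le_variation`. -/
theorem integral_dS_energyDensity (h : CylinderData T K c₀ μ B g₀ g₁ a w x y κ) {s : ℝ}
    (hs : 0 < s) : ∫ t in (0 : ℝ)..T, dS (energyDensity a w x y κ) (s, t)
      = ∫ t in (0 : ℝ)..T, (dS κ (s, t) * y (s, t) ^ 2 + 2 * (κ (s, t) * y (s, t) * dS y (s, t))
      + 2 * (dS x (s, t) * dT y (s, t)) - 2 * (dT x (s, t) * dS y (s, t))
      + 2 * (dS a (s, t) * dT w (s, t)) - 2 * (dT a (s, t) * dS w (s, t))) := by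
  have c : ∀ {F : ℝ × ℝ → ℝ}, ContDiffOn ℝ ∞ F openHalf → Continuous fun t => F (s, t) :=
    fun hF => continuous_slice_smooth hF hs
  have c1 := c h.y_bdd.smooth
  have c2 := c h.w_bdd.smooth
  have c3 := c h.κ_bdd.smooth
  have c4 := c (contDiffOn_dS h.κ_bdd.smooth)
  have c5 := c (contDiffOn_dS h.y_bdd.smooth)
  have c6 := c (contDiffOn_dS h.w_bdd.smooth)
  have c7 := c (contDiffOn_dS h.x_bdd.smooth)
  have c8 := c (contDiffOn_dS h.a_bdd.smooth)
  have c9 := c (contDiffOn_dT h.y_bdd.smooth)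
  have c10 := c (contDiffOn_dT h.w_bdd.smooth)
  have c11 := c (contDiffOn_dT h.x_bdd.smooth)
  have c12 := c (contDiffOn_dT h.a_bdd.smooth)
  have c13 := c (contDiffOn_dT (contDiffOn_dS h.x_bdd.smooth))
  have c14 := c (contDiffOn_dT (contDiffOn_dS h.a_bdd.smooth))
  have p1 := integral_dT_mul (contDiffOn_dS h.x_bdd.smooth) h.x_per.dS h.y_bdd.smooth h.y_per hs
  have p2 := integral_dT_mul (contDiffOn_dS h.a_bdd.smooth) h.a_per.dS h.w_bdd.smooth h.w_per hs
  simp only [h.dS_energyDensity hs]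
  have cP : Continuous fun t => dS κ (s, t) * y (s, t) ^ 2
      + 2 * (κ (s, t) * y (s, t) * dS y (s, t)) - 2 * (dT x (s, t) * dS y (s, t))
      - 2 * (dT a (s, t) * dS w (s, t)) :=
    (((c4.mul (c1.pow 2)).add (continuous_const.mul ((c3.mul c1).mul c5))).sub
      (continuous_const.mul (c11.mul c5))).sub (continuous_const.mul (c12.mul c6))
  have cQ : Continuous fun t => dT (dS x) (s, t) * y (s, t) := c13.mul c1
  have cR : Continuous fun t => dT (dS a) (s, t) * w (s, t) := c14.mul c2
  have cQ' : Continuous fun t => dS x (s, t) * dT y (s, t) := c7.mul c9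
  have cR' : Continuous fun t => dS a (s, t) * dT w (s, t) := c8.mul c10
  rw [integral_sub_two_mul_sub_two_mul cP cQ cR, p1, p2, mul_neg, mul_neg,
    sub_neg_eq_add, sub_neg_eq_add,
    ← integral_add_two_mul_add_two_mul cP cQ' cR']
  congr 1
  funext t
  ring

/-- The squared norm of the asymptotic operator on the circle at `s`. -/
noncomputable def opSq (T : ℝ) (a w x y κ : ℝ × ℝ → ℝ) (s : ℝ) : ℝ :=
  operatorSq T (fun t => dT a (s, t)) (fun t => dT w (s, t)) (fun t => dT x (s, t))
      (fun t => dT y (s, t)) (fun t => y (s, t)) (fun t => κ (s, t))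

theorem opSq_le_dS_energy (h : CylinderData T K c₀ μ B g₀ g₁ a w x y κ) {q : ℝ × ℝ}
    (hq : 0 < q.1) : opSq T a w x y κ q.1 ≤ dS (circleInt T (energyDensity a w x y κ)) q := by
  have c : ∀ {F : ℝ × ℝ → ℝ}, ContDiffOn ℝ ∞ F openHalf → Continuous fun t => F (q.1, t) :=
    fun hF => continuous_slice_smooth hF hq
  rw [dS_circleInt h.energyDensity_smooth hq, circleInt, h.integral_dS_energyDensity hq]
  exact (h.circleData hq).operatorSq_le_variation h.μ_nonneg h.small
    (c (contDiffOn_dS h.a_bdd.smooth)) (c (contDiffOn_dS h.w_bdd.smooth))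
    (c (contDiffOn_dS h.x_bdd.smooth)) (c (contDiffOn_dS h.y_bdd.smooth))
    (c (contDiffOn_dS h.κ_bdd.smooth)) h.cont_g₀ h.cont_g₁ h.lip_g₀ h.lip_g₁
    (fun t => h.abs_dS_κ_le (q.1, t) hq) (fun t => h.eq_a (q.1, t) hq)
    (fun t => h.eq_w (q.1, t) hq) (fun t => h.eq_x (q.1, t) hq) (fun t => h.eq_y (q.1, t) hq)

theorem abs_energy_le (h : CylinderData T K c₀ μ B g₀ g₁ a w x y κ) {q : ℝ × ℝ}
    (hq : 0 < q.1) : |circleInt T (energyDensity a w x y κ) q|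
      ≤ 2 * energyConst T K c₀ * opSq T a w x y κ q.1 := by
  have := (h.circleData hq).abs_energy_le
  simp only [pow_two] at this
  exact this

theorem K_nonneg (h : CylinderData T K c₀ μ B g₀ g₁ a w x y κ) : 0 ≤ K :=
  (abs_nonneg _).trans (h.abs_κ_le (1, 0) one_pos)

end CylinderData

theorem coerciveConst_pos {T K c₀ : ℝ} (hT : 0 < T) (hK : 0 ≤ K) (hc : 0 < c₀) :
    0 < coerciveConst T K c₀ := by
  unfold coerciveConst supConst
  positivity

theorem energyConst_pos {T K c₀ : ℝ} (hT : 0 < T) (hK : 0 ≤ K) (hc : 0 < c₀) :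
    0 < energyConst T K c₀ := by
  have := coerciveConst_pos hT hK hc
  unfold energyConst
  positivity

/-- The rate of exponential decay of the energy. -/
noncomputable def energyRate (T K c₀ : ℝ) : ℝ := 1 / (2 * energyConst T K c₀)

theorem energyRate_pos {T K c₀ : ℝ} (hT : 0 < T) (hK : 0 ≤ K) (hc : 0 < c₀) :
    0 < energyRate T K c₀ := by
  have := energyConst_pos hT hK hc
  unfold energyRate
  positivity

namespace CylinderData

variable {T K c₀ μ : ℝ} {B : ℕ → ℝ} {g₀ g₁ : ℝ → ℝ} {a w x y κ : ℝ × ℝ → ℝ}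

/-- Exponential decay of the energy. -/
theorem energy_decay (h : CylinderData T K c₀ μ B g₀ g₁ a w x y κ) {σ : ℝ} (hσ : 0 < σ)
    {q : ℝ × ℝ} (hq : σ ≤ q.1) : |circleInt T (energyDensity a w x y κ) q|
      ≤ |circleInt T (energyDensity a w x y κ) (σ, 0)|
        * Real.exp (-energyRate T K c₀ * (q.1 - σ)) := by
  have hE := energyConst_pos h.T_pos h.K_nonneg h.c₀_pos
  have hsm := h.energyDensity_bdd
  -- Boundedness of the energy needs only y, w, κ and the t-derivatives of a and x to be bounded,
  -- although a itself is not.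
  refine decay_of_deriv_ge (φ := fun s => circleInt T (energyDensity a w x y κ) (s, 0))
    (b := energyBound T B 0) (energyRate_pos h.T_pos h.K_nonneg h.c₀_pos)
    (fun s hs => hasDerivAt_dS hsm.smooth hs 0) (fun s hs => ?_) (fun s hs => ?_) hσ hq
  · have h1 := h.opSq_le_dS_energy (q := (s, 0)) hs
    have h2 := h.abs_energy_le (q := (s, 0)) hs
    refine le_trans ?_ h1
    unfold energyRate
    rw [one_div, inv_mul_le_iff₀ (by positivity)]
    exact h2
  · have := hsm.bound 0 le_rfl (s, 0) hs
    rwa [norm_iteratedFDeriv_zero] at this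

end CylinderData

end MorseBott

namespace MorseBott

/-! ## Norms on circles -/

theorem sq_integral_mul_le {T : ℝ} (hT : 0 ≤ T) {f g : ℝ → ℝ} (hf : Continuous f)
    (hg : Continuous g) : (∫ t in (0 : ℝ)..T, f t * g t) ^ 2
      ≤ (∫ t in (0 : ℝ)..T, f t ^ 2) * ∫ t in (0 : ℝ)..T, g t ^ 2 := by
  have h : ∀ l : ℝ, 0 ≤ (∫ t in (0 : ℝ)..T, g t ^ 2) * (l * l)
      + 2 * (∫ t in (0 : ℝ)..T, f t * g t) * l + ∫ t in (0 : ℝ)..T, f t ^ 2 := by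
    intro l
    have h1 : 0 ≤ ∫ t in (0 : ℝ)..T, (f t + l * g t) ^ 2 :=
      intervalIntegral.integral_nonneg hT fun t _ => sq_nonneg _
    have h2 : ∀ t, (f t + l * g t) ^ 2 = f t ^ 2 + 2 * l * (f t * g t) + l * l * g t ^ 2 :=
      fun t => by ring
    simp only [h2] at h1
    rw [intervalIntegral.integral_add (Continuous.intervalIntegrable (by fun_prop) _ _)
        (Continuous.intervalIntegrable (by fun_prop) _ _),
      intervalIntegral.integral_add (Continuous.intervalIntegrable (by fun_prop) _ _)
        (Continuous.intervalIntegrable (by fun_prop) _ _),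
      intervalIntegral.integral_const_mul, intervalIntegral.integral_const_mul] at h1
    linarith
  have := discrim_le_zero h
  unfold discrim at this
  nlinarith

/-- The norm of `F (s, ·)` in `L²(ℝ / T ℤ)`. -/
noncomputable def circleNorm (T : ℝ) (F : ℝ × ℝ → ℝ) (s : ℝ) : ℝ :=
  √(∫ t in (0 : ℝ)..T, F (s, t) ^ 2)

theorem circleNorm_nonneg (T : ℝ) (F : ℝ × ℝ → ℝ) (s : ℝ) : 0 ≤ circleNorm T F s :=
  Real.sqrt_nonneg _

theorem sq_circleNorm {T : ℝ} (hT : 0 ≤ T) (F : ℝ × ℝ → ℝ) (s : ℝ) :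
    circleNorm T F s ^ 2 = ∫ t in (0 : ℝ)..T, F (s, t) ^ 2 :=
  Real.sq_sqrt (intervalIntegral.integral_nonneg hT fun _ _ => sq_nonneg _)

theorem abs_integral_mul_le {T : ℝ} (hT : 0 ≤ T) {F G : ℝ × ℝ → ℝ} {s : ℝ}
    (hF : Continuous fun t => F (s, t)) (hG : Continuous fun t => G (s, t)) :
    |∫ t in (0 : ℝ)..T, F (s, t) * G (s, t)| ≤ circleNorm T F s * circleNorm T G s := by
  have h := sq_integral_mul_le hT hF hG
  rw [← sq_circleNorm hT F, ← sq_circleNorm hT G, ← mul_pow] at h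
  exact abs_le_of_sq_le_sq h (mul_nonneg (circleNorm_nonneg _ _ _) (circleNorm_nonneg _ _ _))

theorem circleNorm_le {T : ℝ} (hT : 0 ≤ T) {F : ℝ × ℝ → ℝ} {s b : ℝ}
    (hF : Continuous fun t => F (s, t)) (hb : ∀ t, |F (s, t)| ≤ b) :
    circleNorm T F s ≤ √T * |b| := by
  have h1 : ∫ t in (0 : ℝ)..T, F (s, t) ^ 2 ≤ ∫ _ in (0 : ℝ)..T, b ^ 2 :=
    intervalIntegral.integral_mono_on hT ((hF.pow 2).intervalIntegrable _ _)
      intervalIntegrable_const fun t _ => by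
        rw [← sq_abs]
        have := hb t
        gcongr
  rw [intervalIntegral.integral_const, sub_zero, smul_eq_mul] at h1
  refine (Real.sqrt_le_sqrt h1).trans (le_of_eq ?_)
  rw [Real.sqrt_mul hT, Real.sqrt_sq_eq_abs]

/-- Interpolation on circles for the `t`-derivative. -/
theorem circle_interpolation {T : ℝ} (hT : 0 ≤ T) {θ : ℝ} (h0 : 0 < θ) (h1 : θ < 1) (B : ℕ → ℝ) :
    ∃ C : ℝ, 0 < C ∧ ∀ F : ℝ × ℝ → ℝ, HalfBdd 0 B F → CirclePeriodic T F → ∀ s : ℝ, 0 < s →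
      circleNorm T (dT F) s ≤ C * circleNorm T F s ^ θ := by
  obtain ⟨C, hC, h⟩ := logConvex_interpolation (A := 1) zero_le_one 1 h0 h1 fun j => √T * |B j|
  refine ⟨C, hC, fun F hF hp s hs => ?_⟩
  have hit : ∀ j, HalfBdd 0 (fun n => B (n + j)) (dT^[j] F) ∧ CirclePeriodic T (dT^[j] F) := by
    intro j
    induction j with
    | zero => exact ⟨hF, hp⟩
    | succ j ih =>
      rw [Function.iterate_succ_apply']
      refine ⟨?_, ih.2.dT⟩
      have := (ih.1.mono (Nat.zero_le 1) fun n _ => le_rfl).dT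
      refine this.mono le_rfl fun n _ => le_of_eq ?_
      congr 1
      omega
  refine h (fun j => circleNorm T (dT^[j] F) s) (fun j => circleNorm_nonneg _ _ _) (fun j => ?_)
    (fun j => ?_)
  · refine circleNorm_le hT (continuous_slice_smooth (hit j).1.smooth hs) fun t => ?_
    have := (hit j).1.bound 0 le_rfl (s, t) hs
    rwa [norm_iteratedFDeriv_zero, zero_add] at this
  · simp only [one_mul]
    rw [sq_circleNorm hT, Function.iterate_succ_apply',
      show j + 2 = (j + 1) + 1 from rfl, Function.iterate_succ_apply',
      Function.iterate_succ_apply']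
    set G := dT^[j] F
    have hG := (hit j).1.smooth
    have hpG : CirclePeriodic T G := (hit j).2
    -- Without boundary terms, ‖∂_t G‖² = -∫ G ∂_t² G ≤ ‖G‖ ‖∂_t² G‖: the norms of successive
    -- t-derivatives are log-convex with constant 1.
    have e := integral_dT_mul hG hpG (contDiffOn_dT hG) hpG.dT hs
    simp only [pow_two]
    rw [e]
    exact (neg_le_abs _).trans (abs_integral_mul_le hT (continuous_slice_smooth hG hs)
      (continuous_slice_smooth (contDiffOn_dT (contDiffOn_dT hG)) hs))

/-! ## The non-kernel part -/

/-- The difference of `F` and its averages over circles. -/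
noncomputable def qPart (T : ℝ) (F : ℝ × ℝ → ℝ) (q : ℝ × ℝ) : ℝ := F q - mean T F q.1

/-- A bound for the derivatives of `qPart T F`. -/
def qBound (T : ℝ) (B : ℕ → ℝ) (n : ℕ) : ℝ := 2 * T * |B 1| + 2 * |B n|

theorem abs_sub_mean_le {T : ℝ} (hT : 0 < T) {g g' : ℝ → ℝ} (hg : ∀ t, HasDerivAt g (g' t) t)
    (hg' : Continuous g') {t : ℝ} (ht : t ∈ Set.Icc 0 T) :
    |g t - (∫ τ in (0 : ℝ)..T, g τ) / T| ≤ 2 * ∫ τ in (0 : ℝ)..T, |g' τ| := by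
  set V := ∫ τ in (0 : ℝ)..T, |g' τ|
  have hc : Continuous g := continuous_iff_continuousAt.2 fun t => (hg t).continuousAt
  have h1 := abs_sub_zero_le_integral hg hg' ht
  have h2 : |∫ τ in (0 : ℝ)..T, (g τ - g 0)| ≤ V * T := by
    have := intervalIntegral.norm_integral_le_of_norm_le_const (a := 0) (b := T)
      (f := fun τ => g τ - g 0) (C := V) fun τ hτ => by
        rw [Set.uIoc_of_le hT.le] at hτ
        exact abs_sub_zero_le_integral hg hg' (Set.Ioc_subset_Icc_self hτ)
    rwa [sub_zero, abs_of_pos hT] at this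
  rw [intervalIntegral.integral_sub (hc.intervalIntegrable _ _) intervalIntegrable_const,
    intervalIntegral.integral_const, sub_zero, smul_eq_mul] at h2
  have h3 : |(∫ τ in (0 : ℝ)..T, g τ) / T - g 0| ≤ V := by
    have e : (∫ τ in (0 : ℝ)..T, g τ) / T - g 0 = ((∫ τ in (0 : ℝ)..T, g τ) - T * g 0) / T := by
      field_simp
    rw [e, abs_div, abs_of_pos hT, div_le_iff₀ hT]
    exact h2
  have h4 := abs_sub_le (g t) (g 0) ((∫ τ in (0 : ℝ)..T, g τ) / T)
  rw [abs_sub_comm (g 0)] at h4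
  linarith

section
variable {T : ℝ} {F : ℝ × ℝ → ℝ} {B : ℕ → ℝ}

theorem CirclePeriodic.qPart (hp : CirclePeriodic T F) : CirclePeriodic T (qPart T F) :=
  fun s t hs => by
    unfold MorseBott.qPart
    rw [hp s t hs]

theorem qPart_eq (T : ℝ) (F : ℝ × ℝ → ℝ) :
    qPart T F = fun q => F q - (T⁻¹ • ContinuousLinearMap.id ℝ ℝ) (circleInt T F q) := by
  funext q
  simp only [qPart, mean, circleInt, smul_apply, ContinuousLinearMap.id_apply, smul_eq_mul]
  ring

theorem abs_qPart_le (hT : 0 < T) (hF : ContDiffOn ℝ ∞ F openHalf) (hp : CirclePeriodic T F)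
    {q : ℝ × ℝ} (hq : 0 < q.1) : |qPart T F q| ≤ 2 * ∫ t in (0 : ℝ)..T, |dT F (q.1, t)| :=
  circlePeriodic_of_mem (P := fun v => |v| ≤ _) hT hp.qPart hq (fun _ ht =>
    abs_sub_mean_le hT (hasDerivAt_dT hF hq) (continuous_slice_smooth (contDiffOn_dT hF) hq) ht) q.2

/-- Only derivatives of F are assumed bounded. The bound of order zero comes from the oscillation of
F over a circle, which the first derivative controls. -/
theorem HalfBdd.qPart (hF : HalfBdd 1 B F) (hT : 0 < T) (hp : CirclePeriodic T F) :
    HalfBdd 0 (qBound T B) (qPart T F) := by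
  have h1 := hF.sub ((hF.circleInt hT.le).clm (T⁻¹ • ContinuousLinearMap.id ℝ ℝ))
  rw [← qPart_eq] at h1
  refine ⟨h1.smooth, fun n _ q hq => ?_⟩
  rcases Nat.eq_zero_or_pos n with rfl | hn
  · rw [norm_iteratedFDeriv_zero]
    refine (abs_qPart_le hT hF.smooth hp hq).trans ?_
    have h2 := intervalIntegral.norm_integral_le_of_norm_le_const (a := 0) (b := T)
      (f := fun t => |MorseBott.dT F (q.1, t)|) (C := B 1) fun t _ => by
        have := hF.dT.bound 0 le_rfl (q.1, t) hq
        rw [norm_iteratedFDeriv_zero] at this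
        simpa using this
    rw [sub_zero, abs_of_pos hT] at h2
    have h3 := (le_abs_self _).trans h2
    have h4 := mul_le_mul_of_nonneg_right (le_abs_self (B 1)) hT.le
    have h5 := abs_nonneg (B 0)
    unfold qBound
    linarith
  · refine (h1.bound n hn q hq).trans ?_
    have h2 : ‖T⁻¹ • ContinuousLinearMap.id ℝ ℝ‖ * (T * B n) = B n := by
      rw [norm_smul, ContinuousLinearMap.norm_id, mul_one, norm_inv, Real.norm_eq_abs,
        abs_of_pos hT]
      field_simp
    simp only [h2]
    have h3 := le_abs_self (B n)
    have h4 : 0 ≤ 2 * T * |B 1| := by positivity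
    unfold qBound
    linarith

theorem dT_qPart (hF : ContDiffOn ℝ ∞ F openHalf) {q : ℝ × ℝ} (hq : 0 < q.1) :
    dT (qPart T F) q = dT F q := by
  have h1 : ContDiffOn ℝ ∞ (qPart T F) openHalf := by
    rw [qPart_eq]
    exact hF.sub ((T⁻¹ • ContinuousLinearMap.id ℝ ℝ).contDiff.comp_contDiffOn
      (contDiffOn_circleInt T hF))
  have h2 : HasDerivAt (fun t => qPart T F (q.1, t)) (dT F (q.1, q.2)) q.2 :=
    (hasDerivAt_dT hF hq q.2).sub_const (mean T F q.1)
  exact (hasDerivAt_dT h1 hq q.2).unique h2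

end

/-- The `L²`-norm of the non-kernel part on the circle at `s`. -/
noncomputable def qNorm (T : ℝ) (a w x y : ℝ × ℝ → ℝ) (s : ℝ) : ℝ :=
  √(∫ t in (0 : ℝ)..T, (qPart T a (s, t) ^ 2 + qPart T w (s, t) ^ 2 + qPart T x (s, t) ^ 2
    + y (s, t) ^ 2))

namespace CylinderData

variable {T K c₀ μ : ℝ} {B : ℕ → ℝ} {g₀ g₁ : ℝ → ℝ} {a w x y κ : ℝ × ℝ → ℝ}

theorem w_bdd_one (h : CylinderData T K c₀ μ B g₀ g₁ a w x y κ) : HalfBdd 1 B w :=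
  h.w_bdd.mono (Nat.zero_le 1) fun _ _ => le_rfl

theorem qa_bdd (h : CylinderData T K c₀ μ B g₀ g₁ a w x y κ) :
    HalfBdd 0 (qBound T B) (qPart T a) := h.a_bdd.qPart h.T_pos h.a_per

theorem qw_bdd (h : CylinderData T K c₀ μ B g₀ g₁ a w x y κ) :
    HalfBdd 0 (qBound T B) (qPart T w) := h.w_bdd_one.qPart h.T_pos h.w_per

theorem qx_bdd (h : CylinderData T K c₀ μ B g₀ g₁ a w x y κ) :
    HalfBdd 0 (qBound T B) (qPart T x) := h.x_bdd.qPart h.T_pos h.x_per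

theorem y_qbdd (h : CylinderData T K c₀ μ B g₀ g₁ a w x y κ) : HalfBdd 0 (qBound T B) y :=
  h.y_bdd.mono le_rfl fun n _ => by
    have h1 := le_abs_self (B n)
    have h2 := abs_nonneg (B n)
    have h3 : 0 ≤ 2 * T * |B 1| := by have := h.T_pos; positivity
    unfold qBound
    linarith

theorem circleNorm_le_qNorm (h : CylinderData T K c₀ μ B g₀ g₁ a w x y κ) {s : ℝ} (hs : 0 < s) :
    circleNorm T (qPart T a) s ≤ qNorm T a w x y s ∧ circleNorm T (qPart T w) s ≤ qNorm T a w x y s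
      ∧ circleNorm T (qPart T x) s ≤ qNorm T a w x y s ∧ circleNorm T y s ≤ qNorm T a w x y s := by
  have c1 := (continuous_slice_smooth h.qa_bdd.smooth hs).pow 2
  have c2 := (continuous_slice_smooth h.qw_bdd.smooth hs).pow 2
  have c3 := (continuous_slice_smooth h.qx_bdd.smooth hs).pow 2
  have c4 := (continuous_slice_smooth h.y_bdd.smooth hs).pow 2
  have i := (((c1.add c2).add c3).add c4).intervalIntegrable (μ := MeasureTheory.volume) 0 T
  refine ⟨Real.sqrt_le_sqrt ?_, Real.sqrt_le_sqrt ?_, Real.sqrt_le_sqrt ?_, Real.sqrt_le_sqrt ?_⟩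
  · refine intervalIntegral.integral_mono_on h.T_pos.le (c1.intervalIntegrable _ _) i fun t _ => ?_
    nlinarith [sq_nonneg (qPart T w (s, t)), sq_nonneg (qPart T x (s, t)), sq_nonneg (y (s, t))]
  · refine intervalIntegral.integral_mono_on h.T_pos.le (c2.intervalIntegrable _ _) i fun t _ => ?_
    nlinarith [sq_nonneg (qPart T a (s, t)), sq_nonneg (qPart T x (s, t)), sq_nonneg (y (s, t))]
  · refine intervalIntegral.integral_mono_on h.T_pos.le (c3.intervalIntegrable _ _) i fun t _ => ?_
    nlinarith [sq_nonneg (qPart T w (s, t)), sq_nonneg (qPart T a (s, t)), sq_nonneg (y (s, t))]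
  · refine intervalIntegral.integral_mono_on h.T_pos.le (c4.intervalIntegrable _ _) i fun t _ => ?_
    nlinarith [sq_nonneg (qPart T w (s, t)), sq_nonneg (qPart T x (s, t)),
      sq_nonneg (qPart T a (s, t))]

end CylinderData

/-- A bound for `qNorm`. -/
noncomputable def qNormBound (T : ℝ) (B : ℕ → ℝ) : ℝ := 2 * √T * |qBound T B 0|

theorem CylinderData.qNorm_le {T K c₀ μ : ℝ} {B : ℕ → ℝ} {g₀ g₁ : ℝ → ℝ} {a w x y κ : ℝ × ℝ → ℝ}
    (h : CylinderData T K c₀ μ B g₀ g₁ a w x y κ) {s : ℝ} (hs : 0 < s) :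
    qNorm T a w x y s ≤ qNormBound T B := by
  have hT := h.T_pos
  have c1 := (continuous_slice_smooth h.qa_bdd.smooth hs).pow 2
  have c2 := (continuous_slice_smooth h.qw_bdd.smooth hs).pow 2
  have c3 := (continuous_slice_smooth h.qx_bdd.smooth hs).pow 2
  have c4 := (continuous_slice_smooth h.y_bdd.smooth hs).pow 2
  have i := (((c1.add c2).add c3).add c4).intervalIntegrable (μ := MeasureTheory.volume) 0 T
  have bd : ∀ {F : ℝ × ℝ → ℝ}, HalfBdd 0 (qBound T B) F → ∀ t, F (s, t) ^ 2 ≤ qBound T B 0 ^ 2 := by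
    intro F hF t
    have := hF.bound 0 le_rfl (s, t) hs
    rw [norm_iteratedFDeriv_zero, Real.norm_eq_abs] at this
    rw [← sq_abs]
    gcongr
  have h1 : ∫ t in (0 : ℝ)..T, (qPart T a (s, t) ^ 2 + qPart T w (s, t) ^ 2
      + qPart T x (s, t) ^ 2 + y (s, t) ^ 2) ≤ ∫ _ in (0 : ℝ)..T, 4 * qBound T B 0 ^ 2 := by
    refine intervalIntegral.integral_mono_on hT.le i intervalIntegrable_const fun t _ => ?_
    linarith [bd h.qa_bdd t, bd h.qw_bdd t, bd h.qx_bdd t, bd h.y_qbdd t]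
  rw [intervalIntegral.integral_const, sub_zero, smul_eq_mul] at h1
  refine (Real.sqrt_le_sqrt h1).trans (le_of_eq ?_)
  rw [show T * (4 * qBound T B 0 ^ 2) = (2 * qBound T B 0) ^ 2 * T by ring,
    Real.sqrt_mul (sq_nonneg _), Real.sqrt_sq_eq_abs, abs_mul, abs_two]
  unfold qNormBound
  ring

/-- The energy on a circle is controlled by the `L²`-norm of the non-kernel part. -/
theorem exists_energy_le_qNorm {T : ℝ} (hT : 0 < T) {K : ℝ} (hK : 0 ≤ K) {θ : ℝ} (h0 : 0 < θ)
    (h1 : θ < 1) (B : ℕ → ℝ) :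
    ∃ C : ℝ, 0 < C ∧ ∀ {c₀ μ : ℝ} {g₀ g₁ : ℝ → ℝ} {a w x y κ : ℝ × ℝ → ℝ},
      CylinderData T K c₀ μ B g₀ g₁ a w x y κ → ∀ s : ℝ, 0 < s →
      |circleInt T (energyDensity a w x y κ) (s, 0)| ≤ C * qNorm T a w x y s ^ (1 + θ) := by
  obtain ⟨C, hC, hI⟩ := circle_interpolation hT.le h0 h1 (qBound T B)
  set b := qNormBound T B
  have hb : 0 ≤ b := by unfold b qNormBound; positivity
  refine ⟨K * b ^ (1 - θ) + 4 * C, by positivity, fun {c₀ μ g₀ g₁ a w x y κ} h s hs => ?_⟩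
  set m := qNorm T a w x y s with hm
  have hm0 : 0 ≤ m := Real.sqrt_nonneg _
  have hmb : m ≤ b := h.qNorm_le hs
  obtain ⟨n1, n2, n3, n4⟩ := h.circleNorm_le_qNorm hs
  have c1 := continuous_slice_smooth h.y_bdd.smooth hs
  have c2 := continuous_slice_smooth h.w_bdd.smooth hs
  have c3 := continuous_slice_smooth h.κ_bdd.smooth hs
  have c4 := continuous_slice_smooth (contDiffOn_dT h.x_bdd.smooth) hs
  have c5 := continuous_slice_smooth (contDiffOn_dT h.a_bdd.smooth) hs
  have c6 := continuous_slice_smooth h.qw_bdd.smooth hs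
  have cP : Continuous fun t => κ (s, t) * (y (s, t) * y (s, t)) := c3.mul (c1.mul c1)
  have cQ : Continuous fun t => dT x (s, t) * y (s, t) := c4.mul c1
  have cR : Continuous fun t => dT a (s, t) * w (s, t) := c5.mul c2
  have e1 : circleInt T (energyDensity a w x y κ) (s, 0)
      = (∫ t in (0 : ℝ)..T, κ (s, t) * (y (s, t) * y (s, t)))
        - 2 * (∫ t in (0 : ℝ)..T, dT x (s, t) * y (s, t))
        - 2 * ∫ t in (0 : ℝ)..T, dT a (s, t) * w (s, t) :=
    integral_sub_two_mul_sub_two_mul cP cQ cR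
  -- The average of w drops out because ∂_t a has mean zero, so the energy involves the non-kernel
  -- part only.
  have e2 : ∫ t in (0 : ℝ)..T, dT a (s, t) * w (s, t)
      = ∫ t in (0 : ℝ)..T, dT a (s, t) * qPart T w (s, t) := by
    have : ∀ t, dT a (s, t) * qPart T w (s, t)
        = dT a (s, t) * w (s, t) - dT a (s, t) * mean T w s := fun t => by
      simp only [qPart]
      ring
    have cM : Continuous fun t => dT a (s, t) * mean T w s := c5.mul continuous_const
    simp only [this]
    rw [intervalIntegral.integral_sub (cR.intervalIntegrable _ _) (cM.intervalIntegrable _ _),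
      intervalIntegral.integral_mul_const,
      integral_dT h.a_bdd.smooth h.a_per hs]
    ring
  have hθm : 0 ≤ m ^ θ := Real.rpow_nonneg hm0 θ
  have hmm : m ^ (1 + θ) = m * m ^ θ := by
    rw [Real.rpow_add_of_nonneg hm0 zero_le_one h0.le, Real.rpow_one]
  have d : ∀ F : ℝ × ℝ → ℝ, HalfBdd 1 B F → CirclePeriodic T F → circleNorm T (qPart T F) s ≤ m →
      circleNorm T (dT F) s ≤ C * m ^ θ := by
    intro F hF hp hn
    have h2 := hI (qPart T F) (hF.qPart hT hp) hp.qPart s hs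
    have h3 : circleNorm T (dT (qPart T F)) s = circleNorm T (dT F) s := by
      unfold circleNorm
      simp only [dT_qPart hF.smooth (show 0 < ((s, _) : ℝ × ℝ).1 from hs)]
    rw [h3] at h2
    refine h2.trans (mul_le_mul_of_nonneg_left ?_ hC.le)
    exact Real.rpow_le_rpow (circleNorm_nonneg _ _ _) hn h0.le
  have dx := d x h.x_bdd h.x_per n3
  have da := d a h.a_bdd h.a_per n1
  have f1 : |∫ t in (0 : ℝ)..T, κ (s, t) * (y (s, t) * y (s, t))| ≤ K * (m * m) := by
    refine (intervalIntegral.abs_integral_le_integral_abs hT.le).trans ?_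
    have h2 : ∫ t in (0 : ℝ)..T, |κ (s, t) * (y (s, t) * y (s, t))|
        ≤ ∫ t in (0 : ℝ)..T, K * y (s, t) ^ 2 := by
      refine intervalIntegral.integral_mono_on hT.le (cP.abs.intervalIntegrable _ _)
        ((continuous_const.mul (c1.pow 2)).intervalIntegrable _ _) fun t _ => ?_
      rw [abs_mul, ← pow_two, abs_of_nonneg (sq_nonneg (y (s, t)))]
      exact mul_le_mul_of_nonneg_right (h.abs_κ_le (s, t) hs) (sq_nonneg _)
    rw [intervalIntegral.integral_const_mul, ← sq_circleNorm hT.le y] at h2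
    refine h2.trans (mul_le_mul_of_nonneg_left ?_ hK)
    rw [pow_two]
    exact mul_le_mul n4 n4 (circleNorm_nonneg _ _ _) hm0
  have f2 : |∫ t in (0 : ℝ)..T, dT x (s, t) * y (s, t)| ≤ C * m ^ θ * m :=
    (abs_integral_mul_le hT.le c4 c1).trans
      (mul_le_mul dx n4 (circleNorm_nonneg _ _ _) (by positivity))
  have f3 : |∫ t in (0 : ℝ)..T, dT a (s, t) * w (s, t)| ≤ C * m ^ θ * m := by
    rw [e2]
    exact (abs_integral_mul_le hT.le c5 c6).trans
      (mul_le_mul da n2 (circleNorm_nonneg _ _ _) (by positivity))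
  -- Each product of an undifferentiated and a differentiated factor gives m · m^θ. The term in y²
  -- gives m², which is brought to the same power since m is bounded.
  have f4 : m ≤ b ^ (1 - θ) * m ^ θ := by
    have := rpow_le_mul_rpow hm0 hmb h0 h1.le
    rwa [Real.rpow_one] at this
  have f5 : K * (m * m) ≤ K * b ^ (1 - θ) * (m * m ^ θ) := by
    calc K * (m * m) ≤ K * (m * (b ^ (1 - θ) * m ^ θ)) := by gcongr
      _ = _ := by ring
  rw [e1, hmm]
  have g1 := abs_sub ((∫ t in (0 : ℝ)..T, κ (s, t) * (y (s, t) * y (s, t)))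
        - 2 * (∫ t in (0 : ℝ)..T, dT x (s, t) * y (s, t)))
        (2 * ∫ t in (0 : ℝ)..T, dT a (s, t) * w (s, t))
  have g2 := abs_sub (∫ t in (0 : ℝ)..T, κ (s, t) * (y (s, t) * y (s, t)))
        (2 * (∫ t in (0 : ℝ)..T, dT x (s, t) * y (s, t)))
  rw [abs_mul, abs_two] at g1 g2
  nlinarith

/-- Pointwise exponential decay of the asymptotic operator. -/
theorem exists_opSq_le {T : ℝ} {θ : ℝ} (h0 : 0 < θ) (h1 : θ < 1) (B : ℕ → ℝ) :
    ∃ C : ℝ, 0 < C ∧ ∀ {K c₀ μ : ℝ} {g₀ g₁ : ℝ → ℝ} {a w x y κ : ℝ × ℝ → ℝ},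
      CylinderData T K c₀ μ B g₀ g₁ a w x y κ → ∀ σ s : ℝ, 0 < σ → σ ≤ s →
      CylinderData.opSq T a w x y κ s ≤ C * (|circleInt T (energyDensity a w x y κ) (σ, 0)|
        * Real.exp (-energyRate T K c₀ * (s - σ))) ^ θ := by
  obtain ⟨C, hC, hI⟩ := halfPlane_interpolation (E := ℝ) 1 h0 h1 (energyBound T B)
  refine ⟨C, hC, fun {K c₀ μ g₀ g₁ a w x y κ} h σ s hσ hs => ?_⟩
  have hsm := h.energyDensity_bdd
  have hr := energyRate_pos h.T_pos h.K_nonneg h.c₀_pos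
  have hs0 := hσ.trans_le hs
  set e := |circleInt T (energyDensity a w x y κ) (σ, 0)|
  have he0 : 0 ≤ e := abs_nonneg _
  have he : e ≤ energyBound T B 0 := by
    have := hsm.bound 0 le_rfl (σ, 0) hσ
    rwa [norm_iteratedFDeriv_zero] at this
  have hexp : Real.exp (-energyRate T K c₀ * (s - σ)) ≤ 1 :=
    Real.exp_le_one_iff.2 (by nlinarith)
  -- On the half-plane to the right of s the energy is at most its decayed value at s, and
  -- interpolation bounds its first derivative there. That derivative dominates the squared
  -- operator, which gives a bound at every s and not just an integrated one.
  have key := hI _ hsm.smooth (fun j _ => hsm.bound j (Nat.zero_le j)) s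
    (e * Real.exp (-energyRate T K c₀ * (s - σ))) hs0
    ((mul_le_of_le_one_right he0 hexp).trans he) (fun q hq => ?_) (s, 0) le_rfl
  · have h2 := h.opSq_le_dS_energy (q := (s, 0)) hs0
    have h3 : dS (circleInt T (energyDensity a w x y κ)) (s, 0)
        ≤ ‖iteratedFDeriv ℝ 1 (circleInt T (energyDensity a w x y κ)) (s, 0)‖ := by
      rw [norm_iteratedFDeriv_one]
      have h4 := ContinuousLinearMap.le_opNorm
        (fderiv ℝ (circleInt T (energyDensity a w x y κ)) (s, 0)) (1, 0)
      rw [show ‖((1, 0) : ℝ × ℝ)‖ = 1 by simp [Prod.norm_def], mul_one] at h4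
      exact (le_abs_self _).trans h4
    exact h2.trans (h3.trans key)
  · refine (h.energy_decay hσ (hs.trans hq)).trans ?_
    exact mul_le_mul_of_nonneg_left (Real.exp_le_exp.2 (by nlinarith)) he0

/-- Constant in the supremum estimates by the asymptotic operator. -/
noncomputable def supOpConst (T K c₀ : ℝ) : ℝ := 4 * (T * coerciveConst T K c₀) + supConst T K c₀

theorem supOpConst_nonneg {T K c₀ : ℝ} (hT : 0 < T) (hK : 0 ≤ K) (hc : 0 < c₀) :
    0 ≤ supOpConst T K c₀ := by
  have := coerciveConst_pos hT hK hc
  unfold supOpConst supConst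
  positivity

namespace CylinderData

variable {T K c₀ μ : ℝ} {B : ℕ → ℝ} {g₀ g₁ : ℝ → ℝ} {a w x y κ : ℝ × ℝ → ℝ}

/-- For the parts with average removed, the oscillation is at most 2 ∫|∂_t F|, whose square
coercivity controls. For y no average is removed, and the Morse-Bott estimate `CircleData.sq_y_le`
is used. -/
theorem sq_le_opSq (h : CylinderData T K c₀ μ B g₀ g₁ a w x y κ) {q : ℝ × ℝ} (hq : 0 < q.1) :
    qPart T a q ^ 2 ≤ supOpConst T K c₀ * opSq T a w x y κ q.1 ∧
    qPart T w q ^ 2 ≤ supOpConst T K c₀ * opSq T a w x y κ q.1 ∧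
    qPart T x q ^ 2 ≤ supOpConst T K c₀ * opSq T a w x y κ q.1 ∧
    y q ^ 2 ≤ supOpConst T K c₀ * opSq T a w x y κ q.1 := by
  have hT := h.T_pos
  have hD := h.circleData hq
  have hN : 0 ≤ opSq T a w x y κ q.1 := hD.operatorSq_nonneg
  have hco := hD.integral_sumSq_le
  have hcc := coerciveConst_pos hT h.K_nonneg h.c₀_pos
  have hsc := hD.supConst_nonneg
  have gen : ∀ F : ℝ × ℝ → ℝ, ContDiffOn ℝ ∞ F openHalf → CirclePeriodic T F →
      (∀ t, |dT F (q.1, t)| ≤ |dT a (q.1, t)| + |dT w (q.1, t)| + |dT x (q.1, t)|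
        + |dT y (q.1, t)| + |y (q.1, t)|) →
      qPart T F q ^ 2 ≤ supOpConst T K c₀ * opSq T a w x y κ q.1 := by
    intro F hF hp hle
    have c1 := continuous_slice_smooth (contDiffOn_dT hF) hq
    have h1 := abs_qPart_le hT hF hp hq
    have h2 := sq_integral_abs_le hT c1
    have h3 := hD.integral_sq_le_sumSq c1 hle
    have h4 : qPart T F q ^ 2 ≤ (2 * ∫ t in (0 : ℝ)..T, |dT F (q.1, t)|) ^ 2 := by
      rw [← sq_abs]
      gcongr
    have h5 : qPart T F q ^ 2 ≤ 4 * (T * (coerciveConst T K c₀ * opSq T a w x y κ q.1)) := by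
      have := mul_le_mul_of_nonneg_left (h3.trans hco) hT.le
      rw [mul_pow] at h4
      unfold opSq
      linarith
    unfold supOpConst
    nlinarith [mul_nonneg hsc hN]
  refine ⟨gen a h.a_bdd.smooth h.a_per fun t => ?_, gen w h.w_bdd.smooth h.w_per fun t => ?_,
    gen x h.x_bdd.smooth h.x_per fun t => ?_, ?_⟩
  · linarith [abs_nonneg (dT w (q.1, t)), abs_nonneg (dT x (q.1, t)), abs_nonneg (dT y (q.1, t)),
      abs_nonneg (y (q.1, t))]
  · linarith [abs_nonneg (dT a (q.1, t)), abs_nonneg (dT x (q.1, t)), abs_nonneg (dT y (q.1, t)),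
      abs_nonneg (y (q.1, t))]
  · linarith [abs_nonneg (dT w (q.1, t)), abs_nonneg (dT a (q.1, t)), abs_nonneg (dT y (q.1, t)),
      abs_nonneg (y (q.1, t))]
  · refine circlePeriodic_of_mem (P := fun v => v ^ 2 ≤ _) hT h.y_per hq (fun t ht => ?_) q.2
    refine (hD.sq_y_le ht).trans (mul_le_mul_of_nonneg_right ?_ hN)
    unfold supOpConst
    have : 0 ≤ 4 * (T * coerciveConst T K c₀) := by positivity
    linarith

end CylinderData

/-- Pointwise exponential decay of the non-kernel part. -/
theorem exists_qPart_decay {T : ℝ} (hT : 0 < T) {K : ℝ} (hK : 0 ≤ K) {c₀ : ℝ} (hc : 0 < c₀)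
    {θ : ℝ} (h0 : 0 < θ) (h1 : θ < 1) (B : ℕ → ℝ) :
    ∃ C : ℝ, 0 < C ∧ ∀ {μ : ℝ} {g₀ g₁ : ℝ → ℝ} {a w x y κ : ℝ × ℝ → ℝ},
      CylinderData T K c₀ μ B g₀ g₁ a w x y κ →
      ∀ (σ : ℝ) (q : ℝ × ℝ), 0 < σ → σ ≤ q.1 → ∀ F ∈ [qPart T a, qPart T w, qPart T x, y],
      |F q| ≤ C * qNorm T a w x y σ ^ (θ * θ)
        * Real.exp (-(θ * energyRate T K c₀ / 2) * (q.1 - σ)) := by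
  obtain ⟨C₁, hC₁, H₁⟩ := exists_energy_le_qNorm hT hK h0 h1 B
  obtain ⟨C₂, hC₂, H₂⟩ := exists_opSq_le (T := T) h0 h1 B
  have hS := supOpConst_nonneg hT hK hc
  have hr := energyRate_pos hT hK hc
  set b := qNormBound T B
  have hb : 0 ≤ b := by unfold b qNormBound; positivity
  set D := b ^ (θ * (1 + θ) / 2 - θ * θ)
  have hD : 0 ≤ D := Real.rpow_nonneg hb _
  refine ⟨√(supOpConst T K c₀ * (C₂ * C₁ ^ θ)) * D + 1, by positivity, ?_⟩
  intro μ g₀ g₁ a w x y κ h σ q hσ hq F hF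
  set m := qNorm T a w x y σ
  have hm : 0 ≤ m := Real.sqrt_nonneg _
  set r := energyRate T K c₀
  have e1 := H₁ h σ hσ
  have e2 := H₂ h σ q.1 hσ hq
  -- The bound is written as a square in view of the square root to follow, which halves the rate
  -- and turns m^{(1+θ)θ} into m^{θ(1+θ)/2}.
  have e3 : CylinderData.opSq T a w x y κ q.1
      ≤ C₂ * C₁ ^ θ * (m ^ (θ * (1 + θ) / 2) * Real.exp (-(θ * r / 2) * (q.1 - σ))) ^ 2 := by
    refine e2.trans ?_
    have : (|circleInt T (energyDensity a w x y κ) (σ, 0)| * Real.exp (-r * (q.1 - σ))) ^ θ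
        ≤ (C₁ * m ^ (1 + θ) * Real.exp (-r * (q.1 - σ))) ^ θ := by
      gcongr
    refine (mul_le_mul_of_nonneg_left this hC₂.le).trans (le_of_eq ?_)
    rw [Real.mul_rpow (by positivity) (Real.exp_pos _).le, Real.mul_rpow hC₁.le (by positivity),
      ← Real.rpow_mul hm, ← Real.exp_mul, mul_pow, ← Real.exp_nat_mul, ← Real.rpow_mul_natCast hm]
    have x1 : (1 + θ) * θ = θ * (1 + θ) / 2 * (2 : ℕ) := by push_cast; ring
    have x2 : -r * (q.1 - σ) * θ = (2 : ℕ) * (-(θ * r / 2) * (q.1 - σ)) := by push_cast; ring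
    rw [x1, x2]
    ring
  have hsq : F q ^ 2 ≤ supOpConst T K c₀ * CylinderData.opSq T a w x y κ q.1 := by
    obtain ⟨k1, k2, k3, k4⟩ := h.sq_le_opSq (q := q) (hσ.trans_le hq)
    simp only [List.mem_cons, List.not_mem_nil, or_false] at hF
    rcases hF with rfl | rfl | rfl | rfl
    exacts [k1, k2, k3, k4]
  set Z := m ^ (θ * (1 + θ) / 2) * Real.exp (-(θ * r / 2) * (q.1 - σ)) with hZ
  have hZ0 : 0 ≤ Z := by positivity
  have h4 : |F q| ≤ √(supOpConst T K c₀ * (C₂ * C₁ ^ θ)) * Z := by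
    rw [← Real.sqrt_sq_eq_abs, ← Real.sqrt_sq hZ0, ← Real.sqrt_mul (by positivity)]
    refine Real.sqrt_le_sqrt (hsq.trans ?_)
    rw [mul_assoc]
    exact mul_le_mul_of_nonneg_left e3 hS
  -- As (1 + θ)/2 ≥ θ and m is bounded, the exponent may be lowered to θ².
  have h5 : m ^ (θ * (1 + θ) / 2) ≤ D * m ^ (θ * θ) :=
    rpow_le_mul_rpow hm (h.qNorm_le hσ) (by positivity) (by nlinarith)
  refine h4.trans ?_
  have h6 : 0 ≤ m ^ (θ * θ) := Real.rpow_nonneg hm _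
  have h7 := (Real.exp_pos (-(θ * r / 2) * (q.1 - σ))).le
  calc √(supOpConst T K c₀ * (C₂ * C₁ ^ θ)) * Z
      ≤ √(supOpConst T K c₀ * (C₂ * C₁ ^ θ))
        * ((D * m ^ (θ * θ)) * Real.exp (-(θ * r / 2) * (q.1 - σ))) := by
        rw [hZ]
        gcongr
    _ = (√(supOpConst T K c₀ * (C₂ * C₁ ^ θ)) * D) * m ^ (θ * θ)
        * Real.exp (-(θ * r / 2) * (q.1 - σ)) := by ring
    _ ≤ _ := by
        gcongr
        linarith

end MorseBott

namespace MorseBott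

/-! ## Scalar differential equations -/

/-- Bounded Lipschitz vector fields on the line are complete. -/
theorem exists_global_solution {g : ℝ → ℝ} {μ : NNReal} (hg : LipschitzWith μ g) {L : NNReal}
    (hL : ∀ x, ‖g x‖ ≤ L) (τ b : ℝ) :
    ∃ ξ : ℝ → ℝ, ξ τ = b ∧ ∀ s, HasDerivAt ξ (g (ξ s)) s := by
  have loc : ∀ n : ℕ, ∃ γ : ℝ → ℝ, γ τ = b ∧
      ∀ s ∈ Set.Ioo (τ - (n + 1)) (τ + (n + 1)), HasDerivAt γ (g (γ s)) s := by
    intro n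
    have hn : (0 : ℝ) ≤ n + 1 := by positivity
    -- Over a time n + 1 a solution moves by at most L (n + 1), the radius of the ball, so the
    -- existence time is not restricted.
    have hp : IsPicardLindelof (fun _ => g) (tmin := τ - (n + 1)) (tmax := τ + (n + 1))
        ⟨τ, by constructor <;> linarith⟩ b (L * (n + 1)) 0 L μ := by
      refine .of_time_independent (fun x _ => hL x) hg.lipschitzOnWith ?_
      simp
    obtain ⟨γ, h1, h2⟩ := hp.exists_eq_forall_mem_Icc_hasDerivWithinAt₀
    exact ⟨γ, h1, fun s hs =>
      (h2 s (Set.Ioo_subset_Icc_self hs)).hasDerivAt (Icc_mem_nhds hs.1 hs.2)⟩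
  choose γ h1 h2 using loc
  have hτ : ∀ n : ℕ, τ ∈ Set.Ioo (τ - ((n : ℝ) + 1)) (τ + (n + 1)) := fun n => by
    have : (0 : ℝ) < n + 1 := by positivity
    constructor <;> linarith
  have agree : ∀ {m n : ℕ}, m ≤ n →
      Set.EqOn (γ n) (γ m) (Set.Ioo (τ - ((m : ℝ) + 1)) (τ + (m + 1))) := by
    intro m n hmn
    have hmn' : (m : ℝ) ≤ n := by exact_mod_cast hmn
    refine ODE_solution_unique_of_mem_Ioo (v := fun _ => g) (s := fun _ => Set.univ) (K := μ)
      (fun t _ => hg.lipschitzOnWith) (hτ m) (fun t ht => ⟨h2 n t ⟨?_, ?_⟩, trivial⟩)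
      (fun t ht => ⟨h2 m t ht, trivial⟩) (by rw [h1, h1])
    · linarith [ht.1]
    · linarith [ht.2]
  set N : ℝ → ℕ := fun s => ⌈|s - τ|⌉₊
  have hN : ∀ s, s ∈ Set.Ioo (τ - ((N s : ℝ) + 1)) (τ + (N s + 1)) := fun s => by
    have := abs_le.1 (Nat.le_ceil |s - τ|)
    constructor <;> linarith [this.1, this.2]
  refine ⟨fun s => γ (N s) s, h1 _, fun s => ?_⟩
  refine (h2 (N s) s (hN s)).congr_of_eventuallyEq ?_
  filter_upwards [isOpen_Ioo.mem_nhds (hN s)] with t ht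
  rcases le_total (N t) (N s) with h | h
  · exact (agree h (hN t)).symm
  · exact agree h ht

/-- Trajectories of a Lipschitz vector field depend continuously on their initial values. -/
theorem abs_sub_le_of_trajectories {g ξ ζ : ℝ → ℝ} {μ : ℝ}
    (hg : ∀ x y, |g x - g y| ≤ μ * |x - y|) (hξ : ∀ s, HasDerivAt ξ (g (ξ s)) s)
    (hζ : ∀ s, HasDerivAt ζ (g (ζ s)) s) (s τ : ℝ) :
    (ξ s - ζ s) ^ 2 ≤ Real.exp (2 * μ * |s - τ|) * (ξ τ - ζ τ) ^ 2 := by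
  have hD : ∀ s, HasDerivAt (fun s => (ξ s - ζ s) ^ 2)
      (2 * (ξ s - ζ s) * (g (ξ s) - g (ζ s))) s := fun s =>
    (((hξ s).sub (hζ s)).pow 2).congr_deriv (by simp)
  have hb : ∀ s, |(ξ s - ζ s) * (g (ξ s) - g (ζ s))| ≤ μ * (ξ s - ζ s) ^ 2 := fun s => by
    rw [abs_mul, ← sq_abs (ξ s - ζ s)]
    nlinarith [hg (ξ s) (ζ s), abs_nonneg (ξ s - ζ s)]
  have hE : ∀ c s : ℝ, HasDerivAt (fun s => Real.exp (c * s)) (c * Real.exp (c * s)) s :=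
    fun c s => by simpa [mul_comm] using ((hasDerivAt_id s).const_mul c).exp
  have key : ∀ c s : ℝ, HasDerivAt (fun s => (ξ s - ζ s) ^ 2 * Real.exp (c * s))
      ((2 * ((ξ s - ζ s) * (g (ξ s) - g (ζ s))) + c * (ξ s - ζ s) ^ 2) * Real.exp (c * s)) s :=
    fun c s => ((hD s).mul (hE c s)).congr_deriv (by ring)
  have diff : ∀ c, Differentiable ℝ fun s => (ξ s - ζ s) ^ 2 * Real.exp (c * s) :=
    fun c s => (key c s).differentiableAt
  rcases le_total s τ with h | h
  · have mono := monotone_of_deriv_nonneg (diff (2 * μ)) fun s => by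
      rw [(key _ s).deriv]
      exact mul_nonneg (by linarith [(abs_le.1 (hb s)).1]) (Real.exp_pos _).le
    have := mono h
    simp only at this
    rw [abs_of_nonpos (by linarith), show 2 * μ * -(s - τ) = 2 * μ * τ - 2 * μ * s by ring,
      Real.exp_sub, div_mul_eq_mul_div, le_div_iff₀ (Real.exp_pos _)]
    linarith
  · have anti := antitone_of_deriv_nonpos (diff (-(2 * μ))) fun s => by
      rw [(key _ s).deriv]
      exact mul_nonpos_of_nonpos_of_nonneg (by linarith [(abs_le.1 (hb s)).2]) (Real.exp_pos _).le
    have := anti h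
    simp only at this
    rw [abs_of_nonneg (by linarith), show 2 * μ * (s - τ) = -(2 * μ) * τ - -(2 * μ) * s by ring,
      Real.exp_sub, div_mul_eq_mul_div, le_div_iff₀ (Real.exp_pos _)]
    linarith

/-- Backward comparison of an approximate trajectory with an exact one. -/
theorem abs_sub_le_of_approx {g φ φ' ξ : ℝ → ℝ} {μ r K S : ℝ} (hr : 0 < r)
    (hμ : μ ≤ r / 2) (hg : ∀ x y, |g x - g y| ≤ μ * |x - y|)
    (hφ : ∀ s, 0 < s → HasDerivAt φ (φ' s) s)
    (hK : ∀ s, 0 < s → |φ' s - g (φ s)| ≤ K * Real.exp (-r * s))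
    (hξ : ∀ s, HasDerivAt ξ (g (ξ s)) s) (hS : φ S = ξ S) {s : ℝ} (hs : 0 < s) (hsS : s ≤ S) :
    |φ s - ξ s| ≤ 2 * K / r * Real.exp (-r * s) := by
  have hK0 : 0 ≤ K := by
    have := (abs_nonneg _).trans (hK s hs)
    exact nonneg_of_mul_nonneg_left this (Real.exp_pos _)
  have hE : ∀ c s : ℝ, HasDerivAt (fun s => Real.exp (c * s)) (c * Real.exp (c * s)) s :=
    fun c s => by simpa [mul_comm] using ((hasDerivAt_id s).const_mul c).exp
  -- The function (φ - ξ)² e^{3rs/2} - (4K²/r²) e^{-rs/2} is nondecreasing: the Lipschitz term costs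
  -- at most r (φ - ξ)², and Young's inequality for the error costs another (r/2)(φ - ξ)² together
  -- with the subtracted exponential. At S it is nonpositive, hence also at s.
  have key : ∀ s, 0 < s → HasDerivAt (fun s => (φ s - ξ s) ^ 2 * Real.exp (3 * r / 2 * s)
      - 4 * K ^ 2 / r ^ 2 * Real.exp (-(r / 2) * s))
      ((2 * ((φ s - ξ s) * (φ' s - g (ξ s))) + 3 * r / 2 * (φ s - ξ s) ^ 2)
        * Real.exp (3 * r / 2 * s) + 2 * K ^ 2 / r * Real.exp (-(r / 2) * s)) s := fun s hs => by
    have hD : HasDerivAt (fun s => (φ s - ξ s) ^ 2) (2 * (φ s - ξ s) * (φ' s - g (ξ s))) s :=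
      (((hφ s hs).sub (hξ s)).pow 2).congr_deriv (by simp)
    refine ((hD.mul (hE _ s)).sub ((hE _ s).const_mul (4 * K ^ 2 / r ^ 2))).congr_deriv ?_
    field_simp
    ring
  have mono : MonotoneOn (fun s => (φ s - ξ s) ^ 2 * Real.exp (3 * r / 2 * s)
      - 4 * K ^ 2 / r ^ 2 * Real.exp (-(r / 2) * s)) (Set.Ioi 0) := by
    refine monotoneOn_of_deriv_nonneg (convex_Ioi 0)
      (fun s hs => (key s hs).continuousAt.continuousWithinAt) (fun s hs => ?_) fun s hs => ?_
    · rw [interior_Ioi] at hs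
      exact (key s hs).differentiableAt.differentiableWithinAt
    · rw [interior_Ioi] at hs
      rw [(key s hs).deriv]
      set D := φ s - ξ s
      have e1 : Real.exp (-(r / 2) * s) = Real.exp (-r * s) ^ 2 * Real.exp (3 * r / 2 * s) := by
        rw [← Real.exp_nat_mul, ← Real.exp_add]
        congr 1
        push_cast
        ring
      have e2 : |φ' s - g (ξ s)| ≤ K * Real.exp (-r * s) + μ * |D| := by
        have := abs_add_le (φ' s - g (φ s)) (g (φ s) - g (ξ s))
        rw [sub_add_sub_cancel] at this
        linarith [hK s hs, hg (φ s) (ξ s)]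
      set E := K * Real.exp (-r * s) with hEdef
      have e3 : |D * (φ' s - g (ξ s))| ≤ |D| * (E + μ * |D|) := by
        rw [abs_mul]
        exact mul_le_mul_of_nonneg_left e2 (abs_nonneg _)
      have e4 : 0 ≤ 2 * (D * (φ' s - g (ξ s))) + 3 * r / 2 * D ^ 2 + 2 * E ^ 2 / r := by
        have h1 := (abs_le.1 e3).1
        have h2 : 2 * E * |D| ≤ r / 2 * D ^ 2 + 2 * E ^ 2 / r := by
          have h3 : 0 ≤ (r * |D| - 2 * E) ^ 2 / (2 * r) := by positivity
          have h4 : (r * |D| - 2 * E) ^ 2 / (2 * r)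
              = r / 2 * |D| ^ 2 + 2 * E ^ 2 / r - 2 * E * |D| := by
            field_simp
            ring
          rw [sq_abs] at h4
          linarith
        have h5 : μ * (|D| * |D|) ≤ r / 2 * (|D| * |D|) :=
          mul_le_mul_of_nonneg_right hμ (by positivity)
        have h6 : |D| * |D| = D ^ 2 := by rw [← pow_two, sq_abs]
        rw [h6] at h5
        nlinarith
      have e5 : (2 * (D * (φ' s - g (ξ s))) + 3 * r / 2 * D ^ 2) * Real.exp (3 * r / 2 * s)
          + 2 * K ^ 2 / r * Real.exp (-(r / 2) * s)
          = (2 * (D * (φ' s - g (ξ s))) + 3 * r / 2 * D ^ 2 + 2 * E ^ 2 / r)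
            * Real.exp (3 * r / 2 * s) := by
        rw [e1, hEdef]
        ring
      rw [e5]
      exact mul_nonneg e4 (Real.exp_pos _).le
  have h1 := mono hs (hs.trans_le hsS) hsS
  simp only [hS, sub_self] at h1
  have h2 : 0 ≤ 4 * K ^ 2 / r ^ 2 * Real.exp (-(r / 2) * S) := by positivity
  have h3 : (φ s - ξ s) ^ 2 * Real.exp (3 * r / 2 * s)
      ≤ 4 * K ^ 2 / r ^ 2 * Real.exp (-(r / 2) * s) := by
    have : (0 : ℝ) ^ 2 * Real.exp (3 * r / 2 * S) = 0 := by ring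
    linarith
  have h4 : 4 * K ^ 2 / r ^ 2 * Real.exp (-(r / 2) * s)
      = (2 * K / r * Real.exp (-r * s)) ^ 2 * Real.exp (3 * r / 2 * s) := by
    rw [mul_pow, ← Real.exp_nat_mul, mul_assoc, ← Real.exp_add]
    have : ((2 : ℕ) : ℝ) * (-r * s) + 3 * r / 2 * s = -(r / 2) * s := by push_cast; ring
    rw [this]
    ring
  rw [h4] at h3
  exact abs_le_of_sq_le_sq (le_of_mul_le_mul_right h3 (Real.exp_pos _)) (by positivity)

/-- An exponentially accurate approximate trajectory is exponentially asymptotic to a trajectory. -/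
theorem exists_asymptotic_trajectory {g φ φ' : ℝ → ℝ} {μ r K : ℝ} (hr : 0 < r) (hμ0 : 0 ≤ μ)
    (hμ : μ ≤ r / 2) (hg : ∀ x y, |g x - g y| ≤ μ * |x - y|) {L : ℝ} (hL : ∀ x, |g x| ≤ L)
    (hφ : ∀ s, 0 < s → HasDerivAt φ (φ' s) s)
    (hK : ∀ s, 0 < s → |φ' s - g (φ s)| ≤ K * Real.exp (-r * s)) :
    ∃ ξ : ℝ → ℝ, (∀ s, HasDerivAt ξ (g (ξ s)) s) ∧
      ∀ s, 0 < s → |φ s - ξ s| ≤ 2 * K / r * Real.exp (-r * s) := by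
  have hlip : LipschitzWith μ.toNNReal g := LipschitzWith.of_dist_le_mul fun x y => by
    rw [Real.dist_eq, Real.dist_eq, Real.coe_toNNReal μ hμ0]
    exact hg x y
  have hL' : ∀ x, ‖g x‖ ≤ L.toNNReal := fun x => (hL x).trans (Real.le_coe_toNNReal L)
  have sol := fun τ b => exists_global_solution hlip hL' τ b
  -- The exact trajectories through φ n at time n stay near φ on (0, n] with a bound independent of
  -- n. Their values at time 1 subconverge to some b, and continuous dependence carries the bound to
  -- the trajectory through b at time 1.
  choose ζ hζ0 hζ using fun n : ℕ => sol (n : ℝ) (φ n)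
  have app : ∀ (n : ℕ) (s : ℝ), 0 < s → s ≤ n → |φ s - ζ n s| ≤ 2 * K / r * Real.exp (-r * s) :=
    fun n s hs hn => abs_sub_le_of_approx hr hμ hg hφ hK (hζ n) (hζ0 n).symm hs hn
  have hmem : ∀ n : ℕ, ζ (n + 1) 1 ∈ Metric.closedBall (φ 1) (2 * K / r * Real.exp (-r * 1)) := by
    intro n
    rw [Metric.mem_closedBall, dist_comm, Real.dist_eq]
    exact app (n + 1) 1 one_pos (by push_cast; linarith [n.cast_nonneg (α := ℝ)])
  obtain ⟨b, -, ψ, hψ, hb⟩ := tendsto_subseq_of_bounded Metric.isBounded_closedBall hmem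
  obtain ⟨ξ, hξ1, hξ⟩ := sol 1 b
  refine ⟨ξ, hξ, fun s hs => ?_⟩
  have lim : Tendsto (fun n => ζ (ψ n + 1) s) atTop (𝓝 (ξ s)) := by
    have h1 : Tendsto (fun n => Real.exp (2 * μ * |s - 1|) * (ζ (ψ n + 1) 1 - ξ 1) ^ 2) atTop
        (𝓝 (Real.exp (2 * μ * |s - 1|) * (b - ξ 1) ^ 2)) :=
      ((hb.sub_const (ξ 1)).pow 2).const_mul _
    rw [hξ1, sub_self, zero_pow two_ne_zero, mul_zero] at h1
    have h2 : Tendsto (fun n => (ζ (ψ n + 1) s - ξ s) ^ 2) atTop (𝓝 0) :=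
      squeeze_zero (fun _ => sq_nonneg _)
        (fun n => by
          have := abs_sub_le_of_trajectories hg (hζ (ψ n + 1)) hξ s 1
          rwa [hξ1] at this) h1
    have h3 := h2.sqrt
    rw [Real.sqrt_zero] at h3
    simp only [Real.sqrt_sq_eq_abs] at h3
    exact tendsto_sub_nhds_zero_iff.1 ((tendsto_zero_iff_abs_tendsto_zero _).2 h3)
  have ev : ∀ᶠ n in atTop, |φ s - ζ (ψ n + 1) s| ≤ 2 * K / r * Real.exp (-r * s) := by
    filter_upwards [eventually_ge_atTop ⌈s⌉₊] with n hn
    refine app _ s hs ((Nat.le_ceil s).trans ?_)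
    have : n ≤ ψ n := hψ.id_le n
    exact_mod_cast (hn.trans this).trans (Nat.le_succ _)
  exact le_of_tendsto (lim.const_sub (φ s)).abs ev

/-! ## Derivatives of trajectories -/

theorem contDiff_of_hasDerivAt_comp {G ξ J : ℝ → ℝ} (hG : ContDiff ℝ ∞ G) (hξ : ContDiff ℝ ∞ ξ)
    (hJ : ∀ s, HasDerivAt J (G (ξ s)) s) : ContDiff ℝ ∞ J := by
  rw [contDiff_infty_iff_deriv]
  refine ⟨fun s => (hJ s).differentiableAt, ?_⟩
  rw [show deriv J = G ∘ ξ from funext fun s => (hJ s).deriv]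
  exact hG.comp hξ

theorem contDiff_of_trajectory {g ξ : ℝ → ℝ} (hg : ContDiff ℝ ∞ g)
    (hξ : ∀ s, HasDerivAt ξ (g (ξ s)) s) : ContDiff ℝ ∞ ξ := by
  have hd : deriv ξ = g ∘ ξ := funext fun s => (hξ s).deriv
  rw [contDiff_infty]
  intro n
  induction n with
  | zero => exact contDiff_zero.2 (continuous_iff_continuousAt.2 fun s => (hξ s).continuousAt)
  | succ n ih =>
    rw [Nat.cast_succ, contDiff_succ_iff_deriv, hd]
    exact ⟨fun s => (hξ s).differentiableAt, by simp,
      (hg.of_le (mod_cast le_top)).comp ih⟩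

theorem norm_iteratedFDeriv_comp_le_compBound {G ξ : ℝ → ℝ} (hG : ContDiff ℝ ∞ G)
    (hξ : ContDiff ℝ ∞ ξ) {A b : ℕ → ℝ} {n : ℕ} {s : ℝ}
    (hA : ∀ i, ‖iteratedFDeriv ℝ i G (ξ s)‖ ≤ A i)
    (hb : ∀ i, 1 ≤ i → i ≤ n → ‖iteratedFDeriv ℝ i ξ s‖ ≤ b i) :
    ‖iteratedFDeriv ℝ n (fun s => G (ξ s)) s‖ ≤ compBound A b n := by
  refine norm_iteratedFDeriv_comp_le (C := ∑ i ∈ Finset.range (n + 1), |A i|)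
    (D := 1 + ∑ i ∈ Finset.range (n + 1), |b i|) hG hξ (natCast_le_infty n) s
    (fun i hi => ?_) (fun i hi hin => ?_)
  · refine (hA i).trans ((le_abs_self _).trans ?_)
    exact Finset.single_le_sum (f := fun i => |A i|) (fun _ _ => abs_nonneg _)
      (Finset.mem_range.2 (by omega))
  · have h1 : ‖iteratedFDeriv ℝ i ξ s‖ ≤ ∑ i ∈ Finset.range (n + 1), |b i| :=
      (hb i hi hin).trans ((le_abs_self _).trans
        (Finset.single_le_sum (f := fun i => |b i|) (fun _ _ => abs_nonneg _)
          (Finset.mem_range.2 (by omega))))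
    have h2 : 0 ≤ ∑ i ∈ Finset.range (n + 1), |b i| := Finset.sum_nonneg fun _ _ => abs_nonneg _
    exact (h1.trans (by linarith)).trans (le_self_pow₀ (by linarith) (by omega))

/-- If `J' = G ∘ ξ`, the derivatives of `J` are bounded in terms of those of `G` and `ξ`. -/
theorem norm_iteratedFDeriv_primitive_le {G ξ J : ℝ → ℝ} (hG : ContDiff ℝ ∞ G)
    (hξ : ContDiff ℝ ∞ ξ) (hJ : ∀ s, HasDerivAt J (G (ξ s)) s) {A b : ℕ → ℝ} {n : ℕ} {s : ℝ}
    (hA : ∀ i, ‖iteratedFDeriv ℝ i G (ξ s)‖ ≤ A i)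
    (hb : ∀ i, 1 ≤ i → i ≤ n → ‖iteratedFDeriv ℝ i ξ s‖ ≤ b i) :
    ‖iteratedFDeriv ℝ (n + 1) J s‖ ≤ compBound A b n := by
  rw [norm_iteratedFDeriv_eq_norm_iteratedDeriv, iteratedDeriv_succ',
    show deriv J = fun s => G (ξ s) from funext fun s => (hJ s).deriv,
    ← norm_iteratedFDeriv_eq_norm_iteratedDeriv]
  exact norm_iteratedFDeriv_comp_le_compBound hG hξ hA hb

/-- Bounds for the derivatives of trajectories. -/
theorem exists_bound_trajectory (A : ℕ → ℝ) : ∃ b : ℕ → ℝ, ∀ {g ξ : ℝ → ℝ}, ContDiff ℝ ∞ g →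
    (∀ s, HasDerivAt ξ (g (ξ s)) s) → (∀ i x, ‖iteratedFDeriv ℝ i g x‖ ≤ A i) →
    ∀ n, 1 ≤ n → ∀ s, ‖iteratedFDeriv ℝ n ξ s‖ ≤ b n := by
  -- The derivative of order n + 1 of ξ is the n-th derivative of g ∘ ξ, which involves ξ only up to
  -- order n; the bounds are built order by order and the diagonal is taken.
  have main : ∀ n : ℕ, ∃ b : ℕ → ℝ, ∀ {g ξ : ℝ → ℝ}, ContDiff ℝ ∞ g →
      (∀ s, HasDerivAt ξ (g (ξ s)) s) → (∀ i x, ‖iteratedFDeriv ℝ i g x‖ ≤ A i) →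
      ∀ i, 1 ≤ i → i ≤ n → ∀ s, ‖iteratedFDeriv ℝ i ξ s‖ ≤ b i := by
    intro n
    induction n with
    | zero => exact ⟨0, fun _ _ _ i h1 h2 => by omega⟩
    | succ n ih =>
      obtain ⟨b, hb⟩ := ih
      refine ⟨Function.update b (n + 1) (compBound A b n), fun {g ξ} hg hξ hA i h1 h2 s => ?_⟩
      rcases h2.lt_or_eq with h | rfl
      · rw [Function.update_of_ne h.ne]
        exact hb hg hξ hA i h1 (by omega) s
      · rw [Function.update_self]
        exact norm_iteratedFDeriv_primitive_le hg (contDiff_of_trajectory hg hξ) hξ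
          (fun i => hA i _) fun i h1 h2 => hb hg hξ hA i h1 h2 s
  choose b hb using main
  exact ⟨fun n => b n n, fun hg hξ hA n hn s => hb n hg hξ hA n hn le_rfl s⟩

/-- A function of `s` with bounded derivatives, as a function of `(s, t)`. -/
theorem halfBdd_comp_fst {J : ℝ → ℝ} (hJ : ContDiff ℝ ∞ J) {b : ℕ → ℝ} {j : ℕ}
    (hb : ∀ n, j ≤ n → ∀ s, ‖iteratedFDeriv ℝ n J s‖ ≤ b n) :
    HalfBdd j b fun q => J q.1 := by
  refine ⟨(hJ.comp contDiff_fst).contDiffOn, fun n hn q _ => ?_⟩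
  have h1 := ContinuousLinearMap.iteratedFDeriv_comp_right (ContinuousLinearMap.fst ℝ ℝ ℝ) hJ q
    (natCast_le_infty n)
  rw [show (fun q : ℝ × ℝ => J q.1) = J ∘ ContinuousLinearMap.fst ℝ ℝ ℝ from rfl, h1]
  refine (ContinuousMultilinearMap.norm_compContinuousLinearMap_le _ _).trans ?_
  refine le_trans ?_ (hb n hn q.1)
  refine mul_le_of_le_one_right (norm_nonneg _) ?_
  rw [Finset.prod_const]
  exact pow_le_one₀ (norm_nonneg _) (ContinuousLinearMap.norm_fst_le ℝ ℝ ℝ)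

end MorseBott

namespace MorseBott

/-! ## Asymptotics -/

theorem ExpSmall.mono {E : Type*} [NormedAddCommGroup E] [NormedSpace ℝ E] {k k' : ℕ}
    {K K' r r' : ℝ} {F : ℝ × ℝ → E} (h : ExpSmall k K r F) (hk : k' ≤ k) (hK : K ≤ K')
    (hK' : 0 ≤ K') (hr : r' ≤ r) : ExpSmall k' K' r' F := fun n hn q hq => by
  refine (h n (hn.trans hk) q hq).trans ?_
  exact mul_le_mul hK (Real.exp_le_exp.2 (by nlinarith)) (Real.exp_pos _).le hK'

theorem ExpSmall.congr {E : Type*} [NormedAddCommGroup E] [NormedSpace ℝ E] {k : ℕ} {K r : ℝ}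
    {F G : ℝ × ℝ → E} (h : ExpSmall k K r F) (hFG : ∀ q : ℝ × ℝ, 0 < q.1 → G q = F q) :
    ExpSmall k K r G := fun n hn q hq => by
  rw [iteratedFDeriv_congr_half hFG n hq]
  exact h n hn q hq

theorem ExpSmall.prodMk {E E' : Type*} [NormedAddCommGroup E] [NormedSpace ℝ E]
    [NormedAddCommGroup E'] [NormedSpace ℝ E'] {k : ℕ} {K r : ℝ} {F : ℝ × ℝ → E} {G : ℝ × ℝ → E'}
    (hF : ExpSmall k K r F) (hG : ExpSmall k K r G) (sF : ContDiffOn ℝ ∞ F openHalf)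
    (sG : ContDiffOn ℝ ∞ G openHalf) : ExpSmall k K r fun q => (F q, G q) := fun n hn q hq => by
  rw [iteratedFDeriv_prodMk (contDiffAt_of_half sF hq) (contDiffAt_of_half sG hq)
    (natCast_le_infty n), ContinuousMultilinearMap.opNorm_prod]
  exact max_le (hF n hn q hq) (hG n hn q hq)

/-- Exponential decay of a function with bounded derivatives improves to exponential decay of all
its derivatives. -/
theorem exists_expSmall {E : Type*} [NormedAddCommGroup E] [NormedSpace ℝ E] (k : ℕ) {θ : ℝ}
    (h0 : 0 < θ) (h1 : θ < 1) (B : ℕ → ℝ) (K₀ : ℝ) :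
    ∃ C : ℝ, 0 < C ∧ ∀ F : ℝ × ℝ → E, HalfBdd 1 B F → ∀ r K : ℝ, 0 ≤ r → 0 ≤ K → K ≤ K₀ →
      (∀ q : ℝ × ℝ, 0 < q.1 → ‖F q‖ ≤ K * Real.exp (-r * q.1)) →
      ExpSmall k (C * K ^ θ) (θ * r) F := by
  -- The slot of order zero holds the a priori bound on K; only orders at least one are bounds on F.
  obtain ⟨C, hC, h⟩ := expSmall_of_sup (E := E) k h0 h1 (Function.update B 0 K₀)
  refine ⟨C, hC, fun F hF r K hr hK hK0 hs => h F hF.smooth (fun j hj q hq => ?_) r K hr hK ?_ hs⟩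
  · rw [Function.update_of_ne (by omega)]
    exact hF.bound j hj q hq
  · rwa [Function.update_self]

theorem qNorm_nonneg (T : ℝ) (a w x y : ℝ × ℝ → ℝ) (s : ℝ) : 0 ≤ qNorm T a w x y s :=
  Real.sqrt_nonneg _

theorem qNormBound_nonneg (T : ℝ) (B : ℕ → ℝ) : 0 ≤ qNormBound T B := by
  unfold qNormBound
  positivity

theorem CylinderData.limit_qNorm_mem {T K c₀ μ : ℝ} {B : ℕ → ℝ} {g₀ g₁ : ℝ → ℝ}
    {a w x y κ : ℝ × ℝ → ℝ} (h : CylinderData T K c₀ μ B g₀ g₁ a w x y κ) {m : ℝ}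
    (hm : Tendsto (qNorm T a w x y) (𝓝[>] 0) (𝓝 m)) : m ∈ Set.Icc 0 (qNormBound T B) :=
  ⟨ge_of_tendsto' hm fun s => qNorm_nonneg T a w x y s, le_of_tendsto hm (by
    filter_upwards [self_mem_nhdsWithin] with s hs using h.qNorm_le hs)⟩

/-- Exponential decay of the non-kernel part and its derivatives. -/
theorem exists_qPart_expSmall {T : ℝ} (hT : 0 < T) {K : ℝ} (hK : 0 ≤ K) {c₀ : ℝ} (hc : 0 < c₀)
    {θ : ℝ} (h0 : 0 < θ) (h1 : θ < 1) (B : ℕ → ℝ) (k : ℕ) :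
    ∃ C : ℝ, 0 < C ∧ ∀ {μ : ℝ} {g₀ g₁ : ℝ → ℝ} {a w x y κ : ℝ × ℝ → ℝ},
      CylinderData T K c₀ μ B g₀ g₁ a w x y κ →
      ∀ m : ℝ, Tendsto (qNorm T a w x y) (𝓝[>] 0) (𝓝 m) →
      ∀ F ∈ [qPart T a, qPart T w, qPart T x, y],
        ExpSmall k (C * m ^ (θ * θ * θ)) (θ * (θ * energyRate T K c₀ / 2)) F := by
  obtain ⟨C₁, hC₁, H₁⟩ := exists_qPart_decay hT hK hc h0 h1 B
  obtain ⟨C₂, hC₂, H₂⟩ := exists_expSmall (E := ℝ) k h0 h1 (qBound T B)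
    (C₁ * qNormBound T B ^ (θ * θ))
  have hr := energyRate_pos hT hK hc
  refine ⟨C₂ * C₁ ^ θ, by positivity, fun {μ g₀ g₁ a w x y κ} h m hm F hF => ?_⟩
  obtain ⟨hm0, hmb⟩ := h.limit_qNorm_mem hm
  have hbdd : HalfBdd 1 (qBound T B) F := by
    refine HalfBdd.mono (j := 0) ?_ zero_le_one fun _ _ => le_rfl
    simp only [List.mem_cons, List.not_mem_nil, or_false] at hF
    rcases hF with rfl | rfl | rfl | rfl
    exacts [h.qa_bdd, h.qw_bdd, h.qx_bdd, h.y_qbdd]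
  have key := H₂ F hbdd (θ * energyRate T K c₀ / 2) (C₁ * m ^ (θ * θ)) (by positivity)
    (by positivity) (by gcongr) fun q hq => ?_
  · rwa [Real.mul_rpow hC₁.le (by positivity), ← Real.rpow_mul hm0, ← mul_assoc] at key
  -- The estimates hold from circles σ > 0 on, inside the open half-plane; the limit σ → 0 brings in
  -- the norm at the boundary.
  · have lim : Tendsto (fun σ => C₁ * qNorm T a w x y σ ^ (θ * θ)
        * Real.exp (-(θ * energyRate T K c₀ / 2) * (q.1 - σ))) (𝓝[>] 0)
        (𝓝 (C₁ * m ^ (θ * θ) * Real.exp (-(θ * energyRate T K c₀ / 2) * (q.1 - 0)))) := by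
      refine ((hm.rpow_const (Or.inr (by positivity))).const_mul C₁).mul ?_
      refine Tendsto.mono_left (Continuous.tendsto ?_ 0) nhdsWithin_le_nhds
      fun_prop
    rw [sub_zero] at lim
    refine ge_of_tendsto lim ?_
    filter_upwards [Ioc_mem_nhdsGT hq] with σ hσ
    exact H₁ h σ q hσ.1 hσ.2 F hF

theorem exists_asymptotic_constant {φ φ' : ℝ → ℝ} {r K : ℝ} (hr : 0 < r)
    (hφ : ∀ s, 0 < s → HasDerivAt φ (φ' s) s)
    (hK : ∀ s, 0 < s → |φ' s| ≤ K * Real.exp (-r * s)) :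
    ∃ c : ℝ, ∀ s, 0 < s → |φ s - c| ≤ 2 * K / r * Real.exp (-r * s) := by
  obtain ⟨ξ, h1, h2⟩ := exists_asymptotic_trajectory (g := fun _ => 0) (μ := 0) (L := 0) hr le_rfl
    (by positivity) (by simp) (by simp) hφ (fun s hs => by simpa using hK s hs)
  refine ⟨ξ 0, fun s hs => ?_⟩
  rw [is_const_of_deriv_eq_zero (fun s => (h1 s).differentiableAt) (fun s => (h1 s).deriv) 0 s]
  exact h2 s hs

/-- The constant in `CylinderData.exists_limits`. -/
noncomputable def limitConst (r : ℝ) : ℝ := 2 + 2 * (6 + 12 / r) / r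

theorem limitConst_pos {r : ℝ} (hr : 0 < r) : 0 < limitConst r := by
  unfold limitConst
  positivity

/-- Existence of the asymptotic limits, with exponential convergence. -/
theorem CylinderData.exists_limits {T K c₀ μ : ℝ} {B : ℕ → ℝ} {g₀ g₁ : ℝ → ℝ}
    {a w x y κ : ℝ × ℝ → ℝ} (h : CylinderData T K c₀ μ B g₀ g₁ a w x y κ) {r P : ℝ} (hr : 0 < r)
    (hμ1 : μ ≤ 1) (hμ : μ ≤ r / 2) {L : ℝ} (hL : ∀ x, |g₁ x| ≤ L)
    (hP : ∀ F ∈ [qPart T a, qPart T w, qPart T x, y], ExpSmall 1 P r F) :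
    (∃ c : ℝ, ∀ q : ℝ × ℝ, 0 < q.1 → |w q + c| ≤ limitConst r * P * Real.exp (-r * q.1)) ∧
    ∃ ξ : ℝ → ℝ, (∀ s, HasDerivAt ξ (g₁ (ξ s)) s) ∧
      (∀ q : ℝ × ℝ, 0 < q.1 → |x q - ξ q.1| ≤ limitConst r * P * Real.exp (-r * q.1)) ∧
      ∀ s₀ : ℝ, ∃ c : ℝ, ∀ q : ℝ × ℝ, 0 < q.1 →
        |a q - c - ∫ s' in s₀..q.1, g₀ (ξ s')| ≤ limitConst r * P * Real.exp (-r * q.1) := by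
  set E : ℝ → ℝ := fun s => Real.exp (-r * s) with hE
  have hE0 : ∀ s, 0 < E s := fun s => Real.exp_pos _
  have hP0 : 0 ≤ P := by
    have := (norm_nonneg _).trans (hP y (by simp) 0 zero_le_one (1, 0) one_pos)
    exact nonneg_of_mul_nonneg_left this (Real.exp_pos _)
  have dec : ∀ F ∈ [qPart T a, qPart T w, qPart T x, y], ∀ q : ℝ × ℝ, 0 < q.1 →
      |F q| ≤ P * E q.1 ∧ |dT F q| ≤ P * E q.1 := by
    intro F hF q hq
    constructor
    · have := hP F hF 0 zero_le_one q hq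
      rwa [norm_iteratedFDeriv_zero] at this
    · have h1 := hP F hF 1 le_rfl q hq
      rw [norm_iteratedFDeriv_one] at h1
      have h2 := ContinuousLinearMap.le_opNorm (fderiv ℝ F q) (0, 1)
      rw [show ‖((0, 1) : ℝ × ℝ)‖ = 1 by simp [Prod.norm_def], mul_one] at h2
      exact h2.trans h1
  have da : ∀ q : ℝ × ℝ, 0 < q.1 → |dT a q| ≤ P * E q.1 := fun q hq => by
    rw [← dT_qPart (T := T) h.a_bdd.smooth hq]
    exact (dec _ (by simp) q hq).2
  have dw : ∀ q : ℝ × ℝ, 0 < q.1 → |dT w q| ≤ P * E q.1 := fun q hq => by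
    rw [← dT_qPart (T := T) h.w_bdd.smooth hq]
    exact (dec _ (by simp) q hq).2
  have dx : ∀ q : ℝ × ℝ, 0 < q.1 → |dT x q| ≤ P * E q.1 := fun q hq => by
    rw [← dT_qPart (T := T) h.x_bdd.smooth hq]
    exact (dec _ (by simp) q hq).2
  have dy : ∀ q : ℝ × ℝ, 0 < q.1 → |dT y q| ≤ P * E q.1 := fun q hq => (dec _ (by simp) q hq).2
  have y0 : ∀ q : ℝ × ℝ, 0 < q.1 → |y q| ≤ P * E q.1 := fun q hq => (dec _ (by simp) q hq).1
  have err : ∀ q : ℝ × ℝ, 0 < q.1 →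
      μ * (|dT a q| + |dT w q| + |dT x q| + |dT y q| + |y q|) ≤ 5 * (P * E q.1) := fun q hq => by
    have h1 : |dT a q| + |dT w q| + |dT x q| + |dT y q| + |y q| ≤ 5 * (P * E q.1) := by
      linarith [da q hq, dw q hq, dx q hq, dy q hq, y0 q hq]
    exact (mul_le_of_le_one_left (by positivity) hμ1).trans h1
  -- Along a circle F differs from its value at t = 0 by a decaying amount, so it suffices to follow
  -- the line t = 0.
  have osc : ∀ F, qPart T F ∈ [qPart T a, qPart T w, qPart T x, y] → ∀ q : ℝ × ℝ, 0 < q.1 →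
      |F q - F (q.1, 0)| ≤ 2 * (P * E q.1) := fun F hF q hq => by
    have h1 := (dec _ hF q hq).1
    have h2 := (dec _ hF (q.1, 0) hq).1
    have h3 : F q - F (q.1, 0) = qPart T F q - qPart T F (q.1, 0) := by
      simp only [qPart]
      ring
    rw [h3]
    refine (abs_sub _ _).trans ?_
    linarith
  have fin : ∀ (v V : ℝ) {s : ℝ}, |v| ≤ 2 * (P * E s) →
      |V| ≤ 2 * ((6 + 12 / r) * P) / r * E s → |v + V| ≤ limitConst r * P * E s := by
    intro v V s h1 h2
    refine (abs_add_le v V).trans ((add_le_add h1 h2).trans (le_of_eq ?_))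
    unfold limitConst
    ring
  have weak : ∀ s, 2 * (6 * P) / r * E s ≤ 2 * ((6 + 12 / r) * P) / r * E s := fun s => by
    have : 0 ≤ 12 / r := by positivity
    have := (hE0 s).le
    gcongr
    linarith
  refine ⟨?_, ?_⟩
  -- In 6 P, the errors in the equation account for 5 P and the derivative ∂_t a for the last P; the
  -- same count serves for x.
  · obtain ⟨c, hc⟩ := exists_asymptotic_constant (φ := fun s => w (s, 0)) (K := 6 * P) hr
      (fun s hs => hasDerivAt_dS h.w_bdd.smooth hs 0) fun s hs => by
        have h1 := h.eq_w (s, 0) hs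
        have h2 := err (s, 0) hs
        have h3 := da (s, 0) hs
        have h4 := abs_sub (dS w (s, 0) + dT a (s, 0)) (dT a (s, 0))
        rw [add_sub_cancel_right] at h4
        change _ ≤ 6 * P * E s
        simp only at h2 h3
        linarith
    refine ⟨-c, fun q hq => ?_⟩
    have := fin (w q - w (q.1, 0)) (w (q.1, 0) - c) (osc w (by simp) q hq)
      ((hc q.1 hq).trans (weak q.1))
    rwa [sub_add_sub_cancel, sub_eq_add_neg] at this
  · obtain ⟨ξ, hξ, hx⟩ := exists_asymptotic_trajectory (g := g₁) (φ := fun s => x (s, 0))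
      (K := 6 * P) hr h.μ_nonneg hμ h.lip_g₁ hL
      (fun s hs => hasDerivAt_dS h.x_bdd.smooth hs 0) fun s hs => by
        have h1 := h.eq_x (s, 0) hs
        have h2 := err (s, 0) hs
        have h3 := dy (s, 0) hs
        have h4 := abs_add_le (dS x (s, 0) - g₁ (x (s, 0)) - dT y (s, 0)) (dT y (s, 0))
        rw [sub_add_cancel] at h4
        change _ ≤ 6 * P * E s
        simp only at h2 h3
        linarith
    refine ⟨ξ, hξ, fun q hq => ?_, fun s₀ => ?_⟩
    · have := fin (x q - x (q.1, 0)) (x (q.1, 0) - ξ q.1) (osc x (by simp) q hq)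
        ((hx q.1 hq).trans (weak q.1))
      rwa [sub_add_sub_cancel] at this
    · have hξc : Continuous ξ := continuous_iff_continuousAt.2 fun s => (hξ s).continuousAt
      have hJ : ∀ s, HasDerivAt (fun s => ∫ s' in s₀..s, g₀ (ξ s')) (g₀ (ξ s)) s := fun s =>
        (h.cont_g₀.comp hξc).integral_hasStrictDerivAt s₀ s |>.hasDerivAt
      -- The additional 12 / r comes from replacing x by the trajectory ξ inside g₀.
      obtain ⟨c, hc⟩ := exists_asymptotic_constant
        (φ := fun s => a (s, 0) - ∫ s' in s₀..s, g₀ (ξ s')) (K := (6 + 12 / r) * P) hr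
        (fun s hs => (hasDerivAt_dS h.a_bdd.smooth hs 0).sub (hJ s)) fun s hs => by
          have h1 := h.eq_a (s, 0) hs
          have h2 := err (s, 0) hs
          have h3 := dw (s, 0) hs
          have h4 := abs_add_le (dS a (s, 0) - g₀ (x (s, 0)) - dT w (s, 0))
            (dT w (s, 0) + (g₀ (x (s, 0)) - g₀ (ξ s)))
          have h5 := abs_add_le (dT w (s, 0)) (g₀ (x (s, 0)) - g₀ (ξ s))
          have h6 : |g₀ (x (s, 0)) - g₀ (ξ s)| ≤ 2 * (6 * P) / r * E s :=
            ((h.lip_g₀ _ _).trans (mul_le_of_le_one_left (abs_nonneg _) hμ1)).trans (hx s hs)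
          have h7 : dS a (s, 0) - g₀ (ξ s) = dS a (s, 0) - g₀ (x (s, 0)) - dT w (s, 0)
            + (dT w (s, 0) + (g₀ (x (s, 0)) - g₀ (ξ s))) := by ring
          have h8 : 2 * (6 * P) / r * E s = 12 / r * P * E s := by ring
          change _ ≤ (6 + 12 / r) * P * E s
          rw [h7]
          simp only at h2 h3
          linarith
      refine ⟨c, fun q hq => ?_⟩
      have := fin (a q - a (q.1, 0)) (a (q.1, 0) - (∫ s' in s₀..q.1, g₀ (ξ s')) - c)
        (osc a (by simp) q hq) (hc q.1 hq)
      rwa [show a q - a (q.1, 0) + (a (q.1, 0) - (∫ s' in s₀..q.1, g₀ (ξ s')) - c)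
        = a q - c - ∫ s' in s₀..q.1, g₀ (ξ s') by ring] at this

/-- Asymptotics of solutions of the perturbed Cauchy-Riemann equations on a half-cylinder. -/
theorem exists_cylinder_asymptotics {T : ℝ} (hT : 0 < T) {K : ℝ} (hK : 0 ≤ K) {c₀ : ℝ}
    (hc : 0 < c₀) {θ : ℝ} (h0 : 0 < θ) (h1 : θ < 1) (A B : ℕ → ℝ) (k : ℕ) :
    ∃ C : ℝ, 0 < C ∧ ∀ {μ : ℝ} {g₀ g₁ : ℝ → ℝ} {a w x y κ : ℝ × ℝ → ℝ},
      CylinderData T K c₀ μ B g₀ g₁ a w x y κ →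
      μ ≤ 1 → μ ≤ θ * (θ * energyRate T K c₀ / 2) / 2 →
      ContDiff ℝ ∞ g₀ → ContDiff ℝ ∞ g₁ → (∀ i v, ‖iteratedFDeriv ℝ i g₀ v‖ ≤ A i) →
      (∀ i v, ‖iteratedFDeriv ℝ i g₁ v‖ ≤ A i) →
      ∀ m : ℝ, Tendsto (qNorm T a w x y) (𝓝[>] 0) (𝓝 m) →
      (∀ F ∈ [qPart T a, qPart T w, qPart T x, y], ExpSmall k (C * m ^ (θ * θ * θ * θ))
        (θ * (θ * (θ * energyRate T K c₀ / 2))) F) ∧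
      (∃ c : ℝ, ExpSmall k (C * m ^ (θ * θ * θ * θ)) (θ * (θ * (θ * energyRate T K c₀ / 2)))
        fun q => w q + c) ∧
      ∃ ξ : ℝ → ℝ, (∀ s, HasDerivAt ξ (g₁ (ξ s)) s) ∧
        ExpSmall k (C * m ^ (θ * θ * θ * θ)) (θ * (θ * (θ * energyRate T K c₀ / 2)))
          (fun q => x q - ξ q.1) ∧
        ∀ s₀ : ℝ, ∃ c : ℝ, ExpSmall k (C * m ^ (θ * θ * θ * θ))
          (θ * (θ * (θ * energyRate T K c₀ / 2)))
          fun q => a q - c - ∫ s' in s₀..q.1, g₀ (ξ s') := by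
  -- One order more than k, because the limits use first derivatives even when k = 0.
  obtain ⟨C₁, hC₁, H₁⟩ := exists_qPart_expSmall hT hK hc h0 h1 B (k + 1)
  obtain ⟨b, hb⟩ := exists_bound_trajectory A
  have hR := energyRate_pos hT hK hc
  set R := energyRate T K c₀
  set r := θ * (θ * R / 2) with hrdef
  have hr : 0 < r := by positivity
  set N := qNormBound T B
  have hN : 0 ≤ N := qNormBound_nonneg T B
  set D := limitConst r
  have hD : 0 < D := limitConst_pos hr
  -- The three summands bound the derivatives of the map, of ξ, and of the primitive of g₀ ∘ ξ; the
  -- last has its index lowered by one because of the integration.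
  obtain ⟨C₂, hC₂, H₂⟩ := exists_expSmall (E := ℝ) k h0 h1
    (fun n => |B n| + |b n| + |compBound A b (n - 1)|) (D * (C₁ * N ^ (θ * θ * θ)))
  -- The first summand lowers the power θ³ to θ⁴ for the non-kernel part; the second comes from
  -- interpolating the differences to the limits.
  set C := C₁ * N ^ (θ * θ * θ - θ * θ * θ * θ) + C₂ * (D * C₁) ^ θ with hCdef
  refine ⟨C, by positivity, fun {μ g₀ g₁ a w x y κ} h hμ1 hμ sg₀ sg₁ hA₀ hA₁ m hm => ?_⟩
  obtain ⟨hm0, hmN⟩ := h.limit_qNorm_mem hm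
  have hm3 : 0 ≤ m ^ (θ * θ * θ) := Real.rpow_nonneg hm0 _
  have hm4 : 0 ≤ m ^ (θ * θ * θ * θ) := Real.rpow_nonneg hm0 _
  have hq := H₁ h m hm
  have hrr : θ * r ≤ r := mul_le_of_le_one_left hr.le h1.le
  have hfin : ∀ F : ℝ × ℝ → ℝ, HalfBdd 1 (fun n => |B n| + |b n| + |compBound A b (n - 1)|) F →
      (∀ q : ℝ × ℝ, 0 < q.1 → |F q| ≤ D * (C₁ * m ^ (θ * θ * θ)) * Real.exp (-r * q.1)) →
      ExpSmall k (C * m ^ (θ * θ * θ * θ)) (θ * r) F := by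
    intro F hF hs
    refine (H₂ F hF r (D * (C₁ * m ^ (θ * θ * θ))) hr.le (by positivity) (by gcongr) hs).mono
      le_rfl ?_ (by positivity) le_rfl
    rw [← mul_assoc D, Real.mul_rpow (by positivity) hm3, ← Real.rpow_mul hm0, ← mul_assoc]
    refine mul_le_mul_of_nonneg_right ?_ hm4
    rw [hCdef]
    have : 0 ≤ C₁ * N ^ (θ * θ * θ - θ * θ * θ * θ) := by positivity
    linarith
  obtain ⟨⟨c, hw⟩, ξ, hξ, hx, ha⟩ := h.exists_limits (P := C₁ * m ^ (θ * θ * θ)) hr hμ1 hμ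
    (L := A 0) (fun v => by
      have := hA₁ 0 v
      rwa [norm_iteratedFDeriv_zero] at this)
    fun F hF => (hq F hF).mono (by omega) le_rfl (by positivity) le_rfl
  have hsξ := contDiff_of_trajectory sg₁ hξ
  have hbξ := hb sg₁ hξ hA₁
  have Bξ : HalfBdd 1 b fun q => ξ q.1 := halfBdd_comp_fst hsξ hbξ
  have hconst : ∀ c : ℝ, HalfBdd 1 (fun _ => 0) fun _ : ℝ × ℝ => c := fun c =>
    ⟨contDiffOn_const, fun n hn q _ => by
      rw [iteratedFDeriv_const_of_ne (by omega)]
      simp⟩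
  refine ⟨fun F hF => (hq F hF).mono (by omega) ?_ (by positivity) hrr, ⟨c, hfin _ ?_ hw⟩, ξ, hξ,
    hfin _ ?_ hx, fun s₀ => ?_⟩
  · have h2 : m ^ (θ * θ * θ) ≤ N ^ (θ * θ * θ - θ * θ * θ * θ) * m ^ (θ * θ * θ * θ) :=
      rpow_le_mul_rpow hm0 hmN (by positivity) (mul_le_of_le_one_right (by positivity) h1.le)
    calc C₁ * m ^ (θ * θ * θ)
        ≤ C₁ * (N ^ (θ * θ * θ - θ * θ * θ * θ) * m ^ (θ * θ * θ * θ)) := by gcongr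
      _ = C₁ * N ^ (θ * θ * θ - θ * θ * θ * θ) * m ^ (θ * θ * θ * θ) := by ring
      _ ≤ C * m ^ (θ * θ * θ * θ) := by
        refine mul_le_mul_of_nonneg_right ?_ hm4
        rw [hCdef]
        have : 0 ≤ C₂ * (D * C₁) ^ θ := by positivity
        linarith
  · refine (h.w_bdd_one.add (hconst c)).mono le_rfl fun n _ => ?_
    linarith [le_abs_self (B n), abs_nonneg (b n), abs_nonneg (compBound A b (n - 1))]
  · refine (h.x_bdd.sub Bξ).mono le_rfl fun n _ => ?_
    linarith [le_abs_self (B n), le_abs_self (b n), abs_nonneg (compBound A b (n - 1))]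
  · obtain ⟨c, hc⟩ := ha s₀
    refine ⟨c, hfin _ ?_ hc⟩
    have hJ : ∀ s, HasDerivAt (fun s => ∫ s' in s₀..s, g₀ (ξ s')) (g₀ (ξ s)) s := fun s =>
      (sg₀.continuous.comp hsξ.continuous).integral_hasStrictDerivAt s₀ s |>.hasDerivAt
    have hJs := contDiff_of_hasDerivAt_comp sg₀ hsξ hJ
    have BJ : HalfBdd 1 (fun n => compBound A b (n - 1))
        fun q => (fun s => ∫ s' in s₀..s, g₀ (ξ s')) q.1 := by
      refine halfBdd_comp_fst hJs fun n hn s => ?_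
      obtain ⟨n, rfl⟩ : ∃ i, n = i + 1 := ⟨n - 1, by omega⟩
      exact norm_iteratedFDeriv_primitive_le sg₀ hsξ hJ (fun i => hA₀ i _)
        fun i hi _ => hbξ i hi s
    refine ((h.a_bdd.sub (hconst c)).sub BJ).mono le_rfl fun n hn => ?_
    linarith [le_abs_self (B n), abs_nonneg (b n), le_abs_self (compBound A b (n - 1))]

end MorseBott

namespace MorseBott

/-! ## The perturbed vector fields -/

/-- The functions `e^{δ f} - 1` and `δ f'` have derivatives bounded uniformly in `δ ∈ [0, 1]`. -/
theorem IsPerturbingFunction.exists_bound_fields {f : ℝ → ℝ} (hf : IsPerturbingFunction f) :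
    ∃ A : ℕ → ℝ, ∀ δ : ℝ, 0 ≤ δ → δ ≤ 1 →
      (∀ i v, ‖iteratedFDeriv ℝ i (fun v => Real.exp (δ * f v) - 1) v‖ ≤ A i) ∧
      ∀ i v, ‖iteratedFDeriv ℝ i (fun v => δ * deriv f v) v‖ ≤ A i := by
  choose D hD0 hD using fun n => exists_bound_iteratedFDeriv_of_periodic hf.smooth hf.periodic n
  refine ⟨fun i => |compBound (fun _ => Real.exp (D 0) + 1) D i| + D (i + 1),
    fun δ h0 h1 => ⟨fun i v => ?_, fun i v => ?_⟩⟩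
  · have hsm : ContDiff ℝ ∞ fun v => δ * f v := contDiff_const.mul hf.smooth
    have hE : ContDiff ℝ ∞ fun v : ℝ => Real.exp v - 1 := Real.contDiff_exp.sub contDiff_const
    have hscale : ∀ n v, ‖iteratedFDeriv ℝ n (fun v => δ * f v) v‖ ≤ D n := fun n v => by
      have : (fun v => δ * f v) = δ • f := rfl
      rw [this, iteratedFDeriv_const_smul_apply
        (hf.smooth.contDiffAt.of_le (natCast_le_infty n)), norm_smul, Real.norm_eq_abs,
        abs_of_nonneg h0]
      exact (mul_le_of_le_one_left (norm_nonneg _) h1).trans (hD n v)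
    have hexp : Real.exp (δ * f v) ≤ Real.exp (D 0) := by
      have := hscale 0 v
      rw [norm_iteratedFDeriv_zero, Real.norm_eq_abs] at this
      exact Real.exp_le_exp.2 ((le_abs_self _).trans this)
    have hA : ∀ i, ‖iteratedFDeriv ℝ i (fun v : ℝ => Real.exp v - 1) (δ * f v)‖
        ≤ Real.exp (D 0) + 1 := by
      intro i
      rcases i with _ | i
      · rw [norm_iteratedFDeriv_zero, Real.norm_eq_abs, abs_le]
        constructor <;> linarith [Real.exp_pos (δ * f v), Real.exp_pos (D 0)]
      · have e : deriv (fun v : ℝ => Real.exp v - 1) = Real.exp := by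
          funext v
          simp
        rw [norm_iteratedFDeriv_eq_norm_iteratedDeriv, iteratedDeriv_succ', e,
          iteratedDeriv_eq_iterate, Real.iter_deriv_exp, Real.norm_eq_abs, Real.abs_exp]
        linarith
    refine (norm_iteratedFDeriv_comp_le_compBound hE hsm hA fun i _ _ => hscale i v).trans ?_
    linarith [le_abs_self (compBound (fun _ => Real.exp (D 0) + 1) D i), hD0 (i + 1)]
  · have hd : ContDiff ℝ ∞ (deriv f) := (contDiff_infty_iff_deriv.1 hf.smooth).2
    have : (fun v => δ * deriv f v) = δ • deriv f := rfl
    rw [this, iteratedFDeriv_const_smul_apply (hd.contDiffAt.of_le (natCast_le_infty i)), norm_smul,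
      Real.norm_eq_abs, abs_of_nonneg h0]
    have h2 := hD (i + 1) v
    rw [norm_iteratedFDeriv_eq_norm_iteratedDeriv, iteratedDeriv_succ',
      ← norm_iteratedFDeriv_eq_norm_iteratedDeriv] at h2
    have h3 := mul_le_of_le_one_left (norm_nonneg (iteratedFDeriv ℝ i (deriv f) v)) h1
    linarith [abs_nonneg (compBound (fun _ => Real.exp (D 0) + 1) D i)]

theorem abs_sub_le_of_abs_deriv_le {g g' : ℝ → ℝ} (hg : ∀ v, HasDerivAt g (g' v) v) {L : ℝ}
    (hL : ∀ v, |g' v| ≤ L) (v v' : ℝ) : |g v - g v'| ≤ L * |v - v'| :=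
  convex_univ.norm_image_sub_le_of_norm_hasDerivWithin_le
    (fun v _ => (hg v).hasDerivWithinAt) (fun v _ => hL v) (Set.mem_univ v') (Set.mem_univ v)

/-! ## The components of a holomorphic half-cylinder -/

/-- The rotation rate along `u`. -/
noncomputable def twistC (M : Torus) (u : ℝ × ℝ → SPt) (q : ℝ × ℝ) : ℝ := M.twist (u q).2

section
variable {M : Torus} {f : ℝ → ℝ} {δ : ℝ} {u : ℝ × ℝ → SPt}

theorem IsHolomorphic.smooth_half (hu : IsHolomorphic M f δ u) : ContDiffOn ℝ ∞ u openHalf :=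
  hu.smooth.mono fun q hq => le_of_lt (show 0 < q.1 from hq)

theorem contDiffOn_aC (hu : ContDiffOn ℝ ∞ u openHalf) : ContDiffOn ℝ ∞ (aC u) openHalf :=
  contDiff_fst.comp_contDiffOn hu

theorem contDiffOn_zC (hu : ContDiffOn ℝ ∞ u openHalf) : ContDiffOn ℝ ∞ (zC u) openHalf :=
  (contDiff_fst.comp contDiff_snd).comp_contDiffOn hu

theorem contDiffOn_xC (hu : ContDiffOn ℝ ∞ u openHalf) : ContDiffOn ℝ ∞ (xC u) openHalf :=
  (contDiff_fst.comp (contDiff_snd.comp contDiff_snd)).comp_contDiffOn hu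

theorem contDiffOn_yC (hu : ContDiffOn ℝ ∞ u openHalf) : ContDiffOn ℝ ∞ (yC u) openHalf :=
  (contDiff_snd.comp (contDiff_snd.comp contDiff_snd)).comp_contDiffOn hu

theorem fderiv_eq_components (hu : ContDiffOn ℝ ∞ u openHalf) {q : ℝ × ℝ} (hq : 0 < q.1)
    (v : ℝ × ℝ) : fderiv ℝ u q v = (fderiv ℝ (aC u) q v, fderiv ℝ (zC u) q v,
      fderiv ℝ (xC u) q v, fderiv ℝ (yC u) q v) := by
  have ha := (differentiableAt_half (contDiffOn_aC hu) hq).hasFDerivAt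
  have hz := (differentiableAt_half (contDiffOn_zC hu) hq).hasFDerivAt
  have hx := (differentiableAt_half (contDiffOn_xC hu) hq).hasFDerivAt
  have hy := (differentiableAt_half (contDiffOn_yC hu) hq).hasFDerivAt
  have h : HasFDerivAt u _ q := ha.prodMk (hz.prodMk (hx.prodMk hy))
  rw [h.fderiv]
  rfl

theorem HalfBdd.linear {L : ℝ × ℝ →L[ℝ] ℝ} (hL : ‖L‖ ≤ 1) : HalfBdd 1 (fun _ => 1) L := by
  refine ⟨L.contDiff.contDiffOn, fun n hn q _ => ?_⟩
  obtain ⟨n, rfl⟩ : ∃ i, n = i + 1 := ⟨n - 1, by omega⟩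
  rw [← norm_iteratedFDeriv_fderiv,
    show _root_.fderiv ℝ L = fun _ => L from funext fun q => L.fderiv]
  rcases n with _ | n
  · rwa [norm_iteratedFDeriv_zero]
  · rw [iteratedFDeriv_const_of_ne (by omega)]
    simp

/-- The perturbed Cauchy-Riemann equations in coordinates. -/
theorem Torus.exists_equations (M : Torus) (hf : IsPerturbingFunction f) {F₀ : ℝ} (hF : 0 ≤ F₀)
    (hf0 : ∀ x, |f x| ≤ F₀) (hf1 : ∀ x, |deriv f x| ≤ F₀) :
    ∃ C : ℝ, 0 ≤ C ∧ ∀ δ : ℝ, 0 ≤ δ → δ * F₀ ≤ 1 → ∀ u : ℝ × ℝ → SPt, IsHolomorphic M f δ u →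
      ∀ q : ℝ × ℝ, 0 < q.1 → |yC u q| ≤ M.ρ / 2 → ∀ R : ℝ,
      R = C * (δ + |yC u q|) * (|dT (aC u) q| + |dT (zC u) q - 1| + |dT (xC u) q|
        + |dT (yC u) q| + |yC u q|) →
      |dS (aC u) q - Real.exp (δ * f (xC u q)) - (dT (zC u) q - 1)| ≤ R ∧
      |dS (zC u) q + dT (aC u) q| ≤ R ∧
      |dS (xC u) q - δ * deriv f (xC u q) - dT (yC u) q| ≤ R ∧
      |dS (yC u) q + dT (xC u) q - twistC M u q * yC u q| ≤ R := by
  obtain ⟨C, hC, h⟩ := Torus.exists_Jδ_expansion M hf.smooth hF hf0 hf1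
  refine ⟨C, hC, fun δ hδ hδ1 u hu q hq hy R hR => ?_⟩
  have key := h δ hδ hδ1 (u q).2 hy (fderiv ℝ u q (0, 1))
  have heq : fderiv ℝ u q (1, 0) = -M.Jδ f δ (u q).2 (fderiv ℝ u q (0, 1)) :=
    eq_neg_of_add_eq_zero_left (hu.equation q hq)
  rw [← heq, fderiv_eq_components hu.smooth_half hq, fderiv_eq_components hu.smooth_half hq] at key
  have hR' : C * (δ + |(u q).2.2.2|) * (‖((fderiv ℝ (aC u) q (0, 1), fderiv ℝ (zC u) q (0, 1),
      fderiv ℝ (xC u) q (0, 1), fderiv ℝ (yC u) q (0, 1)) : SPt) - dZ‖ + |(u q).2.2.2|) ≤ R := by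
    rw [hR]
    refine mul_le_mul_of_nonneg_left ?_ (by positivity)
    refine add_le_add ?_ le_rfl
    have h1 := abs_nonneg (dT (aC u) q)
    have h2 := abs_nonneg (dT (zC u) q - 1)
    have h3 := abs_nonneg (dT (xC u) q)
    have h4 := abs_nonneg (dT (yC u) q)
    simp only [dZ, Prod.mk_sub_mk, sub_zero, Prod.norm_mk, Real.norm_eq_abs]
    change max |dT (aC u) q| (max |dT (zC u) q - 1| (max |dT (xC u) q| |dT (yC u) q|)) ≤ _
    refine max_le (by linarith) (max_le (by linarith) (max_le (by linarith) (by linarith)))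
  have key2 := key.trans hR'
  rw [Prod.mk_sub_mk, Prod.mk_sub_mk, Prod.mk_sub_mk] at key2
  simp only [Prod.norm_mk, Real.norm_eq_abs, max_le_iff] at key2
  obtain ⟨k1, k2, k3, k4⟩ := key2
  refine ⟨?_, ?_, ?_, ?_⟩
  · rw [sub_sub]
    exact k1
  · rwa [sub_neg_eq_add] at k2
  · rw [sub_sub]
    exact k3
  · rw [← sub_add] at k4
    rw [add_sub_right_comm]
    exact k4

end

end MorseBott

namespace MorseBott

/-! ### Maps close to the torus as solutions of the perturbed Cauchy-Riemann equations -/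

section
variable {M : Torus} {f : ℝ → ℝ} {δ ε : ℝ} {u : ℝ × ℝ → SPt} {k : ℕ} {B : ℕ → ℝ}

/-- Bounds for the derivatives of the components of a map that is close to the torus. -/
def closeBound (B : ℕ → ℝ) (n : ℕ) : ℝ := |B n| + 1

theorem IsClose.aC_bdd (hc : IsClose k ε B u) (hu : ContDiffOn ℝ ∞ u openHalf) :
    HalfBdd 1 (closeBound B) (aC u) :=
  ⟨contDiffOn_aC hu, fun n hn q hq => (hc.a_bound n hn q hq).trans (by
    unfold closeBound
    linarith [le_abs_self (B n)])⟩

theorem IsClose.zC_bdd (hc : IsClose k ε B u) (hu : ContDiffOn ℝ ∞ u openHalf) :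
    HalfBdd 1 (closeBound B) (zC u) :=
  ⟨contDiffOn_zC hu, fun n hn q hq => (hc.z_bound n hn q hq).trans (by
    unfold closeBound
    linarith [le_abs_self (B n)])⟩

theorem IsClose.xC_bdd (hc : IsClose k ε B u) (hε : ε ≤ 1) (hu : ContDiffOn ℝ ∞ u openHalf) :
    HalfBdd 1 (closeBound B) (xC u) := ⟨contDiffOn_xC hu, fun n hn q hq => by
  unfold closeBound
  rcases le_or_gt n k with h | h
  · linarith [hc.x_close n hn h q hq, abs_nonneg (B n)]
  · linarith [hc.x_bound n h q hq, le_abs_self (B n)]⟩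

theorem IsClose.yC_bdd (hc : IsClose k ε B u) (hε : ε ≤ 1) (hu : ContDiffOn ℝ ∞ u openHalf) :
    HalfBdd 0 (closeBound B) (yC u) := ⟨contDiffOn_yC hu, fun n _ q hq => by
  unfold closeBound
  rcases le_or_gt n k with h | h
  · linarith [hc.y_close n h q hq, abs_nonneg (B n)]
  · linarith [hc.y_bound n h q hq, le_abs_self (B n)]⟩

theorem IsClose.abs_yC_le (hc : IsClose k ε B u) {q : ℝ × ℝ} (hq : 0 < q.1) : |yC u q| ≤ ε := by
  have := hc.y_close 0 (Nat.zero_le k) q hq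
  rwa [norm_iteratedFDeriv_zero] at this

theorem IsClose.a_sub_bdd (hc : IsClose k ε B u) (hu : ContDiffOn ℝ ∞ u openHalf) :
    HalfBdd 1 (fun n => closeBound B n + 1) fun q => aC u q - q.1 :=
  (hc.aC_bdd hu).sub (HalfBdd.linear (ContinuousLinearMap.norm_fst_le ℝ ℝ ℝ))

theorem IsClose.z_sub_bdd (hc : IsClose k ε B u) (hε : ε ≤ 1) (hu : ContDiffOn ℝ ∞ u openHalf) :
    HalfBdd 0 (fun n => closeBound B n + 1) fun q => zC u q - q.2 := by
  have h := (hc.zC_bdd hu).sub (HalfBdd.linear (ContinuousLinearMap.norm_snd_le ℝ ℝ ℝ))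
  refine ⟨h.smooth, fun n _ q hq => ?_⟩
  rcases Nat.eq_zero_or_pos n with rfl | hn
  · rw [norm_iteratedFDeriv_zero, Real.norm_eq_abs]
    have h1 := hc.z_close q hq
    have h2 := abs_nonneg (B 0)
    unfold closeBound
    linarith
  · exact h.bound n hn q hq

/-- Bounds for the derivatives of the position on the three-manifold. -/
def positionBound (B : ℕ → ℝ) (n : ℕ) : ℝ :=
  |closeBound B n| + |(|closeBound B n| + |closeBound B n|)|

theorem IsClose.position_bdd (hc : IsClose k ε B u) (hε : ε ≤ 1)
    (hu : ContDiffOn ℝ ∞ u openHalf) : HalfBdd 1 (positionBound B) fun q => (u q).2 :=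
  (hc.zC_bdd hu).prodMk ((hc.xC_bdd hε hu).prodMk
    ((hc.yC_bdd hε hu).mono zero_le_one fun _ _ => le_rfl))

theorem hasFDerivAt_half {F : ℝ × ℝ → ℝ} (hF : ContDiffOn ℝ ∞ F openHalf) {q : ℝ × ℝ}
    (hq : 0 < q.1) : HasFDerivAt F (fderiv ℝ F q) q := (differentiableAt_half hF hq).hasFDerivAt

theorem dS_sub_fst {F : ℝ × ℝ → ℝ} (hF : ContDiffOn ℝ ∞ F openHalf) {q : ℝ × ℝ} (hq : 0 < q.1) :
    dS (fun q => F q - q.1) q = dS F q - 1 ∧ dT (fun q => F q - q.1) q = dT F q := by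
  have h : HasFDerivAt (fun q => F q - q.1) _ q :=
    (hasFDerivAt_half hF hq).sub (ContinuousLinearMap.fst ℝ ℝ ℝ).hasFDerivAt
  unfold dS dT
  rw [h.fderiv]
  simp

theorem dS_sub_snd {F : ℝ × ℝ → ℝ} (hF : ContDiffOn ℝ ∞ F openHalf) {q : ℝ × ℝ} (hq : 0 < q.1) :
    dS (fun q => F q - q.2) q = dS F q ∧ dT (fun q => F q - q.2) q = dT F q - 1 := by
  have h : HasFDerivAt (fun q => F q - q.2) _ q :=
    (hasFDerivAt_half hF hq).sub (ContinuousLinearMap.snd ℝ ℝ ℝ).hasFDerivAt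
  unfold dS dT
  rw [h.fderiv]
  simp

theorem abs_dS_le (F : ℝ × ℝ → ℝ) (q : ℝ × ℝ) : |dS F q| ≤ ‖iteratedFDeriv ℝ 1 F q‖ := by
  rw [norm_iteratedFDeriv_one]
  have h := ContinuousLinearMap.le_opNorm (fderiv ℝ F q) (1, 0)
  rwa [show ‖((1, 0) : ℝ × ℝ)‖ = 1 by simp [Prod.norm_def], mul_one] at h

theorem abs_dT_le (F : ℝ × ℝ → ℝ) (q : ℝ × ℝ) : |dT F q| ≤ ‖iteratedFDeriv ℝ 1 F q‖ := by
  rw [norm_iteratedFDeriv_one]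
  have h := ContinuousLinearMap.le_opNorm (fderiv ℝ F q) (0, 1)
  rwa [show ‖((0, 1) : ℝ × ℝ)‖ = 1 by simp [Prod.norm_def], mul_one] at h

theorem HalfBdd.norm_iteratedFDeriv_one_le {F : ℝ × ℝ → ℝ} {B : ℕ → ℝ} (hF : HalfBdd 0 B F) {m : ℝ}
    (hm : ∀ q : ℝ × ℝ, 0 < q.1 → |F q| ≤ m) {q : ℝ × ℝ} (hq : 0 < q.1) :
    ‖iteratedFDeriv ℝ 1 F q‖ ≤ √(32 * m * B 2) := by
  refine Real.le_sqrt_of_sq_le ?_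
  refine landau_iteratedFDeriv hF.smooth 0 hq (fun p hp => ?_)
    (fun p hp => hF.bound 2 (Nat.zero_le 2) p (hq.trans_le hp)) le_rfl
  rw [norm_iteratedFDeriv_zero]
  exact hm p (hq.trans_le hp)

end

namespace Torus

theorem exists_twist_bounds (M : Torus) : ∃ K : ℝ, 0 ≤ K ∧ (∀ p, |M.twist p| ≤ K) ∧
    (∀ p : Pt, |p.2.2| ≤ 1 → ‖fderiv ℝ M.twist p‖ ≤ K) ∧
    ∀ p p' : Pt, |M.twist p - M.twist p'| ≤ K * max |p.1 - p'.1| |p.2.1 - p'.2.1| := by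
  -- The twist does not depend on y, so the values 2 and 1 are arbitrary.
  have hs := torusSmooth_twist (M := M) 2
  obtain ⟨K₀, h0, b0⟩ := hs.exists_bound M.T_pos (ρ' := 1) (by norm_num)
  obtain ⟨K₁, h1, b1⟩ := hs.fderiv.exists_bound M.T_pos (ρ' := 1) (by norm_num)
  refine ⟨K₀ + K₁, by positivity, fun p => ?_, fun p hp => (b1 p hp).trans (by linarith),
    fun p p' => ?_⟩
  · have := b0 (p.1, p.2.1, 0) (by simp)
    rw [Real.norm_eq_abs] at this
    change |M.twist (p.1, p.2.1, 0)| ≤ _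
    linarith
  · have hconv : Convex ℝ {p : Pt | |p.2.2| ≤ 1} := by
      have : {p : Pt | |p.2.2| ≤ 1} = ((ContinuousLinearMap.snd ℝ ℝ ℝ).comp
          (ContinuousLinearMap.snd ℝ ℝ (ℝ × ℝ))) ⁻¹' Set.Icc (-1) 1 := by
        ext p
        simp [abs_le]
      rw [this]
      exact (convex_Icc _ _).linear_preimage _
    have key := hconv.norm_image_sub_le_of_norm_fderiv_le (𝕜 := ℝ) (f := M.twist) (C := K₁)
      (fun p _ => (contDiff_twist (M := M)).differentiable (by simp) p) (fun p hp => b1 p hp)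
      (x := (p'.1, p'.2.1, 0)) (y := (p.1, p.2.1, 0))
      (show |(0 : ℝ)| ≤ 1 by simp) (show |(0 : ℝ)| ≤ 1 by simp)
    have e : ‖((p.1, p.2.1, 0) : Pt) - (p'.1, p'.2.1, 0)‖ = max |p.1 - p'.1| |p.2.1 - p'.2.1| := by
      simp [Prod.norm_def]
    rw [e, Real.norm_eq_abs] at key
    refine key.trans (mul_le_mul_of_nonneg_right (by linarith) ?_)
    exact (abs_nonneg _).trans (le_max_left _ _)

end Torus

/-- The quantity that controls the variation of the rotation rate along maps close to the torus. -/
noncomputable def variationBound (b₁ b₂ F₀ K C τ : ℝ) : ℝ :=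
  √(32 * τ * b₂) + τ * F₀ + K * τ + C * (2 * τ) * b₁

/-- Each quantity to be made small is continuous in τ and vanishes at τ = 0. -/
theorem exists_small_parameter (b₁ b₂ F₀ K C T : ℝ) {μ c₀ ρ : ℝ} (hμ : 0 < μ) (hc : 0 < c₀)
    (hρ : 0 < ρ) : ∃ τ : ℝ, 0 < τ ∧ τ ≤ 1 ∧ τ ≤ ρ ∧ τ * F₀ ≤ 1 ∧ τ * F₀ * 3 ≤ μ ∧
      C * (2 * τ) ≤ μ ∧ K * variationBound b₁ b₂ F₀ K C τ ≤ μ ∧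
      K * (τ + T * variationBound b₁ b₂ F₀ K C τ) * T ≤ c₀ := by
  have hv : Continuous (variationBound b₁ b₂ F₀ K C) := by
    unfold variationBound
    fun_prop
  have hv0 : variationBound b₁ b₂ F₀ K C 0 = 0 := by simp [variationBound]
  have ev : ∀ {φ : ℝ → ℝ} {m : ℝ}, Continuous φ → φ 0 = 0 → 0 < m →
      ∀ᶠ τ in 𝓝[>] (0 : ℝ), φ τ ≤ m := by
    intro φ m hφ h0 hm
    have : Tendsto φ (𝓝[>] 0) (𝓝 0) := (hφ.tendsto' 0 0 h0).mono_left nhdsWithin_le_nhds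
    exact (this.eventually_lt_const hm).mono fun _ h => h.le
  have pos : ∀ᶠ τ in 𝓝[>] (0 : ℝ), 0 < τ := self_mem_nhdsWithin
  have h := (pos.and <|
    (ev continuous_id rfl one_pos).and <| (ev continuous_id rfl hρ).and <|
    (ev (φ := fun τ => τ * F₀) (by fun_prop) (by simp) one_pos).and <|
    (ev (φ := fun τ => τ * F₀ * 3) (by fun_prop) (by simp) hμ).and <|
    (ev (φ := fun τ => C * (2 * τ)) (by fun_prop) (by simp) hμ).and <|
    (ev (φ := fun τ => K * variationBound b₁ b₂ F₀ K C τ) (by fun_prop) (by simp [hv0]) hμ).and <|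
    (ev (φ := fun τ => K * (τ + T * variationBound b₁ b₂ F₀ K C τ) * T) (by fun_prop)
      (by simp [hv0]) hc)).exists
  obtain ⟨τ, h⟩ := h
  exact ⟨τ, h⟩

/-- Holomorphic half-cylinders close to the torus satisfy the perturbed Cauchy-Riemann equations
with small errors. -/
theorem Torus.exists_cylinderData (M : Torus) : ∃ K c₀ : ℝ, 0 ≤ K ∧ 0 < c₀ ∧
    ∀ f : ℝ → ℝ, IsPerturbingFunction f → ∀ (k : ℕ) (B : ℕ → ℝ) (μ : ℝ), 0 < μ →
      μ * (2 * (1 + K) + 1 + 4 * M.T) * coerciveConst M.T K c₀ ≤ 1 →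
      ∃ (τ : ℝ) (B' : ℕ → ℝ), 0 < τ ∧ τ ≤ 1 ∧ ∀ δ : ℝ, 0 < δ → δ < τ → ∀ u : ℝ × ℝ → SPt,
        IsHolomorphic M f δ u → IsClose k τ B u →
        CylinderData M.T K c₀ μ B' (fun v => Real.exp (δ * f v) - 1) (fun v => δ * deriv f v)
          (fun q => aC u q - q.1) (fun q => zC u q - q.2) (xC u) (yC u) (twistC M u) := by
  obtain ⟨K, hK, bK, bK1, bK2⟩ := M.exists_twist_bounds
  obtain ⟨c, hc, hint⟩ := Torus.exists_integral_twist_bound (M := M)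
  -- Half of the Morse-Bott constant is given up when κ along the orbit is replaced by κ along the
  -- map.
  refine ⟨K, c / 2, hK, by positivity, fun f hf k B μ hμ hsmall => ?_⟩
  obtain ⟨F₀, hF, hf0, hf1, hf2⟩ := hf.exists_bound
  obtain ⟨C, hC, heq⟩ := M.exists_equations hf hF hf0 hf1
  choose A hA0 hA using fun i => (torusSmooth_twist (M := M) 2).exists_bound_iteratedFDeriv M.T_pos
    (ρ' := 1) (by norm_num) i
  set b := closeBound B
  have hb : ∀ n, 0 ≤ b n := fun n => by unfold b closeBound; positivity
  have hT := M.T_pos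
  obtain ⟨τ, hτ, hτ1, hτρ, hτF, hτF3, hτC, hτν, hτc⟩ := exists_small_parameter (4 * b 1 + 2)
    (b 2 + 1) F₀ K C M.T hμ (half_pos hc) (half_pos M.ρ_pos)
  set ν := variationBound (4 * b 1 + 2) (b 2 + 1) F₀ K C τ with hν
  refine ⟨τ, fun n => b n + 1 + |compBound A (positionBound B) n|, hτ, hτ1,
    fun δ hδ hδτ u hu hcl => ?_⟩
  have hs := hu.smooth_half
  have ba := hcl.a_sub_bdd hs
  have bw := hcl.z_sub_bdd hτ1 hs
  have bx := hcl.xC_bdd hτ1 hs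
  have by' := hcl.yC_bdd hτ1 hs
  have hy : ∀ q : ℝ × ℝ, 0 < q.1 → |yC u q| ≤ τ := fun q hq => hcl.abs_yC_le hq
  have bκ : HalfBdd 0 (compBound A (positionBound B)) (twistC M u) :=
    (hcl.position_bdd hτ1 hs).comp (g := M.twist) isOpen_univ contDiff_twist.contDiffOn
      (fun _ _ => Set.mem_univ _) fun i q hq => hA i _ ((hy q hq).trans hτ1)
  have hδF : δ * F₀ ≤ τ * F₀ := mul_le_mul_of_nonneg_right hδτ.le hF
  have hsd : √(32 * τ * b 2) ≤ √(32 * τ * (b 2 + 1)) :=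
    Real.sqrt_le_sqrt (by nlinarith)
  set η := √(32 * τ * (b 2 + 1))
  have hη : 0 ≤ η := Real.sqrt_nonneg _
  have hCτ : 0 ≤ C * (2 * τ) * (4 * b 1 + 2) := by have := hb 1; positivity
  have hτF0 : 0 ≤ τ * F₀ := by positivity
  have hKτ : 0 ≤ K * τ := by positivity
  have hνeq : ν = η + τ * F₀ + K * τ + C * (2 * τ) * (4 * b 1 + 2) := rfl
  have hν0 : 0 ≤ ν := by linarith
  -- Smallness of first derivatives of z - t is not assumed, nor that of y when k = 0. It follows
  -- from smallness of the functions and the bounds of order two, by Landau's inequality.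
  have dw : ∀ q : ℝ × ℝ, 0 < q.1 → ‖iteratedFDeriv ℝ 1 (fun q => zC u q - q.2) q‖ ≤ η :=
    fun q hq => bw.norm_iteratedFDeriv_one_le (fun p hp => hcl.z_close p hp) hq
  have dy : ∀ q : ℝ × ℝ, 0 < q.1 → ‖iteratedFDeriv ℝ 1 (yC u) q‖ ≤ η :=
    fun q hq => (by'.norm_iteratedFDeriv_one_le hy hq).trans hsd
  -- The error R is estimated twice: relative to the derivatives, for the decay argument, and by a
  -- small constant, for the derivatives of x. In 4 b₁ + 2, each of the four t-derivatives
  -- contributes b₁, the shift by 1 in z - t contributes 1, and |y| ≤ 1.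
  have eqs : ∀ q : ℝ × ℝ, 0 < q.1 → ∃ R : ℝ,
      R ≤ μ * (|dT (fun q => aC u q - q.1) q| + |dT (fun q => zC u q - q.2) q| + |dT (xC u) q|
        + |dT (yC u) q| + |yC u q|) ∧ R ≤ C * (2 * τ) * (4 * b 1 + 2) ∧
      |dS (fun q => aC u q - q.1) q - (Real.exp (δ * f (xC u q)) - 1)
        - dT (fun q => zC u q - q.2) q| ≤ R ∧
      |dS (fun q => zC u q - q.2) q + dT (fun q => aC u q - q.1) q| ≤ R ∧
      |dS (xC u) q - δ * deriv f (xC u q) - dT (yC u) q| ≤ R ∧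
      |dS (yC u) q + dT (xC u) q - twistC M u q * yC u q| ≤ R := by
    intro q hq
    obtain ⟨ea1, ea2⟩ := dS_sub_fst (contDiffOn_aC hs) hq
    obtain ⟨ew1, ew2⟩ := dS_sub_snd (contDiffOn_zC hs) hq
    obtain ⟨e1, e2, e3, e4⟩ := heq δ hδ.le (hδF.trans hτF) u hu q hq ((hy q hq).trans hτρ) _ rfl
    have hfac : C * (δ + |yC u q|) ≤ C * (2 * τ) :=
      mul_le_mul_of_nonneg_left (by linarith [hy q hq]) hC
    have h1 : |dT (aC u) q| ≤ b 1 :=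
      (abs_dT_le _ q).trans ((hcl.aC_bdd hs).bound 1 le_rfl q hq)
    have h2 : |dT (zC u) q| ≤ b 1 :=
      (abs_dT_le _ q).trans ((hcl.zC_bdd hs).bound 1 le_rfl q hq)
    have h3 : |dT (xC u) q| ≤ b 1 := (abs_dT_le _ q).trans (bx.bound 1 le_rfl q hq)
    have h4 : |dT (yC u) q| ≤ b 1 := (abs_dT_le _ q).trans (by'.bound 1 (Nat.zero_le 1) q hq)
    have h5 := abs_sub (dT (zC u) q) 1
    rw [abs_one] at h5
    have h6 := hy q hq
    refine ⟨_, ?_, ?_, ?_, ?_, e3, e4⟩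
    · rw [ea2, ew2]
      exact mul_le_mul_of_nonneg_right (hfac.trans hτC) (by positivity)
    · exact mul_le_mul hfac (by linarith) (by positivity) (by positivity)
    · rw [ea1, ew2, show dS (aC u) q - 1 - (Real.exp (δ * f (xC u q)) - 1) - (dT (zC u) q - 1)
        = dS (aC u) q - Real.exp (δ * f (xC u q)) - (dT (zC u) q - 1) by ring]
      exact e1
    · rw [ea2, ew1]
      exact e2
  -- Here Landau's inequality is of no use, as x itself is not near a constant. The equations
  -- express ∂_s x and ∂_t x through derivatives of y and small terms.
  have sx : ∀ q : ℝ × ℝ, 0 < q.1 → |dS (xC u) q| ≤ ν ∧ |dT (xC u) q| ≤ ν := by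
    intro q hq
    obtain ⟨R, -, hR, -, -, e3, e4⟩ := eqs q hq
    have h1 := (abs_dT_le (yC u) q).trans (dy q hq)
    have h2 := (abs_dS_le (yC u) q).trans (dy q hq)
    have h3 : |δ * deriv f (xC u q)| ≤ τ * F₀ := by
      rw [abs_mul, abs_of_pos hδ]
      exact (mul_le_mul_of_nonneg_left (hf1 _) hδ.le).trans hδF
    have h4 : |twistC M u q * yC u q| ≤ K * τ := by
      rw [abs_mul]
      exact mul_le_mul (bK _) (hy q hq) (abs_nonneg _) hK
    have e3' := abs_le.1 e3
    have e4' := abs_le.1 e4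
    have h1' := abs_le.1 h1
    have h2' := abs_le.1 h2
    have h3' := abs_le.1 h3
    have h4' := abs_le.1 h4
    exact ⟨abs_le.2 ⟨by linarith [e3'.1, h1'.1, h3'.1], by linarith [e3'.2, h1'.2, h3'.2]⟩,
      abs_le.2 ⟨by linarith [e4'.1, h2'.2, h4'.1], by linarith [e4'.2, h2'.1, h4'.2]⟩⟩
  refine
    { T_pos := hT
      c₀_pos := half_pos hc
      μ_nonneg := hμ.le
      small := hsmall
      a_bdd := ba.mono le_rfl fun n _ => le_add_of_nonneg_right (abs_nonneg _)
      w_bdd := bw.mono le_rfl fun n _ => le_add_of_nonneg_right (abs_nonneg _)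
      x_bdd := bx.mono le_rfl fun n _ => by
        linarith [abs_nonneg (compBound A (positionBound B) n)]
      y_bdd := by'.mono le_rfl fun n _ => by
        linarith [abs_nonneg (compBound A (positionBound B) n)]
      κ_bdd := bκ.mono le_rfl fun n _ => by
        linarith [le_abs_self (compBound A (positionBound B) n), hb n]
      a_per := fun s t h => ?_
      w_per := fun s t h => ?_
      x_per := fun s t h => ?_
      y_per := fun s t h => ?_
      abs_κ_le := fun q _ => bK _
      abs_dS_κ_le := fun q hq => ?_
      integral_κ := fun s h => ?_
      cont_g₀ := ?_
      cont_g₁ := ?_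
      lip_g₀ := ?_
      lip_g₁ := ?_
      eq_a := fun q hq => ?_
      eq_w := fun q hq => ?_
      eq_x := fun q hq => ?_
      eq_y := fun q hq => ?_ }
  · simp [aC, hu.periodic s t h.le]
  · simp only [zC, hu.periodic s t h.le, Prod.snd_add, Prod.fst_add]
    ring
  · simp [xC, hu.periodic s t h.le]
  · simp [yC, hu.periodic s t h.le]
  · have hp := (contDiffAt_of_half (hcl.position_bdd hτ1 hs).smooth hq).differentiableAt
      (by simp) |>.hasFDerivAt
    have ht := (contDiff_twist (M := M)).differentiable (by simp) (u q).2 |>.hasFDerivAt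
    have hd : HasFDerivAt (twistC M u) _ q := ht.comp q hp
    have hp' : HasFDerivAt (fun q => (u q).2) _ q :=
      (hasFDerivAt_half (contDiffOn_zC hs) hq).prodMk
        ((hasFDerivAt_half (contDiffOn_xC hs) hq).prodMk (hasFDerivAt_half (contDiffOn_yC hs) hq))
    unfold dS
    rw [hd.fderiv, ContinuousLinearMap.comp_apply, hp'.fderiv]
    refine (ContinuousLinearMap.le_of_opNorm_le _ (bK1 _ ((hy q hq).trans hτ1)) _).trans
      (le_trans (mul_le_mul_of_nonneg_left ?_ hK) hτν)
    have h1 : |dS (zC u) q| ≤ ν := by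
      rw [← (dS_sub_snd (contDiffOn_zC hs) hq).1]
      exact (abs_dS_le _ q).trans ((dw q hq).trans (by linarith))
    have h2 : |dS (yC u) q| ≤ ν := (abs_dS_le _ q).trans ((dy q hq).trans (by linarith))
    exact max_le h1 (max_le (sx q hq).1 h2)
  · have hκ := continuous_slice_smooth bκ.smooth h
    have ht : Continuous fun t : ℝ => M.twist (t, xC u (s, 0), 0) :=
      contDiff_twist.continuous.comp (by fun_prop)
    -- The twist along the map is compared with that along the orbit t ↦ (t, x(s, 0), 0), using |z -
    -- t| ≤ τ and the small oscillation of x.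
    have hpt : ∀ t ∈ Set.uIoc 0 M.T,
        ‖M.twist (t, xC u (s, 0), 0) - twistC M u (s, t)‖ ≤ K * (τ + M.T * ν) := by
      intro t ht'
      rw [Set.uIoc_of_le hT.le] at ht'
      have h1 : |t - zC u (s, t)| ≤ τ := by
        rw [abs_sub_comm]
        exact hcl.z_close (s, t) h
      have h2 : |xC u (s, 0) - xC u (s, t)| ≤ M.T * ν := by
        have h3 := (convex_univ (𝕜 := ℝ) (E := ℝ)).norm_image_sub_le_of_norm_hasDerivWithin_le
          (f := fun t => xC u (s, t)) (C := ν)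
          (fun t _ => (hasDerivAt_dT (contDiffOn_xC hs) h t).hasDerivWithinAt)
          (fun t _ => (sx (s, t) h).2) (Set.mem_univ t) (Set.mem_univ 0)
        refine h3.trans ?_
        rw [zero_sub, norm_neg, Real.norm_eq_abs, abs_of_pos ht'.1, mul_comm]
        exact mul_le_mul_of_nonneg_right ht'.2 hν0
      refine (bK2 _ _).trans (mul_le_mul_of_nonneg_left (max_le ?_ ?_) hK)
      · exact h1.trans (by have := mul_nonneg hT.le hν0; linarith)
      · exact h2.trans (by linarith)
    have h1 := intervalIntegral.norm_integral_le_of_norm_le_const hpt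
    rw [intervalIntegral.integral_sub (ht.intervalIntegrable _ _) (hκ.intervalIntegrable _ _),
      sub_zero, abs_of_pos hT, Real.norm_eq_abs] at h1
    have h2 := hint (xC u (s, 0))
    have h3 := abs_sub_abs_le_abs_sub (∫ t in (0 : ℝ)..M.T, M.twist (t, xC u (s, 0), 0))
      (∫ t in (0 : ℝ)..M.T, twistC M u (s, t))
    linarith
  · exact (Real.continuous_exp.comp (continuous_const.mul hf.smooth.continuous)).sub
      continuous_const
  · exact continuous_const.mul (contDiff_infty_iff_deriv.1 hf.smooth).2.continuous
  · have hd : ∀ v, HasDerivAt (fun v => Real.exp (δ * f v) - 1)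
        (Real.exp (δ * f v) * (δ * deriv f v)) v := fun v =>
      ((((contDiff_infty_iff_deriv.1 hf.smooth).1 v).hasDerivAt.const_mul δ).exp).sub_const 1
    refine abs_sub_le_of_abs_deriv_le hd fun v => ?_
    have h1 : Real.exp (δ * f v) ≤ 3 := by
      have h2 : δ * f v ≤ 1 := (mul_le_mul_of_nonneg_left ((le_abs_self _).trans (hf0 v))
        hδ.le).trans (hδF.trans hτF)
      have h3 := Real.exp_one_lt_d9
      exact (Real.exp_le_exp.2 h2).trans (by linarith)
    rw [abs_mul, Real.abs_exp, abs_mul, abs_of_pos hδ]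
    have h3 : δ * |deriv f v| ≤ τ * F₀ := (mul_le_mul_of_nonneg_left (hf1 v) hδ.le).trans hδF
    have h4 : 0 ≤ δ * |deriv f v| := by positivity
    have h5 := mul_le_mul h1 h3 h4 (by norm_num)
    linarith
  · have hd' : Differentiable ℝ (deriv f) :=
      (contDiff_infty_iff_deriv.1 (contDiff_infty_iff_deriv.1 hf.smooth).2).1
    refine abs_sub_le_of_abs_deriv_le (fun v => (hd' v).hasDerivAt.const_mul δ) fun v => ?_
    rw [abs_mul, abs_of_pos hδ]
    have := (mul_le_mul_of_nonneg_left (hf2 v) hδ.le).trans hδF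
    linarith
  · obtain ⟨R, h1, -, e1, -, -, -⟩ := eqs q hq
    exact e1.trans h1
  · obtain ⟨R, h1, -, -, e2, -, -⟩ := eqs q hq
    exact e2.trans h1
  · obtain ⟨R, h1, -, -, -, e3, -⟩ := eqs q hq
    exact e3.trans h1
  · obtain ⟨R, h1, -, -, -, -, e4⟩ := eqs q hq
    exact e4.trans h1

end MorseBott

namespace MorseBott

/-! ## Behaviour at the boundary of the half-cylinder -/

/-- Freezing F at s = 0 for negative s extends it continuously to the plane, so that continuity of
parametric integrals applies up to the boundary. -/
theorem continuousOn_circle_integral (T : ℝ) {F : ℝ × ℝ → ℝ} (hF : ContinuousOn F {q | 0 ≤ q.1}) :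
    ContinuousOn (fun s => ∫ t in (0 : ℝ)..T, F (s, t)) (Set.Ici 0) := by
  have h1 : Continuous fun q : ℝ × ℝ => F (max q.1 0, q.2) :=
    hF.comp_continuous (by fun_prop) fun q =>
      show (0 : ℝ) ≤ max q.1 0 from le_max_right _ _
  have h2 : Continuous fun s => ∫ t in (0 : ℝ)..T, F (max s 0, t) :=
    intervalIntegral.continuous_parametric_intervalIntegral_of_continuous'
      (f := fun s t => F (max s 0, t)) h1 0 T
  refine h2.continuousOn.congr fun s hs => ?_
  simp only [max_eq_left (Set.mem_Ici.1 hs)]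

theorem continuousOn_qPart (T : ℝ) {F : ℝ × ℝ → ℝ} (hF : ContinuousOn F {q | 0 ≤ q.1}) :
    ContinuousOn (qPart T F) {q | 0 ≤ q.1} :=
  hF.sub (((continuousOn_circle_integral T hF).div_const T).comp continuousOn_fst fun _ hq => hq)

theorem tendsto_qNorm (T : ℝ) {a w x y : ℝ × ℝ → ℝ} (ha : ContinuousOn a {q | 0 ≤ q.1})
    (hw : ContinuousOn w {q | 0 ≤ q.1}) (hx : ContinuousOn x {q | 0 ≤ q.1})
    (hy : ContinuousOn y {q | 0 ≤ q.1}) :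
    Tendsto (qNorm T a w x y) (𝓝[>] 0) (𝓝 (qNorm T a w x y 0)) := by
  have h := (continuousOn_circle_integral T (((((continuousOn_qPart T ha).pow 2).add
    ((continuousOn_qPart T hw).pow 2)).add ((continuousOn_qPart T hx).pow 2)).add (hy.pow 2))).sqrt
  exact (h 0 Set.self_mem_Ici).mono Set.Ioi_subset_Ici_self

variable {u : ℝ × ℝ → SPt}

theorem mapQY_eq (T : ℝ) (u : ℝ × ℝ → SPt) : mapQY T u = fun q =>
    (qPart T (fun q => aC u q - q.1) q, qPart T (fun q => zC u q - q.2) q, qPart T (xC u) q,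
      yC u q) := by
  funext q
  simp only [mapQY, mapPY, mapY, qPart, Prod.mk_sub_mk, sub_zero]

theorem normL2_mapQY (T : ℝ) (u : ℝ × ℝ → SPt) (s : ℝ) : normL2 T (mapQY T u) s
    = qNorm T (fun q => aC u q - q.1) (fun q => zC u q - q.2) (xC u) (yC u) s := by
  rw [mapQY_eq]
  rfl

theorem tendsto_normL2 (T : ℝ) (hu : ContinuousOn u {q | 0 ≤ q.1}) :
    Tendsto (qNorm T (fun q => aC u q - q.1) (fun q => zC u q - q.2) (xC u) (yC u)) (𝓝[>] 0)
      (𝓝 (normL2 T (mapQY T u) 0)) := by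
  rw [normL2_mapQY]
  exact tendsto_qNorm T (hu.fst.sub continuousOn_fst) (hu.snd.fst.sub continuousOn_snd)
    hu.snd.snd.fst hu.snd.snd.snd

/-- The choice of the interpolation exponent. -/
theorem exists_exponent {p : ℝ} (hp : 2 < p) : ∃ θ : ℝ, 0 < θ ∧ θ < 1 ∧ 2 / p ≤ θ * θ * θ * θ ∧
    1 / 2 ≤ θ * θ * θ ∧ 1 / 2 ≤ θ * θ := by
  have hp0 : 0 < p := by linarith
  -- θ is the fourth root of v, since the argument ends with the power θ⁴. The entry 1/2 keeps θ
  -- away from 0, so that the rate does not depend on p.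
  set v := max (2 / p) (1 / 2)
  have hv0 : 0 < v := lt_max_of_lt_right (by norm_num)
  have hv1 : v < 1 := max_lt ((div_lt_one hp0).2 hp) (by norm_num)
  set θ := v ^ (1 / 4 : ℝ)
  have h0 : 0 < θ := Real.rpow_pos_of_pos hv0 _
  have h1 : θ < 1 := Real.rpow_lt_one hv0.le hv1 (by norm_num)
  have h4 : θ * θ * θ * θ = v := by
    have : θ ^ 4 = v := by
      rw [← Real.rpow_natCast, ← Real.rpow_mul hv0.le]
      norm_num
    rw [← this]
    ring
  have hv2 : 1 / 2 ≤ θ * θ * θ * θ := h4 ▸ le_max_right _ _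
  have h3 : θ * θ * θ * θ ≤ θ * θ * θ := mul_le_of_le_one_right (by positivity) h1.le
  have h2 : θ * θ * θ ≤ θ * θ := mul_le_of_le_one_right (by positivity) h1.le
  exact ⟨θ, h0, h1, h4 ▸ le_max_left _ _, hv2.trans h3, (hv2.trans h3).trans h2⟩

end MorseBott

/-! ### The theorem -/

theorem mainTheorem6 (M : MorseBott.Torus) :
    ∃ r : ℝ, 0 < r ∧
    ∀ f : ℝ → ℝ, MorseBott.IsPerturbingFunction f →
    ∀ (k : ℕ) (η : ℝ) (B : ℕ → ℝ), 0 < η →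
    ∃ ε δ₀ : ℝ, 0 < ε ∧ 0 < δ₀ ∧
    ∀ p : ℝ, 2 < p →
    ∃ C : ℝ, 0 < C ∧
    ∀ δ : ℝ, 0 < δ → δ < δ₀ →
    ∀ (u : ℝ × ℝ → MorseBott.SPt) (x₀ : ℝ),
      MorseBott.IsHolomorphic M f δ u →
      deriv f x₀ = 0 →
      MorseBott.ConvergesToOrbit u x₀ →
      MorseBott.StaysAway f η x₀ u →
      MorseBott.IsClose k ε B u →
      MorseBott.ExpSmall k
        (C * MorseBott.normL2 M.T (MorseBott.mapQY M.T u) 0 ^ (2 / p)) r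
        (MorseBott.mapQY M.T u) ∧
      MorseBott.ExpSmall k
        (C * MorseBott.normL2 M.T (MorseBott.mapQY M.T u) 0 ^ (2 / p)) r
        (MorseBott.yC u) ∧
      (∃ c : ℝ, MorseBott.ExpSmall k
        (C * MorseBott.normL2 M.T (MorseBott.mapQY M.T u) 0 ^ (2 / p)) r
        (fun q => MorseBott.zC u q - q.2 + c)) ∧
      ∃ ξ : ℝ → ℝ, MorseBott.IsGradientTrajectory f δ ξ ∧
        MorseBott.ExpSmall k
          (C * MorseBott.normL2 M.T (MorseBott.mapQY M.T u) 0 ^ (2 / p)) r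
          (fun q => MorseBott.xC u q - ξ q.1) ∧
        ∀ s₀ : ℝ, ∃ c : ℝ, MorseBott.ExpSmall k
          (C * MorseBott.normL2 M.T (MorseBott.mapQY M.T u) 0 ^ (2 / p)) r
          (fun q => MorseBott.aC u q - c
            - ∫ s' in s₀..q.1, Real.exp (δ * f (ξ s'))) := by
  obtain ⟨K, c₀, hK, hc₀, bridge⟩ := M.exists_cylinderData
  have hT := M.T_pos
  have hR := MorseBott.energyRate_pos hT hK hc₀
  set R := MorseBott.energyRate M.T K c₀
  -- The rate obtained below is θ³ R / 2, and θ³ ≥ 1/2 for every p.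
  refine ⟨R / 4, by positivity, fun f hf k η B _ => ?_⟩
  obtain ⟨A, hA⟩ := hf.exists_bound_fields
  have hco := MorseBott.coerciveConst_pos hT hK hc₀
  set V := (2 * (1 + K) + 1 + 4 * M.T) * MorseBott.coerciveConst M.T K c₀ with hV
  have hV0 : 0 < V := by positivity
  -- Here 1 / V serves to absorb the errors in the energy estimate, and R / 8 to shadow approximate
  -- trajectories: it is at most half of the rate θ² R / 2, as θ² ≥ 1/2. Thus μ, and with it ε and
  -- δ₀, is fixed before p.
  obtain ⟨μ, hμ, hμ1, hμR, hμV⟩ : ∃ μ : ℝ, 0 < μ ∧ μ ≤ 1 ∧ μ ≤ R / 8 ∧ μ ≤ 1 / V :=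
    ⟨min 1 (min (R / 8) (1 / V)), by positivity, min_le_left _ _,
      (min_le_right _ _).trans (min_le_left _ _), (min_le_right _ _).trans (min_le_right _ _)⟩
  obtain ⟨τ, B', hτ, hτ1, hdata⟩ := bridge f hf k B μ hμ (by
    rw [mul_assoc, ← hV]
    exact (le_div_iff₀ hV0).1 hμV)
  refine ⟨τ, τ, hτ, hτ, fun p hp => ?_⟩
  obtain ⟨θ, h0, h1, hθp, hθ3, hθ2⟩ := MorseBott.exists_exponent hp
  obtain ⟨C, hC, H⟩ := MorseBott.exists_cylinder_asymptotics hT hK hc₀ h0 h1 A B' k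
  set N := MorseBott.qNormBound M.T B'
  have hN : 0 ≤ N := MorseBott.qNormBound_nonneg _ _
  -- The factor N^{θ⁴ - 2/p} pays for lowering the power θ⁴ of the bounded norm to 2/p; the summand
  -- 1 only ensures positivity.
  refine ⟨C * N ^ (θ * θ * θ * θ - 2 / p) + 1, by positivity,
    fun δ hδ hδτ u x₀ hu _ _ _ hcl => ?_⟩
  have h := hdata δ hδ hδτ u hu hcl
  have hm := MorseBott.tendsto_normL2 M.T hu.smooth.continuousOn
  set m := MorseBott.normL2 M.T (MorseBott.mapQY M.T u) 0
  obtain ⟨hm0, hmN⟩ := h.limit_qNorm_mem hm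
  have sf : ContDiff ℝ ∞ (deriv f) := (contDiff_infty_iff_deriv.1 hf.smooth).2
  have sg : ContDiff ℝ ∞ fun v => Real.exp (δ * f v) - 1 :=
    (Real.contDiff_exp.comp (contDiff_const.mul hf.smooth)).sub contDiff_const
  have hμθ : μ ≤ θ * (θ * R / 2) / 2 := by nlinarith
  obtain ⟨hq, ⟨c, hz⟩, ξ, hξ, hx, ha⟩ := H h hμ1 hμθ sg (contDiff_const.mul sf)
    (hA δ hδ.le (hδτ.le.trans hτ1)).1 (hA δ hδ.le (hδτ.le.trans hτ1)).2 m hm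
  have hmp : 0 ≤ m ^ (2 / p) := Real.rpow_nonneg hm0 _
  have hconst : C * m ^ (θ * θ * θ * θ) ≤ (C * N ^ (θ * θ * θ * θ - 2 / p) + 1) * m ^ (2 / p) := by
    have h2 := MorseBott.rpow_le_mul_rpow hm0 hmN (by positivity : 0 < 2 / p) hθp
    have h3 := mul_le_mul_of_nonneg_left h2 hC.le
    linarith
  have hrate : R / 4 ≤ θ * (θ * (θ * R / 2)) := by nlinarith
  have up : ∀ {F : ℝ × ℝ → ℝ},
      MorseBott.ExpSmall k (C * m ^ (θ * θ * θ * θ)) (θ * (θ * (θ * R / 2))) F →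
      MorseBott.ExpSmall k ((C * N ^ (θ * θ * θ * θ - 2 / p) + 1) * m ^ (2 / p)) (R / 4) F :=
    fun hF => hF.mono le_rfl hconst (by positivity) hrate
  have sx := h.qx_bdd.smooth
  have sw := h.qw_bdd.smooth
  have sa := h.qa_bdd.smooth
  have sy := h.y_bdd.smooth
  refine ⟨?_, up (hq _ (by simp)), ⟨c, up hz⟩, ξ, hξ, up hx, fun s₀ => ?_⟩
  · rw [MorseBott.mapQY_eq]
    have e₁ := up (hq (MorseBott.qPart M.T fun q => MorseBott.aC u q - q.1) (by simp))
    have e₂ := up (hq (MorseBott.qPart M.T fun q => MorseBott.zC u q - q.2) (by simp))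
    have e₃ := up (hq (MorseBott.qPart M.T (MorseBott.xC u)) (by simp))
    have e₄ := up (hq (MorseBott.yC u) (by simp))
    exact e₁.prodMk (e₂.prodMk (e₃.prodMk e₄ sx sy) sw (sx.prodMk sy)) sa
      (sw.prodMk (sx.prodMk sy))
  · obtain ⟨c, hc⟩ := ha s₀
    -- The asymptotics found concern a - s and the integral of e^{δ f} - 1; integrating the constant
    -- 1 from s₀ to s cancels the s and leaves s₀.
    refine ⟨c + s₀, (up hc).congr fun q _ => ?_⟩
    have hcont : Continuous fun s => Real.exp (δ * f (ξ s)) :=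
      Real.continuous_exp.comp (continuous_const.mul (hf.smooth.continuous.comp
        (continuous_iff_continuousAt.2 fun s => (hξ s).continuousAt)))
    rw [intervalIntegral.integral_sub (hcont.intervalIntegrable _ _) intervalIntegrable_const,
      intervalIntegral.integral_const, smul_eq_mul, mul_one]
    ring
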